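/- Let $q$ be a power of a prime, and let $A,B,C,D\in\mathbb{F}_q$ satisfy $C\neq 0$, $B^2-4A=0$, $$A^3-A^2C-ABD+AB+AC^2-BC+D^2-D+1=0,$$ $AC^2-BCD+D^2\neq 0$, $A^3-2A^2C+AB+AC^2-BC+1\neq 0$, $A^3-AB^2C+AB+B^2C^2-2BC+1\neq 0$, $B^3+8\neq 0$ and $AB-3BC+2C^3+2\neq 0$. Let $\mu_{q^2+q+1}=\{t\in\mathbb{F}_{q^3}: t^{q^2+q+1}=1\}$, and assume that $$m_{A,B,C,D}(t)=\lambda_1t^3+\lambda_2t^2+\lambda_3t+\lambda_4\in\mathbb{F}_q[t]$$ has no roots in $\mu_{q^2+q+1}$ (that is, $m_{A,B,C,D}(t)\neq 0$ for every $t\in\mu_{q^2+q+1}$), where $\lambda_1,\lambda_2,\lambda_3,\lambda_4$ are the values at $(A,B,C,D)$ of the integer polynomials listed below. Then $$f(x)=x^{q^2+q-1}+Ax^{q^2-q+1}+Bx^{q^2}+Cx^q+Dx$$ is a permutation polynomial over $\mathbb{F}_{q^3}$, that is, $c\mapsto f(c)$ is a bijection of $\mathbb{F}_{q^3}$. The polynomials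 are $\lambda_4=-\lambda_1$ and $$\lambda_1=\begin{aligned} &A^{2}B^{5}C^{6}D^{3}+2A^{2}B^{5}C^{6}D^{2}+3A^{2}B^{5}C^{6}D-2A^{2}B^{5}C^{6}\\ &+3A^{2}B^{4}C^{8}D^{2}-8A^{2}B^{4}C^{8}D-11A^{2}B^{4}C^{8}-6A^{2}B^{4}C^{5}D^{3}-12A^{2}B^{4}C^{5}D^{2}+12A^{2}B^{4}C^{5}D-4A^{2}B^{4}C^{5}\\ &-6A^{2}B^{3}C^{10}D^{2}-27A^{2}B^{3}C^{10}D-6A^{2}B^{3}C^{10}-3A^{2}B^{3}C^{7}D^{4}-10A^{2}B^{3}C^{7}D^{3}+61A^{2}B^{3}C^{7}D^{2}+20A^{2}B^{3}C^{7}D+5A^{2}B^{3}C^{7}+15A^{2}B^{3}C^{4}D^{3}-30A^{2}B^{3}C^{4}D^{2}+15A^{2}B^{3}C^{4}D\\ &-2A^{2}B^{2}C^{12}D^{2}+15A^{2}B^{2}C^{12}+22A^{2}B^{2}C^{9}D^{3}+66A^{2}B^{2}C^{9}D^{2}-24A^{2}B^{2}C^{9}D+38A^{2}B^{2}C^{9}+A^{2}B^{2}C^{6}D^{6}+2A^{2}B^{2}C^{6}D^{5}+21A^{2}B^{2}C^{6}D^{4}-130A^{2}B^{2}C^{6}D^{3}+28A^{2}B^{2}C^{6}D^{2}-60A^{2}B^{2}C^{6}D+15A^{2}B^{2}C^{6}+40A^{2}B^{2}C^{3}D^{3}-20A^{2}B^{2}C^{3}D^{2}\\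 &+3A^{2}BC^{14}D+4A^{2}BC^{14}+8A^{2}BC^{11}D^{3}-12A^{2}BC^{11}D^{2}-30A^{2}BC^{11}D+3A^{2}BC^{11}+3A^{2}BC^{8}D^{5}-36A^{2}BC^{8}D^{4}-47A^{2}BC^{8}D^{3}+66A^{2}BC^{8}D^{2}-69A^{2}BC^{8}D-4A^{2}BC^{8}-6A^{2}BC^{5}D^{6}-12A^{2}BC^{5}D^{5}+131A^{2}BC^{5}D^{4}-122A^{2}BC^{5}D^{3}+135A^{2}BC^{5}D^{2}-36A^{2}BC^{5}D+A^{2}BC^{5}-30A^{2}BC^{2}D^{4}+10A^{2}BC^{2}D^{3}\\ &-A^{2}C^{16}-6A^{2}C^{13}D^{2}+6A^{2}C^{13}D-6A^{2}C^{13}-9A^{2}C^{10}D^{4}+30A^{2}C^{10}D^{3}-24A^{2}C^{10}D^{2}+30A^{2}C^{10}D-9A^{2}C^{10}-4A^{2}C^{7}D^{6}+30A^{2}C^{7}D^{5}-30A^{2}C^{7}D^{4}+32A^{2}C^{7}D^{3}-30A^{2}C^{7}D^{2}+30A^{2}C^{7}D-4A^{2}C^{7}+15A^{2}C^{4}D^{6}-70A^{2}C^{4}D^{5}+85A^{2}C^{4}D^{4}-70A^{2}C^{4}D^{3}+15A^{2}C^{4}D^{2}+6A^{2}CD^{5}\\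 &+AB^{6}C^{5}\\ &-AB^{5}C^{7}D^{3}-3AB^{5}C^{7}D^{2}+9AB^{5}C^{7}D+5AB^{5}C^{7}-5AB^{5}C^{4}D\\ &+12AB^{4}C^{9}D^{2}+34AB^{4}C^{9}D+AB^{4}C^{9}+AB^{4}C^{6}D^{4}+8AB^{4}C^{6}D^{3}-53AB^{4}C^{6}D^{2}-2AB^{4}C^{6}D-9AB^{4}C^{6}+10AB^{4}C^{3}D^{2}\\ &+AB^{3}C^{11}D^{3}+15AB^{3}C^{11}D^{2}+9AB^{3}C^{11}D-21AB^{3}C^{11}+3AB^{3}C^{8}D^{4}-58AB^{3}C^{8}D^{3}-101AB^{3}C^{8}D^{2}+23AB^{3}C^{8}D-37AB^{3}C^{8}-6AB^{3}C^{5}D^{4}+123AB^{3}C^{5}D^{3}-39AB^{3}C^{5}D^{2}+48AB^{3}C^{5}D-6AB^{3}C^{5}-10AB^{3}C^{2}D^{3}\\ &-18AB^{2}C^{13}D-15AB^{2}C^{13}-5AB^{2}C^{10}D^{4}-49AB^{2}C^{10}D^{3}+39AB^{2}C^{10}D^{2}+36AB^{2}C^{10}D-11AB^{2}C^{10}-AB^{2}C^{7}D^{6}-6AB^{2}C^{7}D^{5}+115AB^{2}C^{7}D^{4}+52AB^{2}C^{7}D^{3}-15AB^{2}C^{7}D^{2}+74AB^{2}C^{7}D+9AB^{2}C^{7}-135AB^{2}C^{4}D^{4}+80AB^{2}C^{4}D^{3}-90AB^{2}C^{4}D^{2}+15AB^{2}C^{4}D+5AB^{2}CD^{4}\\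 &-2ABC^{15}D+4ABC^{15}+ABC^{12}D^{3}+44ABC^{12}D^{2}-9ABC^{12}D+27ABC^{12}+7ABC^{9}D^{5}+51ABC^{9}D^{4}-109ABC^{9}D^{3}+57ABC^{9}D^{2}-69ABC^{9}D+31ABC^{9}+ABC^{6}D^{7}+8ABC^{6}D^{6}-109ABC^{6}D^{5}+69ABC^{6}D^{4}-79ABC^{6}D^{3}+25ABC^{6}D^{2}-56ABC^{6}D+7ABC^{6}+75ABC^{3}D^{5}-65ABC^{3}D^{4}+70ABC^{3}D^{3}-10ABC^{3}D^{2}-ABD^{5}\\ &+AC^{17}+3AC^{14}D^{2}-9AC^{14}D+3AC^{14}-30AC^{11}D^{3}+30AC^{11}D^{2}-30AC^{11}D-2AC^{8}D^{6}-24AC^{8}D^{5}+78AC^{8}D^{4}-86AC^{8}D^{3}+78AC^{8}D^{2}-24AC^{8}D-2AC^{8}-6AC^{5}D^{7}+48AC^{5}D^{6}-76AC^{5}D^{5}+97AC^{5}D^{4}-76AC^{5}D^{3}+48AC^{5}D^{2}-6AC^{5}D-15AC^{2}D^{6}+15AC^{2}D^{5}-15AC^{2}D^{4}\\ &-B^{6}C^{6}D^{4}-B^{6}C^{6}D^{3}-B^{6}C^{6}D^{2}-B^{6}C^{6}D-B^{6}C^{6}\\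 &-2B^{5}C^{8}D^{3}-6B^{5}C^{8}D^{2}-10B^{5}C^{8}D-2B^{5}C^{8}+6B^{5}C^{5}D^{4}+6B^{5}C^{5}D^{3}+6B^{5}C^{5}D^{2}+5B^{5}C^{5}D+B^{5}C^{5}\\ &-3B^{4}C^{10}D^{2}-3B^{4}C^{10}D+9B^{4}C^{10}+3B^{4}C^{7}D^{5}+6B^{4}C^{7}D^{4}+19B^{4}C^{7}D^{3}+38B^{4}C^{7}D^{2}+7B^{4}C^{7}D+12B^{4}C^{7}-15B^{4}C^{4}D^{4}-15B^{4}C^{4}D^{3}-10B^{4}C^{4}D^{2}-5B^{4}C^{4}D\\ &+B^{3}C^{12}D^{2}+12B^{3}C^{12}D+12B^{3}C^{12}+5B^{3}C^{9}D^{4}+14B^{3}C^{9}D^{3}-27B^{3}C^{9}D^{2}-23B^{3}C^{9}D+4B^{3}C^{9}-B^{3}C^{6}D^{7}-B^{3}C^{6}D^{6}-18B^{3}C^{6}D^{5}-41B^{3}C^{6}D^{4}-14B^{3}C^{6}D^{3}-27B^{3}C^{6}D^{2}-31B^{3}C^{6}D-7B^{3}C^{6}+20B^{3}C^{3}D^{4}+10B^{3}C^{3}D^{3}+10B^{3}C^{3}D^{2}\\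 &+B^{2}C^{14}D-3B^{2}C^{14}-B^{2}C^{11}D^{4}-13B^{2}C^{11}D^{3}-27B^{2}C^{11}D^{2}-3B^{2}C^{11}D-28B^{2}C^{11}-2B^{2}C^{8}D^{6}-15B^{2}C^{8}D^{5}+13B^{2}C^{8}D^{4}+39B^{2}C^{8}D^{3}-6B^{2}C^{8}D^{2}+59B^{2}C^{8}D-25B^{2}C^{8}+6B^{2}C^{5}D^{7}+6B^{2}C^{5}D^{6}+51B^{2}C^{5}D^{5}-24B^{2}C^{5}D^{4}+43B^{2}C^{5}D^{3}-9B^{2}C^{5}D^{2}+40B^{2}C^{5}D-3B^{2}C^{5}-5B^{2}C^{2}D^{4}-10B^{2}C^{2}D^{3}\\ &-BC^{16}-BC^{13}D^{3}+BC^{13}D^{2}+5BC^{13}D+2BC^{10}D^{5}+22BC^{10}D^{4}+7BC^{10}D^{3}+9BC^{10}D^{2}+15BC^{10}D+14BC^{10}+3BC^{7}D^{7}+13BC^{7}D^{6}-29BC^{7}D^{5}-28BC^{7}D^{4}+33BC^{7}D^{3}-58BC^{7}D^{2}-2BC^{7}D+11BC^{7}-15BC^{4}D^{7}-15BC^{4}D^{6}+60BC^{4}D^{5}-120BC^{4}D^{4}+110BC^{4}D^{3}-65BC^{4}D^{2}+5BC^{4}D-5BCD^{5}+5BCD^{4}\\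 &+C^{15}D^{2}-C^{15}D+C^{15}+3C^{12}D^{4}-12C^{12}D^{3}+15C^{12}D^{2}-12C^{12}D+3C^{12}+2C^{9}D^{6}-30C^{9}D^{5}+60C^{9}D^{4}-86C^{9}D^{3}+60C^{9}D^{2}-30C^{9}D+2C^{9}+C^{6}D^{8}-22C^{6}D^{7}+79C^{6}D^{6}-134C^{6}D^{5}+170C^{6}D^{4}-134C^{6}D^{3}+79C^{6}D^{2}-22C^{6}D+C^{6}+20C^{3}D^{7}-55C^{3}D^{6}+75C^{3}D^{5}-55C^{3}D^{4}+20C^{3}D^{3}+D^{6} \end{aligned},$$ $$\lambda_2=\begin{aligned} &A^{2}B^{6}C^{6}D^{3}+2A^{2}B^{6}C^{6}D^{2}+3A^{2}B^{6}C^{6}D-A^{2}B^{6}C^{6}\\ &+2A^{2}B^{5}C^{8}D^{2}-A^{2}B^{5}C^{8}D-7A^{2}B^{5}C^{8}+A^{2}B^{5}C^{5}D^{4}-5A^{2}B^{5}C^{5}D^{3}-11A^{2}B^{5}C^{5}D^{2}+7A^{2}B^{5}C^{5}D-3A^{2}B^{5}C^{5}\\ &-A^{2}B^{4}C^{10}D^{2}-10A^{2}B^{4}C^{10}D-7A^{2}B^{4}C^{10}-3A^{2}B^{4}C^{7}D^{4}-6A^{2}B^{4}C^{7}D^{3}+19A^{2}B^{4}C^{7}D^{2}+25A^{2}B^{4}C^{7}D-2A^{2}B^{4}C^{7}-5A^{2}B^{4}C^{4}D^{4}+10A^{2}B^{4}C^{4}D^{3}-20A^{2}B^{4}C^{4}D^{2}+10A^{2}B^{4}C^{4}D\\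 &-A^{2}B^{3}C^{12}D+3A^{2}B^{3}C^{12}-5A^{2}B^{3}C^{9}D^{3}+9A^{2}B^{3}C^{9}D^{2}+2A^{2}B^{3}C^{9}+A^{2}B^{3}C^{6}D^{6}-A^{2}B^{3}C^{6}D^{5}+13A^{2}B^{3}C^{6}D^{4}-12A^{2}B^{3}C^{6}D^{3}-44A^{2}B^{3}C^{6}D^{2}-4A^{2}B^{3}C^{6}D-A^{2}B^{3}C^{6}+10A^{2}B^{3}C^{3}D^{4}+30A^{2}B^{3}C^{3}D^{3}-10A^{2}B^{3}C^{3}D^{2}\\ &+A^{2}B^{2}C^{14}-A^{2}B^{2}C^{11}D^{3}+10A^{2}B^{2}C^{11}D^{2}-10A^{2}B^{2}C^{11}D-7A^{2}B^{2}C^{11}+2A^{2}B^{2}C^{8}D^{5}+25A^{2}B^{2}C^{8}D^{4}-16A^{2}B^{2}C^{8}D^{3}+43A^{2}B^{2}C^{8}D^{2}+29A^{2}B^{2}C^{8}D-5A^{2}B^{2}C^{8}+A^{2}B^{2}C^{5}D^{7}-5A^{2}B^{2}C^{5}D^{6}+4A^{2}B^{2}C^{5}D^{5}-23A^{2}B^{2}C^{5}D^{4}+21A^{2}B^{2}C^{5}D^{3}-14A^{2}B^{2}C^{5}D^{2}+24A^{2}B^{2}C^{5}D-2A^{2}B^{2}C^{5}-25A^{2}B^{2}C^{2}D^{4}\\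 &+4A^{2}BC^{13}D^{2}+A^{2}BC^{13}D+8A^{2}BC^{13}+6A^{2}BC^{10}D^{4}-25A^{2}BC^{10}D^{3}+16A^{2}BC^{10}D^{2}-25A^{2}BC^{10}D+26A^{2}BC^{10}-37A^{2}BC^{7}D^{5}+19A^{2}BC^{7}D^{4}-31A^{2}BC^{7}D^{3}-21A^{2}BC^{7}D^{2}-47A^{2}BC^{7}D+15A^{2}BC^{7}-5A^{2}BC^{4}D^{7}+10A^{2}BC^{4}D^{6}+40A^{2}BC^{4}D^{5}-80A^{2}BC^{4}D^{4}+120A^{2}BC^{4}D^{3}-60A^{2}BC^{4}D^{2}+5A^{2}BC^{4}D+5A^{2}BCD^{4}\\ &-2A^{2}C^{15}D+A^{2}C^{15}-9A^{2}C^{12}D^{3}+15A^{2}C^{12}D^{2}-20A^{2}C^{12}D+A^{2}C^{12}-11A^{2}C^{9}D^{5}+51A^{2}C^{9}D^{4}-81A^{2}C^{9}D^{3}+89A^{2}C^{9}D^{2}-39A^{2}C^{9}D-A^{2}C^{9}-5A^{2}C^{6}D^{7}+46A^{2}C^{6}D^{6}-103A^{2}C^{6}D^{5}+171A^{2}C^{6}D^{4}-167A^{2}C^{6}D^{3}+121A^{2}C^{6}D^{2}-28A^{2}C^{6}D+A^{2}C^{6}+10A^{2}C^{3}D^{7}-50A^{2}C^{3}D^{6}+75A^{2}C^{3}D^{5}-70A^{2}C^{3}D^{4}+20A^{2}C^{3}D^{3}+A^{2}D^{6}\\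 &+AB^{7}C^{5}\\ &-AB^{6}C^{7}D^{3}-3AB^{6}C^{7}D^{2}+4AB^{6}C^{7}D+5AB^{6}C^{7}-5AB^{6}C^{4}D\\ &+3AB^{5}C^{9}D^{2}+18AB^{5}C^{9}D+6AB^{5}C^{9}+6AB^{5}C^{6}D^{3}-26AB^{5}C^{6}D^{2}-12AB^{5}C^{6}D-3AB^{5}C^{6}+10AB^{5}C^{3}D^{2}\\ &+3AB^{4}C^{11}D^{2}+9AB^{4}C^{11}D-5AB^{4}C^{11}+3AB^{4}C^{8}D^{4}-3AB^{4}C^{8}D^{3}-57AB^{4}C^{8}D^{2}-12AB^{4}C^{8}+AB^{4}C^{5}D^{5}+60AB^{4}C^{5}D^{3}+9AB^{4}C^{5}D^{2}+17AB^{4}C^{5}D-2AB^{4}C^{5}-10AB^{4}C^{2}D^{3}\\ &-2AB^{3}C^{13}D-6AB^{3}C^{13}+AB^{3}C^{10}D^{4}-12AB^{3}C^{10}D^{2}+36AB^{3}C^{10}D-3AB^{3}C^{10}-AB^{3}C^{7}D^{6}-3AB^{3}C^{7}D^{5}-19AB^{3}C^{7}D^{4}+57AB^{3}C^{7}D^{3}-48AB^{3}C^{7}D^{2}+31AB^{3}C^{7}D-2AB^{3}C^{7}-5AB^{3}C^{4}D^{5}-50AB^{3}C^{4}D^{4}-10AB^{3}C^{4}D^{3}-25AB^{3}C^{4}D^{2}+5AB^{3}CD^{4}\\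 &-3AB^{2}C^{12}D^{3}-16AB^{2}C^{12}D^{2}+6AB^{2}C^{12}D-9AB^{2}C^{12}-7AB^{2}C^{9}D^{5}-21AB^{2}C^{9}D^{4}+57AB^{2}C^{9}D^{3}-91AB^{2}C^{9}D^{2}+18AB^{2}C^{9}D-27AB^{2}C^{9}+3AB^{2}C^{6}D^{6}+64AB^{2}C^{6}D^{5}-90AB^{2}C^{6}D^{4}+147AB^{2}C^{6}D^{3}-49AB^{2}C^{6}D^{2}+33AB^{2}C^{6}D-9AB^{2}C^{6}+10AB^{2}C^{3}D^{5}+15AB^{2}C^{3}D^{4}+10AB^{2}C^{3}D^{2}-AB^{2}D^{5}\\ &+4ABC^{14}D-9ABC^{14}+11ABC^{11}D^{4}+28ABC^{11}D^{3}-23ABC^{11}D^{2}+69ABC^{11}D-15ABC^{11}+13ABC^{8}D^{6}+11ABC^{8}D^{5}-77ABC^{8}D^{4}+139ABC^{8}D^{3}-137ABC^{8}D^{2}+101ABC^{8}D-2ABC^{8}+ABC^{5}D^{8}-74ABC^{5}D^{6}+129ABC^{5}D^{5}-211ABC^{5}D^{4}+147ABC^{5}D^{3}-124ABC^{5}D^{2}+31ABC^{5}D-ABC^{5}+15ABC^{2}D^{6}-25ABC^{2}D^{5}+25ABC^{2}D^{4}-10ABC^{2}D^{3}\\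 &+AC^{16}D+AC^{16}-2AC^{13}D^{2}-3AC^{13}D+8AC^{13}-7AC^{10}D^{5}-9AC^{10}D^{4}-5AC^{10}D^{2}-31AC^{10}D+12AC^{10}-5AC^{7}D^{7}-6AC^{7}D^{6}+48AC^{7}D^{5}-76AC^{7}D^{4}+62AC^{7}D^{3}-6AC^{7}D^{2}-27AC^{7}D+4AC^{7}-5AC^{4}D^{8}+45AC^{4}D^{7}-100AC^{4}D^{6}+155AC^{4}D^{5}-135AC^{4}D^{4}+85AC^{4}D^{3}-15AC^{4}D^{2}-5ACD^{7}+6ACD^{6}-6ACD^{5}\\ &-B^{7}C^{6}D^{4}-B^{7}C^{6}D^{3}-B^{7}C^{6}D^{2}-B^{7}C^{6}D-B^{7}C^{6}\\ &-B^{6}C^{8}D^{3}-4B^{6}C^{8}D^{2}-7B^{6}C^{8}D-3B^{6}C^{8}-B^{6}C^{5}D^{5}+6B^{6}C^{5}D^{4}+6B^{6}C^{5}D^{3}+6B^{6}C^{5}D^{2}+5B^{6}C^{5}D+B^{6}C^{5}\\ &-B^{5}C^{10}D^{2}-4B^{5}C^{10}D+2B^{5}C^{10}+3B^{5}C^{7}D^{5}+3B^{5}C^{7}D^{4}+7B^{5}C^{7}D^{3}+25B^{5}C^{7}D^{2}+11B^{5}C^{7}D+7B^{5}C^{7}+5B^{5}C^{4}D^{5}-15B^{5}C^{4}D^{4}-15B^{5}C^{4}D^{3}-10B^{5}C^{4}D^{2}-5B^{5}C^{4}D\\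 &+2B^{4}C^{12}D+5B^{4}C^{12}+2B^{4}C^{9}D^{4}+9B^{4}C^{9}D^{3}-5B^{4}C^{9}D^{2}-16B^{4}C^{9}D+B^{4}C^{9}-B^{4}C^{6}D^{7}+2B^{4}C^{6}D^{6}-14B^{4}C^{6}D^{5}-25B^{4}C^{6}D^{4}+10B^{4}C^{6}D^{3}-21B^{4}C^{6}D^{2}-17B^{4}C^{6}D-4B^{4}C^{6}-10B^{4}C^{3}D^{5}+20B^{4}C^{3}D^{4}+10B^{4}C^{3}D^{3}+10B^{4}C^{3}D^{2}\\ &+8B^{3}C^{11}D^{2}+2B^{3}C^{11}D-2B^{3}C^{11}-B^{3}C^{8}D^{6}-5B^{3}C^{8}D^{5}+11B^{3}C^{8}D^{4}-20B^{3}C^{8}D^{3}+17B^{3}C^{8}D^{2}+34B^{3}C^{8}D+3B^{3}C^{8}-B^{3}C^{5}D^{8}+6B^{3}C^{5}D^{7}-8B^{3}C^{5}D^{6}+27B^{3}C^{5}D^{5}+7B^{3}C^{5}D^{4}-20B^{3}C^{5}D^{3}-10B^{3}C^{5}D^{2}+19B^{3}C^{5}D+10B^{3}C^{2}D^{5}-5B^{3}C^{2}D^{4}-10B^{3}C^{2}D^{3}\\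 &-B^{2}C^{13}D^{2}-3B^{2}C^{13}D+8B^{2}C^{13}-2B^{2}C^{10}D^{5}-17B^{2}C^{10}D^{4}-5B^{2}C^{10}D^{3}-6B^{2}C^{10}D^{2}-48B^{2}C^{10}D+11B^{2}C^{10}-11B^{2}C^{7}D^{6}+45B^{2}C^{7}D^{5}-64B^{2}C^{7}D^{4}+46B^{2}C^{7}D^{3}+8B^{2}C^{7}D^{2}-57B^{2}C^{7}D+5B^{2}C^{4}D^{8}-15B^{2}C^{4}D^{7}+15B^{2}C^{4}D^{6}+20B^{2}C^{4}D^{5}-65B^{2}C^{4}D^{4}+80B^{2}C^{4}D^{3}-10B^{2}C^{4}D^{2}-5B^{2}C^{4}D-10B^{2}CD^{5}+5B^{2}CD^{4}\\ &-BC^{15}D-BC^{15}+BC^{12}D^{4}+BC^{12}D^{3}-5BC^{12}D^{2}+11BC^{12}D-14BC^{12}+8BC^{9}D^{6}+8BC^{9}D^{5}+6BC^{9}D^{4}+46BC^{9}D^{3}-40BC^{9}D^{2}+74BC^{9}D-20BC^{9}+5BC^{6}D^{8}-9BC^{6}D^{7}+11BC^{6}D^{6}-41BC^{6}D^{5}+37BC^{6}D^{4}-7BC^{6}D^{3}-44BC^{6}D^{2}+54BC^{6}D-6BC^{6}-10BC^{3}D^{8}+20BC^{3}D^{7}-20BC^{3}D^{6}-15BC^{3}D^{5}+45BC^{3}D^{4}-50BC^{3}D^{3}+10BC^{3}D^{2}+BD^{6}+BD^{5}\\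 &+C^{14}D^{3}+C^{14}+C^{11}D^{5}-6C^{11}D^{4}+6C^{11}D^{3}+C^{11}D^{2}-6C^{11}D+6C^{11}-C^{8}D^{7}-21C^{8}D^{6}+51C^{8}D^{5}-87C^{8}D^{4}+57C^{8}D^{3}-21C^{8}D^{2}-14C^{8}D+6C^{8}+C^{5}D^{9}-24C^{5}D^{8}+105C^{5}D^{7}-231C^{5}D^{6}+339C^{5}D^{5}-321C^{5}D^{4}+200C^{5}D^{3}-69C^{5}D^{2}+6C^{5}D+10C^{2}D^{8}-30C^{2}D^{7}+45C^{2}D^{6}-36C^{2}D^{5}+15C^{2}D^{4} \end{aligned},$$ $$\lambda_3=\begin{aligned} &A^{2}B^{6}C^{5}D^{4}+A^{2}B^{6}C^{5}D^{3}+A^{2}B^{6}C^{5}D^{2}+A^{2}B^{6}C^{5}D+2A^{2}B^{6}C^{5}\\ &+2A^{2}B^{5}C^{7}D^{3}+5A^{2}B^{5}C^{7}D^{2}+17A^{2}B^{5}C^{7}D+6A^{2}B^{5}C^{7}-5A^{2}B^{5}C^{4}D^{4}-5A^{2}B^{5}C^{4}D^{3}-5A^{2}B^{5}C^{4}D^{2}-10A^{2}B^{5}C^{4}D\\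 &+8A^{2}B^{4}C^{9}D^{2}+20A^{2}B^{4}C^{9}D-10A^{2}B^{4}C^{9}-3A^{2}B^{4}C^{6}D^{5}-6A^{2}B^{4}C^{6}D^{4}-15A^{2}B^{4}C^{6}D^{3}-80A^{2}B^{4}C^{6}D^{2}-2A^{2}B^{4}C^{6}D-19A^{2}B^{4}C^{6}+10A^{2}B^{4}C^{3}D^{4}+10A^{2}B^{4}C^{3}D^{3}+20A^{2}B^{4}C^{3}D^{2}\\ &+A^{2}B^{3}C^{11}D^{2}-13A^{2}B^{3}C^{11}D-24A^{2}B^{3}C^{11}-5A^{2}B^{3}C^{8}D^{4}-41A^{2}B^{3}C^{8}D^{3}-30A^{2}B^{3}C^{8}D^{2}+47A^{2}B^{3}C^{8}D-40A^{2}B^{3}C^{8}+A^{2}B^{3}C^{5}D^{7}+A^{2}B^{3}C^{5}D^{6}+15A^{2}B^{3}C^{5}D^{5}+33A^{2}B^{3}C^{5}D^{4}+132A^{2}B^{3}C^{5}D^{3}-45A^{2}B^{3}C^{5}D^{2}+87A^{2}B^{3}C^{5}D-9A^{2}B^{3}C^{5}-10A^{2}B^{3}C^{2}D^{4}-20A^{2}B^{3}C^{2}D^{3}\\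 &-4A^{2}B^{2}C^{13}D+A^{2}B^{2}C^{10}D^{4}+4A^{2}B^{2}C^{10}D^{3}+49A^{2}B^{2}C^{10}D^{2}+23A^{2}B^{2}C^{10}D+18A^{2}B^{2}C^{10}+2A^{2}B^{2}C^{7}D^{6}+14A^{2}B^{2}C^{7}D^{5}+48A^{2}B^{2}C^{7}D^{4}-8A^{2}B^{2}C^{7}D^{3}-17A^{2}B^{2}C^{7}D^{2}+39A^{2}B^{2}C^{7}D+24A^{2}B^{2}C^{7}-5A^{2}B^{2}C^{4}D^{7}-5A^{2}B^{2}C^{4}D^{6}-35A^{2}B^{2}C^{4}D^{5}-130A^{2}B^{2}C^{4}D^{4}+100A^{2}B^{2}C^{4}D^{3}-140A^{2}B^{2}C^{4}D^{2}+20A^{2}B^{2}C^{4}D+10A^{2}B^{2}CD^{4}\\ &+2A^{2}BC^{15}+A^{2}BC^{12}D^{3}+9A^{2}BC^{12}D^{2}-10A^{2}BC^{12}D+14A^{2}BC^{12}-2A^{2}BC^{9}D^{5}-7A^{2}BC^{9}D^{4}-62A^{2}BC^{9}D^{3}+31A^{2}BC^{9}D^{2}-70A^{2}BC^{9}D+21A^{2}BC^{9}-3A^{2}BC^{6}D^{7}-9A^{2}BC^{6}D^{6}-38A^{2}BC^{6}D^{5}+77A^{2}BC^{6}D^{4}-96A^{2}BC^{6}D^{3}+67A^{2}BC^{6}D^{2}-75A^{2}BC^{6}D+8A^{2}BC^{6}+10A^{2}BC^{3}D^{7}+10A^{2}BC^{3}D^{6}+50A^{2}BC^{3}D^{5}-45A^{2}BC^{3}D^{4}+80A^{2}BC^{3}D^{3}-10A^{2}BC^{3}D^{2}-A^{2}BD^{5}\\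 &-A^{2}C^{14}D^{2}-A^{2}C^{14}D-3A^{2}C^{11}D^{4}+3A^{2}C^{11}D^{3}-8A^{2}C^{11}D-2A^{2}C^{11}-2A^{2}C^{8}D^{6}+19A^{2}C^{8}D^{5}-9A^{2}C^{8}D^{4}+5A^{2}C^{8}D^{3}+29A^{2}C^{8}D^{2}-9A^{2}C^{8}D-3A^{2}C^{8}-A^{2}C^{5}D^{8}+17A^{2}C^{5}D^{7}-33A^{2}C^{5}D^{6}+31A^{2}C^{5}D^{5}+A^{2}C^{5}D^{4}-33A^{2}C^{5}D^{3}+42A^{2}C^{5}D^{2}-6A^{2}C^{5}D-10A^{2}C^{2}D^{7}+5A^{2}C^{2}D^{6}-15A^{2}C^{2}D^{4}\\ &-AB^{6}C^{6}D^{4}-2AB^{6}C^{6}D^{3}-3AB^{6}C^{6}D^{2}-9AB^{6}C^{6}D+AB^{6}C^{6}\\ &-2AB^{5}C^{8}D^{3}-18AB^{5}C^{8}D^{2}-18AB^{5}C^{8}D+14AB^{5}C^{8}+AB^{5}C^{5}D^{5}+6AB^{5}C^{5}D^{4}+12AB^{5}C^{5}D^{3}+42AB^{5}C^{5}D^{2}-12AB^{5}C^{5}D+9AB^{5}C^{5}\\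 &-AB^{4}C^{10}D^{3}-9AB^{4}C^{10}D^{2}+24AB^{4}C^{10}D+31AB^{4}C^{10}+3AB^{4}C^{7}D^{5}+12AB^{4}C^{7}D^{4}+73AB^{4}C^{7}D^{3}+21AB^{4}C^{7}D^{2}-33AB^{4}C^{7}D+21AB^{4}C^{7}-5AB^{4}C^{4}D^{5}-15AB^{4}C^{4}D^{4}-75AB^{4}C^{4}D^{3}+40AB^{4}C^{4}D^{2}-35AB^{4}C^{4}D\\ &+3AB^{3}C^{12}D^{2}+28AB^{3}C^{12}D+6AB^{3}C^{12}+5AB^{3}C^{9}D^{4}+20AB^{3}C^{9}D^{3}-129AB^{3}C^{9}D^{2}-20AB^{3}C^{9}D-32AB^{3}C^{9}-AB^{3}C^{6}D^{7}-5AB^{3}C^{6}D^{6}-24AB^{3}C^{6}D^{5}-128AB^{3}C^{6}D^{4}+70AB^{3}C^{6}D^{3}-42AB^{3}C^{6}D^{2}+AB^{3}C^{6}D-28AB^{3}C^{6}+10AB^{3}C^{3}D^{5}+60AB^{3}C^{3}D^{4}-60AB^{3}C^{3}D^{3}+50AB^{3}C^{3}D^{2}\\ &-11AB^{2}C^{1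4}-3AB^{2}C^{11}D^{4}-23AB^{2}C^{11}D^{3}-62AB^{2}C^{11}D^{2}+27AB^{2}C^{11}D-52AB^{2}C^{11}-2AB^{2}C^{8}D^{6}-10AB^{2}C^{8}D^{5}+21AB^{2}C^{8}D^{4}+184AB^{2}C^{8}D^{3}-92AB^{2}C^{8}D^{2}+153AB^{2}C^{8}D-41AB^{2}C^{8}+AB^{2}C^{5}D^{8}+6AB^{2}C^{5}D^{7}+27AB^{2}C^{5}D^{6}+87AB^{2}C^{5}D^{5}-135AB^{2}C^{5}D^{4}+173AB^{2}C^{5}D^{3}-115AB^{2}C^{5}D^{2}+90AB^{2}C^{5}D-5AB^{2}C^{5}-25AB^{2}C^{2}D^{5}+45AB^{2}C^{2}D^{4}-30AB^{2}C^{2}D^{3}\\ &-ABC^{16}+2ABC^{13}D^{3}+5ABC^{13}D^{2}+11ABC^{13}D-2ABC^{13}+10ABC^{10}D^{5}+22ABC^{10}D^{4}+25ABC^{10}D^{3}+ABC^{10}D^{2}+51ABC^{10}D+11ABC^{10}+6ABC^{7}D^{7}-7ABC^{7}D^{6}-32ABC^{7}D^{5}-76ABC^{7}D^{4}+44ABC^{7}D^{3}-112ABC^{7}D^{2}+28ABC^{7}D+11ABC^{7}-5ABC^{4}D^{8}-15ABC^{4}D^{7}-15ABC^{4}D^{6}+70ABC^{4}D^{5}-125ABC^{4}D^{4}+110ABC^{4}D^{3}-80ABC^{4}D^{2}+5ABC^{4}D-11ABCD^{5}+5ABCD^{4}\\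 &+AC^{15}D+AC^{15}-3AC^{12}D^{4}-5AC^{12}D^{2}-3AC^{12}D+5AC^{12}-7AC^{9}D^{6}+2AC^{9}D^{5}-12AC^{9}D^{4}-2AC^{9}D^{3}-8AC^{9}D^{2}-22AC^{9}D+5AC^{9}-3AC^{6}D^{8}+7AC^{6}D^{7}+9AC^{6}D^{6}+6AC^{6}D^{5}+2AC^{6}D^{4}+20AC^{6}D^{3}+9AC^{6}D^{2}-15AC^{6}D+AC^{6}+10AC^{3}D^{8}-20AC^{3}D^{7}+15AC^{3}D^{6}+5AC^{3}D^{5}-20AC^{3}D^{4}+20AC^{3}D^{3}+AD^{7}+AD^{6}\\ &-B^{7}C^{5}D^{5}\\ &-B^{6}C^{7}D^{4}-B^{6}C^{7}D^{3}+2B^{6}C^{7}D^{2}+3B^{6}C^{7}D-3B^{6}C^{7}+5B^{6}C^{4}D^{5}\\ &-B^{5}C^{9}D^{3}-4B^{5}C^{9}D^{2}-13B^{5}C^{9}D-15B^{5}C^{9}+3B^{5}C^{6}D^{6}+2B^{5}C^{6}D^{5}+B^{5}C^{6}D^{4}+4B^{5}C^{6}D^{3}-4B^{5}C^{6}D^{2}+10B^{5}C^{6}D-4B^{5}C^{6}-10B^{5}C^{3}D^{5}\\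 &-2B^{4}C^{11}D^{2}-16B^{4}C^{11}D-7B^{4}C^{11}+2B^{4}C^{8}D^{5}+9B^{4}C^{8}D^{4}+15B^{4}C^{8}D^{3}+68B^{4}C^{8}D^{2}+37B^{4}C^{8}D+19B^{4}C^{8}-B^{4}C^{5}D^{8}-13B^{4}C^{5}D^{6}-12B^{4}C^{5}D^{5}+4B^{4}C^{5}D^{4}-38B^{4}C^{5}D^{3}-9B^{4}C^{5}D^{2}+2B^{4}C^{5}D+7B^{4}C^{5}+10B^{4}C^{2}D^{5}\\ &+B^{3}C^{13}D+9B^{3}C^{13}+3B^{3}C^{10}D^{4}+29B^{3}C^{10}D^{3}+32B^{3}C^{10}D^{2}-3B^{3}C^{10}D+40B^{3}C^{10}-B^{3}C^{7}D^{7}-7B^{3}C^{7}D^{6}+B^{3}C^{7}D^{5}-90B^{3}C^{7}D^{4}-76B^{3}C^{7}D^{3}-31B^{3}C^{7}D^{2}-92B^{3}C^{7}D+14B^{3}C^{7}+5B^{3}C^{4}D^{8}+25B^{3}C^{4}D^{6}+30B^{3}C^{4}D^{5}+45B^{3}C^{4}D^{4}+5B^{3}C^{4}D^{3}+35B^{3}C^{4}D^{2}-25B^{3}C^{4}D-5B^{3}CD^{5}\\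 &+B^{2}C^{15}-3B^{2}C^{12}D^{3}-12B^{2}C^{12}D^{2}-4B^{2}C^{12}D-6B^{2}C^{12}-B^{2}C^{9}D^{6}-20B^{2}C^{9}D^{5}-35B^{2}C^{9}D^{4}+8B^{2}C^{9}D^{3}-68B^{2}C^{9}D^{2}-7B^{2}C^{9}D-34B^{2}C^{9}+2B^{2}C^{6}D^{8}-5B^{2}C^{6}D^{7}+40B^{2}C^{6}D^{6}+64B^{2}C^{6}D^{5}+28B^{2}C^{6}D^{4}+99B^{2}C^{6}D^{3}+26B^{2}C^{6}D^{2}+39B^{2}C^{6}D-17B^{2}C^{6}-10B^{2}C^{3}D^{8}-30B^{2}C^{3}D^{6}-80B^{2}C^{3}D^{5}+50B^{2}C^{3}D^{4}-80B^{2}C^{3}D^{3}+30B^{2}C^{3}D^{2}+B^{2}D^{5}\\ &-BC^{14}D^{2}-2BC^{14}+2BC^{11}D^{5}+4BC^{11}D^{4}+11BC^{11}D^{3}-6BC^{11}D^{2}+17BC^{11}D-7BC^{11}+6BC^{8}D^{7}+7BC^{8}D^{6}+28BC^{8}D^{5}-33BC^{8}D^{4}+96BC^{8}D^{3}-53BC^{8}D^{2}+62BC^{8}D-2BC^{8}+2BC^{5}D^{9}-12BC^{5}D^{8}+19BC^{5}D^{7}-128BC^{5}D^{6}+156BC^{5}D^{5}-241BC^{5}D^{4}+146BC^{5}D^{3}-119BC^{5}D^{2}+37BC^{5}D-BC^{5}+10BC^{2}D^{8}+40BC^{2}D^{6}-20BC^{2}D^{5}+40BC^{2}D^{4}-10BC^{2}D^{3}\\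 &+C^{13}D^{3}+C^{13}-2C^{10}D^{6}+C^{10}D^{5}-6C^{10}D^{4}+2C^{10}D^{3}+C^{10}D^{2}-6C^{10}D+4C^{10}-3C^{7}D^{8}-C^{7}D^{7}-3C^{7}D^{5}-15C^{7}D^{4}+3C^{7}D^{3}-14C^{7}D+3C^{7}-5C^{4}D^{9}+30C^{4}D^{8}-45C^{4}D^{7}+45C^{4}D^{6}+15C^{4}D^{5}-45C^{4}D^{4}+50C^{4}D^{3}-15C^{4}D^{2}-5CD^{8}-CD^{6}-6CD^{5} \end{aligned}.$$ -/

import Mathlib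

namespace PermPentanomial

/-- The value at `(A, B, C, D)` of the integer polynomial with the given monomials, where the entry
`(c, i, j, k, l)` stands for `c * A ^ i * B ^ j * C ^ k * D ^ l`. -/
def evalTerms {R : Type*} [CommRing R] (T : List (ℤ × ℕ × ℕ × ℕ × ℕ)) (A B C D : R) : R :=
  (T.map fun ⟨c, i, j, k, l⟩ => (c : R) * A ^ i * B ^ j * C ^ k * D ^ l).sum

/-- The monomials of the integer polynomial `λ₁`: the entry `⟨c, i, j, k, l⟩` stands for
`c * A ^ i * B ^ j * C ^ k * D ^ l`. -/
def lam1Terms : List (ℤ × ℕ × ℕ × ℕ × ℕ) :=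
  [⟨1, 2, 5, 6, 3⟩, ⟨2, 2, 5, 6, 2⟩, ⟨3, 2, 5, 6, 1⟩, ⟨-2, 2, 5, 6, 0⟩,
    ⟨3, 2, 4, 8, 2⟩, ⟨-8, 2, 4, 8, 1⟩, ⟨-11, 2, 4, 8, 0⟩, ⟨-6, 2, 4, 5, 3⟩, ⟨-12, 2, 4, 5, 2⟩,
    ⟨12, 2, 4, 5, 1⟩, ⟨-4, 2, 4, 5, 0⟩,
    ⟨-6, 2, 3, 10, 2⟩, ⟨-27, 2, 3, 10, 1⟩, ⟨-6, 2, 3, 10, 0⟩, ⟨-3, 2, 3, 7, 4⟩, ⟨-10, 2, 3, 7, 3⟩,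
    ⟨61, 2, 3, 7, 2⟩, ⟨20, 2, 3, 7, 1⟩, ⟨5, 2, 3, 7, 0⟩, ⟨15, 2, 3, 4, 3⟩, ⟨-30, 2, 3, 4, 2⟩,
    ⟨15, 2, 3, 4, 1⟩,
    ⟨-2, 2, 2, 12, 2⟩, ⟨15, 2, 2, 12, 0⟩, ⟨22, 2, 2, 9, 3⟩, ⟨66, 2, 2, 9, 2⟩, ⟨-24, 2, 2, 9, 1⟩,
    ⟨38, 2, 2, 9, 0⟩, ⟨1, 2, 2, 6, 6⟩, ⟨2, 2, 2, 6, 5⟩, ⟨21, 2, 2, 6, 4⟩, ⟨-130, 2, 2, 6, 3⟩,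
    ⟨28, 2, 2, 6, 2⟩, ⟨-60, 2, 2, 6, 1⟩, ⟨15, 2, 2, 6, 0⟩, ⟨40, 2, 2, 3, 3⟩, ⟨-20, 2, 2, 3, 2⟩,
    ⟨3, 2, 1, 14, 1⟩, ⟨4, 2, 1, 14, 0⟩, ⟨8, 2, 1, 11, 3⟩, ⟨-12, 2, 1, 11, 2⟩, ⟨-30, 2, 1, 11, 1⟩,
    ⟨3, 2, 1, 11, 0⟩, ⟨3, 2, 1, 8, 5⟩, ⟨-36, 2, 1, 8, 4⟩, ⟨-47, 2, 1, 8, 3⟩, ⟨66, 2, 1, 8, 2⟩,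
    ⟨-69, 2, 1, 8, 1⟩, ⟨-4, 2, 1, 8, 0⟩, ⟨-6, 2, 1, 5, 6⟩, ⟨-12, 2, 1, 5, 5⟩, ⟨131, 2, 1, 5, 4⟩,
    ⟨-122, 2, 1, 5, 3⟩, ⟨135, 2, 1, 5, 2⟩, ⟨-36, 2, 1, 5, 1⟩, ⟨1, 2, 1, 5, 0⟩, ⟨-30, 2, 1, 2, 4⟩,
    ⟨10, 2, 1, 2, 3⟩,
    ⟨-1, 2, 0, 16, 0⟩, ⟨-6, 2, 0, 13, 2⟩, ⟨6, 2, 0, 13, 1⟩, ⟨-6, 2, 0, 13, 0⟩, ⟨-9, 2, 0, 10, 4⟩,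
    ⟨30, 2, 0, 10, 3⟩, ⟨-24, 2, 0, 10, 2⟩, ⟨30, 2, 0, 10, 1⟩, ⟨-9, 2, 0, 10, 0⟩, ⟨-4, 2, 0, 7, 6⟩,
    ⟨30, 2, 0, 7, 5⟩, ⟨-30, 2, 0, 7, 4⟩, ⟨32, 2, 0, 7, 3⟩, ⟨-30, 2, 0, 7, 2⟩, ⟨30, 2, 0, 7, 1⟩,
    ⟨-4, 2, 0, 7, 0⟩, ⟨15, 2, 0, 4, 6⟩, ⟨-70, 2, 0, 4, 5⟩, ⟨85, 2, 0, 4, 4⟩, ⟨-70, 2, 0, 4, 3⟩,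
    ⟨15, 2, 0, 4, 2⟩, ⟨6, 2, 0, 1, 5⟩,
    ⟨1, 1, 6, 5, 0⟩,
    ⟨-1, 1, 5, 7, 3⟩, ⟨-3, 1, 5, 7, 2⟩, ⟨9, 1, 5, 7, 1⟩, ⟨5, 1, 5, 7, 0⟩, ⟨-5, 1, 5, 4, 1⟩,
    ⟨12, 1, 4, 9, 2⟩, ⟨34, 1, 4, 9, 1⟩, ⟨1, 1, 4, 9, 0⟩, ⟨1, 1, 4, 6, 4⟩, ⟨8, 1, 4, 6, 3⟩,
    ⟨-53, 1, 4, 6, 2⟩, ⟨-2, 1, 4, 6, 1⟩, ⟨-9, 1, 4, 6, 0⟩, ⟨10, 1, 4, 3, 2⟩,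
    ⟨1, 1, 3, 11, 3⟩, ⟨15, 1, 3, 11, 2⟩, ⟨9, 1, 3, 11, 1⟩, ⟨-21, 1, 3, 11, 0⟩, ⟨3, 1, 3, 8, 4⟩,
    ⟨-58, 1, 3, 8, 3⟩, ⟨-101, 1, 3, 8, 2⟩, ⟨23, 1, 3, 8, 1⟩, ⟨-37, 1, 3, 8, 0⟩, ⟨-6, 1, 3, 5, 4⟩,
    ⟨123, 1, 3, 5, 3⟩, ⟨-39, 1, 3, 5, 2⟩, ⟨48, 1, 3, 5, 1⟩, ⟨-6, 1, 3, 5, 0⟩, ⟨-10, 1, 3, 2, 3⟩,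
    ⟨-18, 1, 2, 13, 1⟩, ⟨-15, 1, 2, 13, 0⟩, ⟨-5, 1, 2, 10, 4⟩, ⟨-49, 1, 2, 10, 3⟩,
    ⟨39, 1, 2, 10, 2⟩, ⟨36, 1, 2, 10, 1⟩, ⟨-11, 1, 2, 10, 0⟩, ⟨-1, 1, 2, 7, 6⟩, ⟨-6, 1, 2, 7, 5⟩,
    ⟨115, 1, 2, 7, 4⟩, ⟨52, 1, 2, 7, 3⟩, ⟨-15, 1, 2, 7, 2⟩, ⟨74, 1, 2, 7, 1⟩, ⟨9, 1, 2, 7, 0⟩,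
    ⟨-135, 1, 2, 4, 4⟩, ⟨80, 1, 2, 4, 3⟩, ⟨-90, 1, 2, 4, 2⟩, ⟨15, 1, 2, 4, 1⟩, ⟨5, 1, 2, 1, 4⟩,
    ⟨-2, 1, 1, 15, 1⟩, ⟨4, 1, 1, 15, 0⟩, ⟨1, 1, 1, 12, 3⟩, ⟨44, 1, 1, 12, 2⟩, ⟨-9, 1, 1, 12, 1⟩,
    ⟨27, 1, 1, 12, 0⟩, ⟨7, 1, 1, 9, 5⟩, ⟨51, 1, 1, 9, 4⟩, ⟨-109, 1, 1, 9, 3⟩, ⟨57, 1, 1, 9, 2⟩,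
    ⟨-69, 1, 1, 9, 1⟩, ⟨31, 1, 1, 9, 0⟩, ⟨1, 1, 1, 6, 7⟩, ⟨8, 1, 1, 6, 6⟩, ⟨-109, 1, 1, 6, 5⟩,
    ⟨69, 1, 1, 6, 4⟩, ⟨-79, 1, 1, 6, 3⟩, ⟨25, 1, 1, 6, 2⟩, ⟨-56, 1, 1, 6, 1⟩, ⟨7, 1, 1, 6, 0⟩,
    ⟨75, 1, 1, 3, 5⟩, ⟨-65, 1, 1, 3, 4⟩, ⟨70, 1, 1, 3, 3⟩, ⟨-10, 1, 1, 3, 2⟩, ⟨-1, 1, 1, 0, 5⟩,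
    ⟨1, 1, 0, 17, 0⟩, ⟨3, 1, 0, 14, 2⟩, ⟨-9, 1, 0, 14, 1⟩, ⟨3, 1, 0, 14, 0⟩, ⟨-30, 1, 0, 11, 3⟩,
    ⟨30, 1, 0, 11, 2⟩, ⟨-30, 1, 0, 11, 1⟩, ⟨-2, 1, 0, 8, 6⟩, ⟨-24, 1, 0, 8, 5⟩, ⟨78, 1, 0, 8, 4⟩,
    ⟨-86, 1, 0, 8, 3⟩, ⟨78, 1, 0, 8, 2⟩, ⟨-24, 1, 0, 8, 1⟩, ⟨-2, 1, 0, 8, 0⟩, ⟨-6, 1, 0, 5, 7⟩,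
    ⟨48, 1, 0, 5, 6⟩, ⟨-76, 1, 0, 5, 5⟩, ⟨97, 1, 0, 5, 4⟩, ⟨-76, 1, 0, 5, 3⟩, ⟨48, 1, 0, 5, 2⟩,
    ⟨-6, 1, 0, 5, 1⟩, ⟨-15, 1, 0, 2, 6⟩, ⟨15, 1, 0, 2, 5⟩, ⟨-15, 1, 0, 2, 4⟩,
    ⟨-1, 0, 6, 6, 4⟩, ⟨-1, 0, 6, 6, 3⟩, ⟨-1, 0, 6, 6, 2⟩, ⟨-1, 0, 6, 6, 1⟩, ⟨-1, 0, 6, 6, 0⟩,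
    ⟨-2, 0, 5, 8, 3⟩, ⟨-6, 0, 5, 8, 2⟩, ⟨-10, 0, 5, 8, 1⟩, ⟨-2, 0, 5, 8, 0⟩, ⟨6, 0, 5, 5, 4⟩,
    ⟨6, 0, 5, 5, 3⟩, ⟨6, 0, 5, 5, 2⟩, ⟨5, 0, 5, 5, 1⟩, ⟨1, 0, 5, 5, 0⟩,
    ⟨-3, 0, 4, 10, 2⟩, ⟨-3, 0, 4, 10, 1⟩, ⟨9, 0, 4, 10, 0⟩, ⟨3, 0, 4, 7, 5⟩, ⟨6, 0, 4, 7, 4⟩,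
    ⟨19, 0, 4, 7, 3⟩, ⟨38, 0, 4, 7, 2⟩, ⟨7, 0, 4, 7, 1⟩, ⟨12, 0, 4, 7, 0⟩, ⟨-15, 0, 4, 4, 4⟩,
    ⟨-15, 0, 4, 4, 3⟩, ⟨-10, 0, 4, 4, 2⟩, ⟨-5, 0, 4, 4, 1⟩,
    ⟨1, 0, 3, 12, 2⟩, ⟨12, 0, 3, 12, 1⟩, ⟨12, 0, 3, 12, 0⟩, ⟨5, 0, 3, 9, 4⟩, ⟨14, 0, 3, 9, 3⟩,
    ⟨-27, 0, 3, 9, 2⟩, ⟨-23, 0, 3, 9, 1⟩, ⟨4, 0, 3, 9, 0⟩, ⟨-1, 0, 3, 6, 7⟩, ⟨-1, 0, 3, 6, 6⟩,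
    ⟨-18, 0, 3, 6, 5⟩, ⟨-41, 0, 3, 6, 4⟩, ⟨-14, 0, 3, 6, 3⟩, ⟨-27, 0, 3, 6, 2⟩, ⟨-31, 0, 3, 6, 1⟩,
    ⟨-7, 0, 3, 6, 0⟩, ⟨20, 0, 3, 3, 4⟩, ⟨10, 0, 3, 3, 3⟩, ⟨10, 0, 3, 3, 2⟩,
    ⟨1, 0, 2, 14, 1⟩, ⟨-3, 0, 2, 14, 0⟩, ⟨-1, 0, 2, 11, 4⟩, ⟨-13, 0, 2, 11, 3⟩,
    ⟨-27, 0, 2, 11, 2⟩, ⟨-3, 0, 2, 11, 1⟩, ⟨-28, 0, 2, 11, 0⟩, ⟨-2, 0, 2, 8, 6⟩,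
    ⟨-15, 0, 2, 8, 5⟩, ⟨13, 0, 2, 8, 4⟩, ⟨39, 0, 2, 8, 3⟩, ⟨-6, 0, 2, 8, 2⟩, ⟨59, 0, 2, 8, 1⟩,
    ⟨-25, 0, 2, 8, 0⟩, ⟨6, 0, 2, 5, 7⟩, ⟨6, 0, 2, 5, 6⟩, ⟨51, 0, 2, 5, 5⟩, ⟨-24, 0, 2, 5, 4⟩,
    ⟨43, 0, 2, 5, 3⟩, ⟨-9, 0, 2, 5, 2⟩, ⟨40, 0, 2, 5, 1⟩, ⟨-3, 0, 2, 5, 0⟩, ⟨-5, 0, 2, 2, 4⟩,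
    ⟨-10, 0, 2, 2, 3⟩,
    ⟨-1, 0, 1, 16, 0⟩, ⟨-1, 0, 1, 13, 3⟩, ⟨1, 0, 1, 13, 2⟩, ⟨5, 0, 1, 13, 1⟩, ⟨2, 0, 1, 10, 5⟩,
    ⟨22, 0, 1, 10, 4⟩, ⟨7, 0, 1, 10, 3⟩, ⟨9, 0, 1, 10, 2⟩, ⟨15, 0, 1, 10, 1⟩, ⟨14, 0, 1, 10, 0⟩,
    ⟨3, 0, 1, 7, 7⟩, ⟨13, 0, 1, 7, 6⟩, ⟨-29, 0, 1, 7, 5⟩, ⟨-28, 0, 1, 7, 4⟩, ⟨33, 0, 1, 7, 3⟩,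
    ⟨-58, 0, 1, 7, 2⟩, ⟨-2, 0, 1, 7, 1⟩, ⟨11, 0, 1, 7, 0⟩, ⟨-15, 0, 1, 4, 7⟩, ⟨-15, 0, 1, 4, 6⟩,
    ⟨60, 0, 1, 4, 5⟩, ⟨-120, 0, 1, 4, 4⟩, ⟨110, 0, 1, 4, 3⟩, ⟨-65, 0, 1, 4, 2⟩, ⟨5, 0, 1, 4, 1⟩,
    ⟨-5, 0, 1, 1, 5⟩, ⟨5, 0, 1, 1, 4⟩,
    ⟨1, 0, 0, 15, 2⟩, ⟨-1, 0, 0, 15, 1⟩, ⟨1, 0, 0, 15, 0⟩, ⟨3, 0, 0, 12, 4⟩, ⟨-12, 0, 0, 12, 3⟩,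
    ⟨15, 0, 0, 12, 2⟩, ⟨-12, 0, 0, 12, 1⟩, ⟨3, 0, 0, 12, 0⟩, ⟨2, 0, 0, 9, 6⟩, ⟨-30, 0, 0, 9, 5⟩,
    ⟨60, 0, 0, 9, 4⟩, ⟨-86, 0, 0, 9, 3⟩, ⟨60, 0, 0, 9, 2⟩, ⟨-30, 0, 0, 9, 1⟩, ⟨2, 0, 0, 9, 0⟩,
    ⟨1, 0, 0, 6, 8⟩, ⟨-22, 0, 0, 6, 7⟩, ⟨79, 0, 0, 6, 6⟩, ⟨-134, 0, 0, 6, 5⟩, ⟨170, 0, 0, 6, 4⟩,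
    ⟨-134, 0, 0, 6, 3⟩, ⟨79, 0, 0, 6, 2⟩, ⟨-22, 0, 0, 6, 1⟩, ⟨1, 0, 0, 6, 0⟩, ⟨20, 0, 0, 3, 7⟩,
    ⟨-55, 0, 0, 3, 6⟩, ⟨75, 0, 0, 3, 5⟩, ⟨-55, 0, 0, 3, 4⟩, ⟨20, 0, 0, 3, 3⟩, ⟨1, 0, 0, 0, 6⟩]

/-- The integer polynomial `λ₁` in `A, B, C, D`: the coefficient of `t ^ 3` in the cubic `m_{A,B,C,D}`. -/
def lam1 {R : Type*} [CommRing R] (A B C D : R) : R := evalTerms lam1Terms A B C D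

/-- The monomials of the integer polynomial `λ₂`: the entry `⟨c, i, j, k, l⟩` stands for
`c * A ^ i * B ^ j * C ^ k * D ^ l`. -/
def lam2Terms : List (ℤ × ℕ × ℕ × ℕ × ℕ) :=
  [⟨1, 2, 6, 6, 3⟩, ⟨2, 2, 6, 6, 2⟩, ⟨3, 2, 6, 6, 1⟩, ⟨-1, 2, 6, 6, 0⟩,
    ⟨2, 2, 5, 8, 2⟩, ⟨-1, 2, 5, 8, 1⟩, ⟨-7, 2, 5, 8, 0⟩, ⟨1, 2, 5, 5, 4⟩, ⟨-5, 2, 5, 5, 3⟩,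
    ⟨-11, 2, 5, 5, 2⟩, ⟨7, 2, 5, 5, 1⟩, ⟨-3, 2, 5, 5, 0⟩,
    ⟨-1, 2, 4, 10, 2⟩, ⟨-10, 2, 4, 10, 1⟩, ⟨-7, 2, 4, 10, 0⟩, ⟨-3, 2, 4, 7, 4⟩, ⟨-6, 2, 4, 7, 3⟩,
    ⟨19, 2, 4, 7, 2⟩, ⟨25, 2, 4, 7, 1⟩, ⟨-2, 2, 4, 7, 0⟩, ⟨-5, 2, 4, 4, 4⟩, ⟨10, 2, 4, 4, 3⟩,
    ⟨-20, 2, 4, 4, 2⟩, ⟨10, 2, 4, 4, 1⟩,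
    ⟨-1, 2, 3, 12, 1⟩, ⟨3, 2, 3, 12, 0⟩, ⟨-5, 2, 3, 9, 3⟩, ⟨9, 2, 3, 9, 2⟩, ⟨2, 2, 3, 9, 0⟩,
    ⟨1, 2, 3, 6, 6⟩, ⟨-1, 2, 3, 6, 5⟩, ⟨13, 2, 3, 6, 4⟩, ⟨-12, 2, 3, 6, 3⟩, ⟨-44, 2, 3, 6, 2⟩,
    ⟨-4, 2, 3, 6, 1⟩, ⟨-1, 2, 3, 6, 0⟩, ⟨10, 2, 3, 3, 4⟩, ⟨30, 2, 3, 3, 3⟩, ⟨-10, 2, 3, 3, 2⟩,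
    ⟨1, 2, 2, 14, 0⟩, ⟨-1, 2, 2, 11, 3⟩, ⟨10, 2, 2, 11, 2⟩, ⟨-10, 2, 2, 11, 1⟩, ⟨-7, 2, 2, 11, 0⟩,
    ⟨2, 2, 2, 8, 5⟩, ⟨25, 2, 2, 8, 4⟩, ⟨-16, 2, 2, 8, 3⟩, ⟨43, 2, 2, 8, 2⟩, ⟨29, 2, 2, 8, 1⟩,
    ⟨-5, 2, 2, 8, 0⟩, ⟨1, 2, 2, 5, 7⟩, ⟨-5, 2, 2, 5, 6⟩, ⟨4, 2, 2, 5, 5⟩, ⟨-23, 2, 2, 5, 4⟩,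
    ⟨21, 2, 2, 5, 3⟩, ⟨-14, 2, 2, 5, 2⟩, ⟨24, 2, 2, 5, 1⟩, ⟨-2, 2, 2, 5, 0⟩, ⟨-25, 2, 2, 2, 4⟩,
    ⟨4, 2, 1, 13, 2⟩, ⟨1, 2, 1, 13, 1⟩, ⟨8, 2, 1, 13, 0⟩, ⟨6, 2, 1, 10, 4⟩, ⟨-25, 2, 1, 10, 3⟩,
    ⟨16, 2, 1, 10, 2⟩, ⟨-25, 2, 1, 10, 1⟩, ⟨26, 2, 1, 10, 0⟩, ⟨-37, 2, 1, 7, 5⟩, ⟨19, 2, 1, 7, 4⟩,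
    ⟨-31, 2, 1, 7, 3⟩, ⟨-21, 2, 1, 7, 2⟩, ⟨-47, 2, 1, 7, 1⟩, ⟨15, 2, 1, 7, 0⟩, ⟨-5, 2, 1, 4, 7⟩,
    ⟨10, 2, 1, 4, 6⟩, ⟨40, 2, 1, 4, 5⟩, ⟨-80, 2, 1, 4, 4⟩, ⟨120, 2, 1, 4, 3⟩, ⟨-60, 2, 1, 4, 2⟩,
    ⟨5, 2, 1, 4, 1⟩, ⟨5, 2, 1, 1, 4⟩,
    ⟨-2, 2, 0, 15, 1⟩, ⟨1, 2, 0, 15, 0⟩, ⟨-9, 2, 0, 12, 3⟩, ⟨15, 2, 0, 12, 2⟩, ⟨-20, 2, 0, 12, 1⟩,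
    ⟨1, 2, 0, 12, 0⟩, ⟨-11, 2, 0, 9, 5⟩, ⟨51, 2, 0, 9, 4⟩, ⟨-81, 2, 0, 9, 3⟩, ⟨89, 2, 0, 9, 2⟩,
    ⟨-39, 2, 0, 9, 1⟩, ⟨-1, 2, 0, 9, 0⟩, ⟨-5, 2, 0, 6, 7⟩, ⟨46, 2, 0, 6, 6⟩, ⟨-103, 2, 0, 6, 5⟩,
    ⟨171, 2, 0, 6, 4⟩, ⟨-167, 2, 0, 6, 3⟩, ⟨121, 2, 0, 6, 2⟩, ⟨-28, 2, 0, 6, 1⟩, ⟨1, 2, 0, 6, 0⟩,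
    ⟨10, 2, 0, 3, 7⟩, ⟨-50, 2, 0, 3, 6⟩, ⟨75, 2, 0, 3, 5⟩, ⟨-70, 2, 0, 3, 4⟩, ⟨20, 2, 0, 3, 3⟩,
    ⟨1, 2, 0, 0, 6⟩,
    ⟨1, 1, 7, 5, 0⟩,
    ⟨-1, 1, 6, 7, 3⟩, ⟨-3, 1, 6, 7, 2⟩, ⟨4, 1, 6, 7, 1⟩, ⟨5, 1, 6, 7, 0⟩, ⟨-5, 1, 6, 4, 1⟩,
    ⟨3, 1, 5, 9, 2⟩, ⟨18, 1, 5, 9, 1⟩, ⟨6, 1, 5, 9, 0⟩, ⟨6, 1, 5, 6, 3⟩, ⟨-26, 1, 5, 6, 2⟩,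
    ⟨-12, 1, 5, 6, 1⟩, ⟨-3, 1, 5, 6, 0⟩, ⟨10, 1, 5, 3, 2⟩,
    ⟨3, 1, 4, 11, 2⟩, ⟨9, 1, 4, 11, 1⟩, ⟨-5, 1, 4, 11, 0⟩, ⟨3, 1, 4, 8, 4⟩, ⟨-3, 1, 4, 8, 3⟩,
    ⟨-57, 1, 4, 8, 2⟩, ⟨-12, 1, 4, 8, 0⟩, ⟨1, 1, 4, 5, 5⟩, ⟨60, 1, 4, 5, 3⟩, ⟨9, 1, 4, 5, 2⟩,
    ⟨17, 1, 4, 5, 1⟩, ⟨-2, 1, 4, 5, 0⟩, ⟨-10, 1, 4, 2, 3⟩,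
    ⟨-2, 1, 3, 13, 1⟩, ⟨-6, 1, 3, 13, 0⟩, ⟨1, 1, 3, 10, 4⟩, ⟨-12, 1, 3, 10, 2⟩, ⟨36, 1, 3, 10, 1⟩,
    ⟨-3, 1, 3, 10, 0⟩, ⟨-1, 1, 3, 7, 6⟩, ⟨-3, 1, 3, 7, 5⟩, ⟨-19, 1, 3, 7, 4⟩, ⟨57, 1, 3, 7, 3⟩,
    ⟨-48, 1, 3, 7, 2⟩, ⟨31, 1, 3, 7, 1⟩, ⟨-2, 1, 3, 7, 0⟩, ⟨-5, 1, 3, 4, 5⟩, ⟨-50, 1, 3, 4, 4⟩,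
    ⟨-10, 1, 3, 4, 3⟩, ⟨-25, 1, 3, 4, 2⟩, ⟨5, 1, 3, 1, 4⟩,
    ⟨-3, 1, 2, 12, 3⟩, ⟨-16, 1, 2, 12, 2⟩, ⟨6, 1, 2, 12, 1⟩, ⟨-9, 1, 2, 12, 0⟩, ⟨-7, 1, 2, 9, 5⟩,
    ⟨-21, 1, 2, 9, 4⟩, ⟨57, 1, 2, 9, 3⟩, ⟨-91, 1, 2, 9, 2⟩, ⟨18, 1, 2, 9, 1⟩, ⟨-27, 1, 2, 9, 0⟩,
    ⟨3, 1, 2, 6, 6⟩, ⟨64, 1, 2, 6, 5⟩, ⟨-90, 1, 2, 6, 4⟩, ⟨147, 1, 2, 6, 3⟩, ⟨-49, 1, 2, 6, 2⟩,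
    ⟨33, 1, 2, 6, 1⟩, ⟨-9, 1, 2, 6, 0⟩, ⟨10, 1, 2, 3, 5⟩, ⟨15, 1, 2, 3, 4⟩, ⟨10, 1, 2, 3, 2⟩,
    ⟨-1, 1, 2, 0, 5⟩,
    ⟨4, 1, 1, 14, 1⟩, ⟨-9, 1, 1, 14, 0⟩, ⟨11, 1, 1, 11, 4⟩, ⟨28, 1, 1, 11, 3⟩, ⟨-23, 1, 1, 11, 2⟩,
    ⟨69, 1, 1, 11, 1⟩, ⟨-15, 1, 1, 11, 0⟩, ⟨13, 1, 1, 8, 6⟩, ⟨11, 1, 1, 8, 5⟩, ⟨-77, 1, 1, 8, 4⟩,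
    ⟨139, 1, 1, 8, 3⟩, ⟨-137, 1, 1, 8, 2⟩, ⟨101, 1, 1, 8, 1⟩, ⟨-2, 1, 1, 8, 0⟩, ⟨1, 1, 1, 5, 8⟩,
    ⟨-74, 1, 1, 5, 6⟩, ⟨129, 1, 1, 5, 5⟩, ⟨-211, 1, 1, 5, 4⟩, ⟨147, 1, 1, 5, 3⟩,
    ⟨-124, 1, 1, 5, 2⟩, ⟨31, 1, 1, 5, 1⟩, ⟨-1, 1, 1, 5, 0⟩, ⟨15, 1, 1, 2, 6⟩, ⟨-25, 1, 1, 2, 5⟩,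
    ⟨25, 1, 1, 2, 4⟩, ⟨-10, 1, 1, 2, 3⟩,
    ⟨1, 1, 0, 16, 1⟩, ⟨1, 1, 0, 16, 0⟩, ⟨-2, 1, 0, 13, 2⟩, ⟨-3, 1, 0, 13, 1⟩, ⟨8, 1, 0, 13, 0⟩,
    ⟨-7, 1, 0, 10, 5⟩, ⟨-9, 1, 0, 10, 4⟩, ⟨-5, 1, 0, 10, 2⟩, ⟨-31, 1, 0, 10, 1⟩,
    ⟨12, 1, 0, 10, 0⟩, ⟨-5, 1, 0, 7, 7⟩, ⟨-6, 1, 0, 7, 6⟩, ⟨48, 1, 0, 7, 5⟩, ⟨-76, 1, 0, 7, 4⟩,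
    ⟨62, 1, 0, 7, 3⟩, ⟨-6, 1, 0, 7, 2⟩, ⟨-27, 1, 0, 7, 1⟩, ⟨4, 1, 0, 7, 0⟩, ⟨-5, 1, 0, 4, 8⟩,
    ⟨45, 1, 0, 4, 7⟩, ⟨-100, 1, 0, 4, 6⟩, ⟨155, 1, 0, 4, 5⟩, ⟨-135, 1, 0, 4, 4⟩, ⟨85, 1, 0, 4, 3⟩,
    ⟨-15, 1, 0, 4, 2⟩, ⟨-5, 1, 0, 1, 7⟩, ⟨6, 1, 0, 1, 6⟩, ⟨-6, 1, 0, 1, 5⟩,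
    ⟨-1, 0, 7, 6, 4⟩, ⟨-1, 0, 7, 6, 3⟩, ⟨-1, 0, 7, 6, 2⟩, ⟨-1, 0, 7, 6, 1⟩, ⟨-1, 0, 7, 6, 0⟩,
    ⟨-1, 0, 6, 8, 3⟩, ⟨-4, 0, 6, 8, 2⟩, ⟨-7, 0, 6, 8, 1⟩, ⟨-3, 0, 6, 8, 0⟩, ⟨-1, 0, 6, 5, 5⟩,
    ⟨6, 0, 6, 5, 4⟩, ⟨6, 0, 6, 5, 3⟩, ⟨6, 0, 6, 5, 2⟩, ⟨5, 0, 6, 5, 1⟩, ⟨1, 0, 6, 5, 0⟩,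
    ⟨-1, 0, 5, 10, 2⟩, ⟨-4, 0, 5, 10, 1⟩, ⟨2, 0, 5, 10, 0⟩, ⟨3, 0, 5, 7, 5⟩, ⟨3, 0, 5, 7, 4⟩,
    ⟨7, 0, 5, 7, 3⟩, ⟨25, 0, 5, 7, 2⟩, ⟨11, 0, 5, 7, 1⟩, ⟨7, 0, 5, 7, 0⟩, ⟨5, 0, 5, 4, 5⟩,
    ⟨-15, 0, 5, 4, 4⟩, ⟨-15, 0, 5, 4, 3⟩, ⟨-10, 0, 5, 4, 2⟩, ⟨-5, 0, 5, 4, 1⟩,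
    ⟨2, 0, 4, 12, 1⟩, ⟨5, 0, 4, 12, 0⟩, ⟨2, 0, 4, 9, 4⟩, ⟨9, 0, 4, 9, 3⟩, ⟨-5, 0, 4, 9, 2⟩,
    ⟨-16, 0, 4, 9, 1⟩, ⟨1, 0, 4, 9, 0⟩, ⟨-1, 0, 4, 6, 7⟩, ⟨2, 0, 4, 6, 6⟩, ⟨-14, 0, 4, 6, 5⟩,
    ⟨-25, 0, 4, 6, 4⟩, ⟨10, 0, 4, 6, 3⟩, ⟨-21, 0, 4, 6, 2⟩, ⟨-17, 0, 4, 6, 1⟩, ⟨-4, 0, 4, 6, 0⟩,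
    ⟨-10, 0, 4, 3, 5⟩, ⟨20, 0, 4, 3, 4⟩, ⟨10, 0, 4, 3, 3⟩, ⟨10, 0, 4, 3, 2⟩,
    ⟨8, 0, 3, 11, 2⟩, ⟨2, 0, 3, 11, 1⟩, ⟨-2, 0, 3, 11, 0⟩, ⟨-1, 0, 3, 8, 6⟩, ⟨-5, 0, 3, 8, 5⟩,
    ⟨11, 0, 3, 8, 4⟩, ⟨-20, 0, 3, 8, 3⟩, ⟨17, 0, 3, 8, 2⟩, ⟨34, 0, 3, 8, 1⟩, ⟨3, 0, 3, 8, 0⟩,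
    ⟨-1, 0, 3, 5, 8⟩, ⟨6, 0, 3, 5, 7⟩, ⟨-8, 0, 3, 5, 6⟩, ⟨27, 0, 3, 5, 5⟩, ⟨7, 0, 3, 5, 4⟩,
    ⟨-20, 0, 3, 5, 3⟩, ⟨-10, 0, 3, 5, 2⟩, ⟨19, 0, 3, 5, 1⟩, ⟨10, 0, 3, 2, 5⟩, ⟨-5, 0, 3, 2, 4⟩,
    ⟨-10, 0, 3, 2, 3⟩,
    ⟨-1, 0, 2, 13, 2⟩, ⟨-3, 0, 2, 13, 1⟩, ⟨8, 0, 2, 13, 0⟩, ⟨-2, 0, 2, 10, 5⟩, ⟨-17, 0, 2, 10, 4⟩,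
    ⟨-5, 0, 2, 10, 3⟩, ⟨-6, 0, 2, 10, 2⟩, ⟨-48, 0, 2, 10, 1⟩, ⟨11, 0, 2, 10, 0⟩,
    ⟨-11, 0, 2, 7, 6⟩, ⟨45, 0, 2, 7, 5⟩, ⟨-64, 0, 2, 7, 4⟩, ⟨46, 0, 2, 7, 3⟩, ⟨8, 0, 2, 7, 2⟩,
    ⟨-57, 0, 2, 7, 1⟩, ⟨5, 0, 2, 4, 8⟩, ⟨-15, 0, 2, 4, 7⟩, ⟨15, 0, 2, 4, 6⟩, ⟨20, 0, 2, 4, 5⟩,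
    ⟨-65, 0, 2, 4, 4⟩, ⟨80, 0, 2, 4, 3⟩, ⟨-10, 0, 2, 4, 2⟩, ⟨-5, 0, 2, 4, 1⟩, ⟨-10, 0, 2, 1, 5⟩,
    ⟨5, 0, 2, 1, 4⟩,
    ⟨-1, 0, 1, 15, 1⟩, ⟨-1, 0, 1, 15, 0⟩, ⟨1, 0, 1, 12, 4⟩, ⟨1, 0, 1, 12, 3⟩, ⟨-5, 0, 1, 12, 2⟩,
    ⟨11, 0, 1, 12, 1⟩, ⟨-14, 0, 1, 12, 0⟩, ⟨8, 0, 1, 9, 6⟩, ⟨8, 0, 1, 9, 5⟩, ⟨6, 0, 1, 9, 4⟩,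
    ⟨46, 0, 1, 9, 3⟩, ⟨-40, 0, 1, 9, 2⟩, ⟨74, 0, 1, 9, 1⟩, ⟨-20, 0, 1, 9, 0⟩, ⟨5, 0, 1, 6, 8⟩,
    ⟨-9, 0, 1, 6, 7⟩, ⟨11, 0, 1, 6, 6⟩, ⟨-41, 0, 1, 6, 5⟩, ⟨37, 0, 1, 6, 4⟩, ⟨-7, 0, 1, 6, 3⟩,
    ⟨-44, 0, 1, 6, 2⟩, ⟨54, 0, 1, 6, 1⟩, ⟨-6, 0, 1, 6, 0⟩, ⟨-10, 0, 1, 3, 8⟩, ⟨20, 0, 1, 3, 7⟩,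
    ⟨-20, 0, 1, 3, 6⟩, ⟨-15, 0, 1, 3, 5⟩, ⟨45, 0, 1, 3, 4⟩, ⟨-50, 0, 1, 3, 3⟩, ⟨10, 0, 1, 3, 2⟩,
    ⟨1, 0, 1, 0, 6⟩, ⟨1, 0, 1, 0, 5⟩,
    ⟨1, 0, 0, 14, 3⟩, ⟨1, 0, 0, 14, 0⟩, ⟨1, 0, 0, 11, 5⟩, ⟨-6, 0, 0, 11, 4⟩, ⟨6, 0, 0, 11, 3⟩,
    ⟨1, 0, 0, 11, 2⟩, ⟨-6, 0, 0, 11, 1⟩, ⟨6, 0, 0, 11, 0⟩, ⟨-1, 0, 0, 8, 7⟩, ⟨-21, 0, 0, 8, 6⟩,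
    ⟨51, 0, 0, 8, 5⟩, ⟨-87, 0, 0, 8, 4⟩, ⟨57, 0, 0, 8, 3⟩, ⟨-21, 0, 0, 8, 2⟩, ⟨-14, 0, 0, 8, 1⟩,
    ⟨6, 0, 0, 8, 0⟩, ⟨1, 0, 0, 5, 9⟩, ⟨-24, 0, 0, 5, 8⟩, ⟨105, 0, 0, 5, 7⟩, ⟨-231, 0, 0, 5, 6⟩,
    ⟨339, 0, 0, 5, 5⟩, ⟨-321, 0, 0, 5, 4⟩, ⟨200, 0, 0, 5, 3⟩, ⟨-69, 0, 0, 5, 2⟩, ⟨6, 0, 0, 5, 1⟩,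
    ⟨10, 0, 0, 2, 8⟩, ⟨-30, 0, 0, 2, 7⟩, ⟨45, 0, 0, 2, 6⟩, ⟨-36, 0, 0, 2, 5⟩, ⟨15, 0, 0, 2, 4⟩]

/-- The integer polynomial `λ₂` in `A, B, C, D`: the coefficient of `t ^ 2` in the cubic `m_{A,B,C,D}`. -/
def lam2 {R : Type*} [CommRing R] (A B C D : R) : R := evalTerms lam2Terms A B C D

/-- The monomials of the integer polynomial `λ₃`: the entry `⟨c, i, j, k, l⟩` stands for
`c * A ^ i * B ^ j * C ^ k * D ^ l`. -/
def lam3Terms : List (ℤ × ℕ × ℕ × ℕ × ℕ) :=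
  [⟨1, 2, 6, 5, 4⟩, ⟨1, 2, 6, 5, 3⟩, ⟨1, 2, 6, 5, 2⟩, ⟨1, 2, 6, 5, 1⟩, ⟨2, 2, 6, 5, 0⟩,
    ⟨2, 2, 5, 7, 3⟩, ⟨5, 2, 5, 7, 2⟩, ⟨17, 2, 5, 7, 1⟩, ⟨6, 2, 5, 7, 0⟩, ⟨-5, 2, 5, 4, 4⟩,
    ⟨-5, 2, 5, 4, 3⟩, ⟨-5, 2, 5, 4, 2⟩, ⟨-10, 2, 5, 4, 1⟩,
    ⟨8, 2, 4, 9, 2⟩, ⟨20, 2, 4, 9, 1⟩, ⟨-10, 2, 4, 9, 0⟩, ⟨-3, 2, 4, 6, 5⟩, ⟨-6, 2, 4, 6, 4⟩,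
    ⟨-15, 2, 4, 6, 3⟩, ⟨-80, 2, 4, 6, 2⟩, ⟨-2, 2, 4, 6, 1⟩, ⟨-19, 2, 4, 6, 0⟩, ⟨10, 2, 4, 3, 4⟩,
    ⟨10, 2, 4, 3, 3⟩, ⟨20, 2, 4, 3, 2⟩,
    ⟨1, 2, 3, 11, 2⟩, ⟨-13, 2, 3, 11, 1⟩, ⟨-24, 2, 3, 11, 0⟩, ⟨-5, 2, 3, 8, 4⟩, ⟨-41, 2, 3, 8, 3⟩,
    ⟨-30, 2, 3, 8, 2⟩, ⟨47, 2, 3, 8, 1⟩, ⟨-40, 2, 3, 8, 0⟩, ⟨1, 2, 3, 5, 7⟩, ⟨1, 2, 3, 5, 6⟩,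
    ⟨15, 2, 3, 5, 5⟩, ⟨33, 2, 3, 5, 4⟩, ⟨132, 2, 3, 5, 3⟩, ⟨-45, 2, 3, 5, 2⟩, ⟨87, 2, 3, 5, 1⟩,
    ⟨-9, 2, 3, 5, 0⟩, ⟨-10, 2, 3, 2, 4⟩, ⟨-20, 2, 3, 2, 3⟩,
    ⟨-4, 2, 2, 13, 1⟩, ⟨1, 2, 2, 10, 4⟩, ⟨4, 2, 2, 10, 3⟩, ⟨49, 2, 2, 10, 2⟩, ⟨23, 2, 2, 10, 1⟩,
    ⟨18, 2, 2, 10, 0⟩, ⟨2, 2, 2, 7, 6⟩, ⟨14, 2, 2, 7, 5⟩, ⟨48, 2, 2, 7, 4⟩, ⟨-8, 2, 2, 7, 3⟩,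
    ⟨-17, 2, 2, 7, 2⟩, ⟨39, 2, 2, 7, 1⟩, ⟨24, 2, 2, 7, 0⟩, ⟨-5, 2, 2, 4, 7⟩, ⟨-5, 2, 2, 4, 6⟩,
    ⟨-35, 2, 2, 4, 5⟩, ⟨-130, 2, 2, 4, 4⟩, ⟨100, 2, 2, 4, 3⟩, ⟨-140, 2, 2, 4, 2⟩,
    ⟨20, 2, 2, 4, 1⟩, ⟨10, 2, 2, 1, 4⟩,
    ⟨2, 2, 1, 15, 0⟩, ⟨1, 2, 1, 12, 3⟩, ⟨9, 2, 1, 12, 2⟩, ⟨-10, 2, 1, 12, 1⟩, ⟨14, 2, 1, 12, 0⟩,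
    ⟨-2, 2, 1, 9, 5⟩, ⟨-7, 2, 1, 9, 4⟩, ⟨-62, 2, 1, 9, 3⟩, ⟨31, 2, 1, 9, 2⟩, ⟨-70, 2, 1, 9, 1⟩,
    ⟨21, 2, 1, 9, 0⟩, ⟨-3, 2, 1, 6, 7⟩, ⟨-9, 2, 1, 6, 6⟩, ⟨-38, 2, 1, 6, 5⟩, ⟨77, 2, 1, 6, 4⟩,
    ⟨-96, 2, 1, 6, 3⟩, ⟨67, 2, 1, 6, 2⟩, ⟨-75, 2, 1, 6, 1⟩, ⟨8, 2, 1, 6, 0⟩, ⟨10, 2, 1, 3, 7⟩,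
    ⟨10, 2, 1, 3, 6⟩, ⟨50, 2, 1, 3, 5⟩, ⟨-45, 2, 1, 3, 4⟩, ⟨80, 2, 1, 3, 3⟩, ⟨-10, 2, 1, 3, 2⟩,
    ⟨-1, 2, 1, 0, 5⟩,
    ⟨-1, 2, 0, 14, 2⟩, ⟨-1, 2, 0, 14, 1⟩, ⟨-3, 2, 0, 11, 4⟩, ⟨3, 2, 0, 11, 3⟩, ⟨-8, 2, 0, 11, 1⟩,
    ⟨-2, 2, 0, 11, 0⟩, ⟨-2, 2, 0, 8, 6⟩, ⟨19, 2, 0, 8, 5⟩, ⟨-9, 2, 0, 8, 4⟩, ⟨5, 2, 0, 8, 3⟩,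
    ⟨29, 2, 0, 8, 2⟩, ⟨-9, 2, 0, 8, 1⟩, ⟨-3, 2, 0, 8, 0⟩, ⟨-1, 2, 0, 5, 8⟩, ⟨17, 2, 0, 5, 7⟩,
    ⟨-33, 2, 0, 5, 6⟩, ⟨31, 2, 0, 5, 5⟩, ⟨1, 2, 0, 5, 4⟩, ⟨-33, 2, 0, 5, 3⟩, ⟨42, 2, 0, 5, 2⟩,
    ⟨-6, 2, 0, 5, 1⟩, ⟨-10, 2, 0, 2, 7⟩, ⟨5, 2, 0, 2, 6⟩, ⟨-15, 2, 0, 2, 4⟩,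
    ⟨-1, 1, 6, 6, 4⟩, ⟨-2, 1, 6, 6, 3⟩, ⟨-3, 1, 6, 6, 2⟩, ⟨-9, 1, 6, 6, 1⟩, ⟨1, 1, 6, 6, 0⟩,
    ⟨-2, 1, 5, 8, 3⟩, ⟨-18, 1, 5, 8, 2⟩, ⟨-18, 1, 5, 8, 1⟩, ⟨14, 1, 5, 8, 0⟩, ⟨1, 1, 5, 5, 5⟩,
    ⟨6, 1, 5, 5, 4⟩, ⟨12, 1, 5, 5, 3⟩, ⟨42, 1, 5, 5, 2⟩, ⟨-12, 1, 5, 5, 1⟩, ⟨9, 1, 5, 5, 0⟩,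
    ⟨-1, 1, 4, 10, 3⟩, ⟨-9, 1, 4, 10, 2⟩, ⟨24, 1, 4, 10, 1⟩, ⟨31, 1, 4, 10, 0⟩, ⟨3, 1, 4, 7, 5⟩,
    ⟨12, 1, 4, 7, 4⟩, ⟨73, 1, 4, 7, 3⟩, ⟨21, 1, 4, 7, 2⟩, ⟨-33, 1, 4, 7, 1⟩, ⟨21, 1, 4, 7, 0⟩,
    ⟨-5, 1, 4, 4, 5⟩, ⟨-15, 1, 4, 4, 4⟩, ⟨-75, 1, 4, 4, 3⟩, ⟨40, 1, 4, 4, 2⟩, ⟨-35, 1, 4, 4, 1⟩,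
    ⟨3, 1, 3, 12, 2⟩, ⟨28, 1, 3, 12, 1⟩, ⟨6, 1, 3, 12, 0⟩, ⟨5, 1, 3, 9, 4⟩, ⟨20, 1, 3, 9, 3⟩,
    ⟨-129, 1, 3, 9, 2⟩, ⟨-20, 1, 3, 9, 1⟩, ⟨-32, 1, 3, 9, 0⟩, ⟨-1, 1, 3, 6, 7⟩, ⟨-5, 1, 3, 6, 6⟩,
    ⟨-24, 1, 3, 6, 5⟩, ⟨-128, 1, 3, 6, 4⟩, ⟨70, 1, 3, 6, 3⟩, ⟨-42, 1, 3, 6, 2⟩, ⟨1, 1, 3, 6, 1⟩,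
    ⟨-28, 1, 3, 6, 0⟩, ⟨10, 1, 3, 3, 5⟩, ⟨60, 1, 3, 3, 4⟩, ⟨-60, 1, 3, 3, 3⟩, ⟨50, 1, 3, 3, 2⟩,
    ⟨-11, 1, 2, 14, 0⟩, ⟨-3, 1, 2, 11, 4⟩, ⟨-23, 1, 2, 11, 3⟩, ⟨-62, 1, 2, 11, 2⟩,
    ⟨27, 1, 2, 11, 1⟩, ⟨-52, 1, 2, 11, 0⟩, ⟨-2, 1, 2, 8, 6⟩, ⟨-10, 1, 2, 8, 5⟩, ⟨21, 1, 2, 8, 4⟩,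
    ⟨184, 1, 2, 8, 3⟩, ⟨-92, 1, 2, 8, 2⟩, ⟨153, 1, 2, 8, 1⟩, ⟨-41, 1, 2, 8, 0⟩, ⟨1, 1, 2, 5, 8⟩,
    ⟨6, 1, 2, 5, 7⟩, ⟨27, 1, 2, 5, 6⟩, ⟨87, 1, 2, 5, 5⟩, ⟨-135, 1, 2, 5, 4⟩, ⟨173, 1, 2, 5, 3⟩,
    ⟨-115, 1, 2, 5, 2⟩, ⟨90, 1, 2, 5, 1⟩, ⟨-5, 1, 2, 5, 0⟩, ⟨-25, 1, 2, 2, 5⟩, ⟨45, 1, 2, 2, 4⟩,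
    ⟨-30, 1, 2, 2, 3⟩,
    ⟨-1, 1, 1, 16, 0⟩, ⟨2, 1, 1, 13, 3⟩, ⟨5, 1, 1, 13, 2⟩, ⟨11, 1, 1, 13, 1⟩, ⟨-2, 1, 1, 13, 0⟩,
    ⟨10, 1, 1, 10, 5⟩, ⟨22, 1, 1, 10, 4⟩, ⟨25, 1, 1, 10, 3⟩, ⟨1, 1, 1, 10, 2⟩, ⟨51, 1, 1, 10, 1⟩,
    ⟨11, 1, 1, 10, 0⟩, ⟨6, 1, 1, 7, 7⟩, ⟨-7, 1, 1, 7, 6⟩, ⟨-32, 1, 1, 7, 5⟩, ⟨-76, 1, 1, 7, 4⟩,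
    ⟨44, 1, 1, 7, 3⟩, ⟨-112, 1, 1, 7, 2⟩, ⟨28, 1, 1, 7, 1⟩, ⟨11, 1, 1, 7, 0⟩, ⟨-5, 1, 1, 4, 8⟩,
    ⟨-15, 1, 1, 4, 7⟩, ⟨-15, 1, 1, 4, 6⟩, ⟨70, 1, 1, 4, 5⟩, ⟨-125, 1, 1, 4, 4⟩, ⟨110, 1, 1, 4, 3⟩,
    ⟨-80, 1, 1, 4, 2⟩, ⟨5, 1, 1, 4, 1⟩, ⟨-11, 1, 1, 1, 5⟩, ⟨5, 1, 1, 1, 4⟩,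
    ⟨1, 1, 0, 15, 1⟩, ⟨1, 1, 0, 15, 0⟩, ⟨-3, 1, 0, 12, 4⟩, ⟨-5, 1, 0, 12, 2⟩, ⟨-3, 1, 0, 12, 1⟩,
    ⟨5, 1, 0, 12, 0⟩, ⟨-7, 1, 0, 9, 6⟩, ⟨2, 1, 0, 9, 5⟩, ⟨-12, 1, 0, 9, 4⟩, ⟨-2, 1, 0, 9, 3⟩,
    ⟨-8, 1, 0, 9, 2⟩, ⟨-22, 1, 0, 9, 1⟩, ⟨5, 1, 0, 9, 0⟩, ⟨-3, 1, 0, 6, 8⟩, ⟨7, 1, 0, 6, 7⟩,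
    ⟨9, 1, 0, 6, 6⟩, ⟨6, 1, 0, 6, 5⟩, ⟨2, 1, 0, 6, 4⟩, ⟨20, 1, 0, 6, 3⟩, ⟨9, 1, 0, 6, 2⟩,
    ⟨-15, 1, 0, 6, 1⟩, ⟨1, 1, 0, 6, 0⟩, ⟨10, 1, 0, 3, 8⟩, ⟨-20, 1, 0, 3, 7⟩, ⟨15, 1, 0, 3, 6⟩,
    ⟨5, 1, 0, 3, 5⟩, ⟨-20, 1, 0, 3, 4⟩, ⟨20, 1, 0, 3, 3⟩, ⟨1, 1, 0, 0, 7⟩, ⟨1, 1, 0, 0, 6⟩,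
    ⟨-1, 0, 7, 5, 5⟩,
    ⟨-1, 0, 6, 7, 4⟩, ⟨-1, 0, 6, 7, 3⟩, ⟨2, 0, 6, 7, 2⟩, ⟨3, 0, 6, 7, 1⟩, ⟨-3, 0, 6, 7, 0⟩,
    ⟨5, 0, 6, 4, 5⟩,
    ⟨-1, 0, 5, 9, 3⟩, ⟨-4, 0, 5, 9, 2⟩, ⟨-13, 0, 5, 9, 1⟩, ⟨-15, 0, 5, 9, 0⟩, ⟨3, 0, 5, 6, 6⟩,
    ⟨2, 0, 5, 6, 5⟩, ⟨1, 0, 5, 6, 4⟩, ⟨4, 0, 5, 6, 3⟩, ⟨-4, 0, 5, 6, 2⟩, ⟨10, 0, 5, 6, 1⟩,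
    ⟨-4, 0, 5, 6, 0⟩, ⟨-10, 0, 5, 3, 5⟩,
    ⟨-2, 0, 4, 11, 2⟩, ⟨-16, 0, 4, 11, 1⟩, ⟨-7, 0, 4, 11, 0⟩, ⟨2, 0, 4, 8, 5⟩, ⟨9, 0, 4, 8, 4⟩,
    ⟨15, 0, 4, 8, 3⟩, ⟨68, 0, 4, 8, 2⟩, ⟨37, 0, 4, 8, 1⟩, ⟨19, 0, 4, 8, 0⟩, ⟨-1, 0, 4, 5, 8⟩,
    ⟨-13, 0, 4, 5, 6⟩, ⟨-12, 0, 4, 5, 5⟩, ⟨4, 0, 4, 5, 4⟩, ⟨-38, 0, 4, 5, 3⟩, ⟨-9, 0, 4, 5, 2⟩,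
    ⟨2, 0, 4, 5, 1⟩, ⟨7, 0, 4, 5, 0⟩, ⟨10, 0, 4, 2, 5⟩,
    ⟨1, 0, 3, 13, 1⟩, ⟨9, 0, 3, 13, 0⟩, ⟨3, 0, 3, 10, 4⟩, ⟨29, 0, 3, 10, 3⟩, ⟨32, 0, 3, 10, 2⟩,
    ⟨-3, 0, 3, 10, 1⟩, ⟨40, 0, 3, 10, 0⟩, ⟨-1, 0, 3, 7, 7⟩, ⟨-7, 0, 3, 7, 6⟩, ⟨1, 0, 3, 7, 5⟩,
    ⟨-90, 0, 3, 7, 4⟩, ⟨-76, 0, 3, 7, 3⟩, ⟨-31, 0, 3, 7, 2⟩, ⟨-92, 0, 3, 7, 1⟩, ⟨14, 0, 3, 7, 0⟩,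
    ⟨5, 0, 3, 4, 8⟩, ⟨25, 0, 3, 4, 6⟩, ⟨30, 0, 3, 4, 5⟩, ⟨45, 0, 3, 4, 4⟩, ⟨5, 0, 3, 4, 3⟩,
    ⟨35, 0, 3, 4, 2⟩, ⟨-25, 0, 3, 4, 1⟩, ⟨-5, 0, 3, 1, 5⟩,
    ⟨1, 0, 2, 15, 0⟩, ⟨-3, 0, 2, 12, 3⟩, ⟨-12, 0, 2, 12, 2⟩, ⟨-4, 0, 2, 12, 1⟩, ⟨-6, 0, 2, 12, 0⟩,
    ⟨-1, 0, 2, 9, 6⟩, ⟨-20, 0, 2, 9, 5⟩, ⟨-35, 0, 2, 9, 4⟩, ⟨8, 0, 2, 9, 3⟩, ⟨-68, 0, 2, 9, 2⟩,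
    ⟨-7, 0, 2, 9, 1⟩, ⟨-34, 0, 2, 9, 0⟩, ⟨2, 0, 2, 6, 8⟩, ⟨-5, 0, 2, 6, 7⟩, ⟨40, 0, 2, 6, 6⟩,
    ⟨64, 0, 2, 6, 5⟩, ⟨28, 0, 2, 6, 4⟩, ⟨99, 0, 2, 6, 3⟩, ⟨26, 0, 2, 6, 2⟩, ⟨39, 0, 2, 6, 1⟩,
    ⟨-17, 0, 2, 6, 0⟩, ⟨-10, 0, 2, 3, 8⟩, ⟨-30, 0, 2, 3, 6⟩, ⟨-80, 0, 2, 3, 5⟩, ⟨50, 0, 2, 3, 4⟩,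
    ⟨-80, 0, 2, 3, 3⟩, ⟨30, 0, 2, 3, 2⟩, ⟨1, 0, 2, 0, 5⟩,
    ⟨-1, 0, 1, 14, 2⟩, ⟨-2, 0, 1, 14, 0⟩, ⟨2, 0, 1, 11, 5⟩, ⟨4, 0, 1, 11, 4⟩, ⟨11, 0, 1, 11, 3⟩,
    ⟨-6, 0, 1, 11, 2⟩, ⟨17, 0, 1, 11, 1⟩, ⟨-7, 0, 1, 11, 0⟩, ⟨6, 0, 1, 8, 7⟩, ⟨7, 0, 1, 8, 6⟩,
    ⟨28, 0, 1, 8, 5⟩, ⟨-33, 0, 1, 8, 4⟩, ⟨96, 0, 1, 8, 3⟩, ⟨-53, 0, 1, 8, 2⟩, ⟨62, 0, 1, 8, 1⟩,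
    ⟨-2, 0, 1, 8, 0⟩, ⟨2, 0, 1, 5, 9⟩, ⟨-12, 0, 1, 5, 8⟩, ⟨19, 0, 1, 5, 7⟩, ⟨-128, 0, 1, 5, 6⟩,
    ⟨156, 0, 1, 5, 5⟩, ⟨-241, 0, 1, 5, 4⟩, ⟨146, 0, 1, 5, 3⟩, ⟨-119, 0, 1, 5, 2⟩,
    ⟨37, 0, 1, 5, 1⟩, ⟨-1, 0, 1, 5, 0⟩, ⟨10, 0, 1, 2, 8⟩, ⟨40, 0, 1, 2, 6⟩, ⟨-20, 0, 1, 2, 5⟩,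
    ⟨40, 0, 1, 2, 4⟩, ⟨-10, 0, 1, 2, 3⟩,
    ⟨1, 0, 0, 13, 3⟩, ⟨1, 0, 0, 13, 0⟩, ⟨-2, 0, 0, 10, 6⟩, ⟨1, 0, 0, 10, 5⟩, ⟨-6, 0, 0, 10, 4⟩,
    ⟨2, 0, 0, 10, 3⟩, ⟨1, 0, 0, 10, 2⟩, ⟨-6, 0, 0, 10, 1⟩, ⟨4, 0, 0, 10, 0⟩, ⟨-3, 0, 0, 7, 8⟩,
    ⟨-1, 0, 0, 7, 7⟩, ⟨-3, 0, 0, 7, 5⟩, ⟨-15, 0, 0, 7, 4⟩, ⟨3, 0, 0, 7, 3⟩, ⟨-14, 0, 0, 7, 1⟩,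
    ⟨3, 0, 0, 7, 0⟩, ⟨-5, 0, 0, 4, 9⟩, ⟨30, 0, 0, 4, 8⟩, ⟨-45, 0, 0, 4, 7⟩, ⟨45, 0, 0, 4, 6⟩,
    ⟨15, 0, 0, 4, 5⟩, ⟨-45, 0, 0, 4, 4⟩, ⟨50, 0, 0, 4, 3⟩, ⟨-15, 0, 0, 4, 2⟩, ⟨-5, 0, 0, 1, 8⟩,
    ⟨-1, 0, 0, 1, 6⟩, ⟨-6, 0, 0, 1, 5⟩]

/-- The integer polynomial `λ₃` in `A, B, C, D`: the coefficient of `t` in the cubic `m_{A,B,C,D}`. -/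
def lam3 {R : Type*} [CommRing R] (A B C D : R) : R := evalTerms lam3Terms A B C D

/-- The integer polynomial `λ₄`: the constant coefficient of the cubic `m_{A,B,C,D}`.
Term by term, it is the negative of `λ₁`. -/
def lam4 {R : Type*} [CommRing R] (A B C D : R) : R := -lam1 A B C D

/-- The cubic `m_{A,B,C,D}(t) = λ₁ t^3 + λ₂ t^2 + λ₃ t + λ₄`. -/
noncomputable def mCubic {F : Type*} [Field F] (A B C D : F) : Polynomial F :=
  Polynomial.C (lam1 A B C D) * Polynomial.X ^ 3 + Polynomial.C (lam2 A B C D) * Polynomial.X ^ 2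
    + Polynomial.C (lam3 A B C D) * Polynomial.X + Polynomial.C (lam4 A B C D)

/-- The set `μ_d` of `d`-th roots of unity in the field `K`. -/
def mu (K : Type*) [Field K] (d : ℕ) : Set K := {x : K | x ^ d = 1}

/-- The polynomial `x^(q^2+q-1) + A x^(q^2-q+1) + B x^(q^2) + C x^q + D x`. -/
noncomputable def pentanomial {F : Type*} [Field F] (q : ℕ) (A B C D : F) : Polynomial F :=
  Polynomial.X ^ (q ^ 2 + q - 1) + Polynomial.C A * Polynomial.X ^ (q ^ 2 - q + 1)
    + Polynomial.C B * Polynomial.X ^ (q ^ 2) + Polynomial.C C * Polynomial.X ^ q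
    + Polynomial.C D * Polynomial.X

/-- `f ∈ F[x]` is a permutation polynomial over the extension `K` of `F`: the associated function
`c ↦ f(c)` from `K` to `K` is a permutation of `K`. -/
def IsPermutationPolynomial {F : Type*} (K : Type*) [Field F] [Field K] [Algebra F K]
    (f : Polynomial F) : Prop :=
  Function.Bijective fun c : K => Polynomial.aeval c f

end PermPentanomial

/-! Since `B ^ 2 = 4 * A` and the characteristic is not 2, one can write `A = b ^ 2` and `B = 2 *
b`. Let `σ` be the Frobenius `x ↦ x ^ q` of the cubic extension. For `x ≠ 0` and `X = x⁻¹`, the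
value `f(x)` is the norm of `x` times `Q(X, σ X, σ² X)`, where `Q(X, Y, Z) = (X + b Y)² + Z (C X + D
Y)` is the ternary quadratic form `quad`. The norm lies in the base field, so the problem concerns
the conic `Q = 0` and its two cyclic shifts.

No zeros: if `Q(X, σ X, σ² X) = 0`, applying `σ` shows that all three shifts vanish at `(X, σ X, σ²
X)`. Eliminating the third coordinate leaves a binary cubic, `redForm`, which vanishes at `(X, σ
X)`. Modulo the relation between the parameters, the large cubic `m` is a constant times this
reduced cubic (`aeval_mCubic`). As `X / σ X` has norm one, the hypothesis on `m` forces `X = 0`.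

Linearization: suppose that the three conics have a common zero `(x, y, z)` over the base field with
nonzero circulant determinant. In the coordinates given by this point and its cyclic shifts, `Q`
loses its square terms, and `Q(X, σ X, σ² X)` becomes an additive function of `Y * σ Y`. That
function is injective because `Q` has no zeros, so values of `Q` that agree up to a scalar of the
base field come from proportional arguments (`IsBasePoint.exists_fixed_smul_eq`). Since `f(d x) = d
f(x)` for `d` in the base field, `f` is injective.

Existence of the point: the extreme coefficients of the reduced cubic are opposite, so if it were
irreducible its roots would have norm one. Hence it has a root in the base field (or degenerates),
and the relation between the parameters lifts that root to a common zero of the conics. The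
determinant is nonzero because of `D ≠ b * C`. -/

namespace PermPentanomial

/-! ### The reduced cubic and its relation to the coefficients of `m` -/

/-- The relation between the parameters, after the substitution `A = b ^ 2`, `B = 2 * b`. -/
def ParamRel {R : Type*} [CommRing R] (b C D : R) : Prop :=
  b ^ 6 - b ^ 4 * C - 2 * b ^ 3 * D + 2 * b ^ 3 + b ^ 2 * C ^ 2 - 2 * b * C + D ^ 2 - D + 1 = 0

/-- The leading coefficient of the reduced cubic. -/
def red1 {R : Type*} [CommRing R] (b C D : R) : R :=
  2 * b ^ 3 - D - b ^ 4 * C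

/-- The quadratic coefficient of the reduced cubic. -/
def red2 {R : Type*} [CommRing R] (b C D : R) : R :=
  C ^ 2 + b ^ 2 * C - 2 * b - 2 * b * D - b ^ 2 * C * D + 4 * b ^ 4 - b ^ 4 * D

/-- The linear coefficient of the reduced cubic. -/
def red3 {R : Type*} [CommRing R] (b C D : R) : R :=
  C + C * D - 4 * b ^ 2 - b ^ 2 * D - b ^ 2 * D ^ 2 + 2 * b ^ 3 * C + 2 * b ^ 5

-- Together with `lam2_eq` and `lam3_eq`, this reduces `m` to a manageable cubic. The three
-- coefficients share the factor `(b ^ 3 + 1 - D - b * C) ^ 10` modulo the parameter relation; the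
-- long polynomial is the explicit quotient by that relation. Since `m` is assumed nonzero at each
-- `t` in question, the reduced cubic is nonzero there without any separate study of this factor.
set_option maxRecDepth 100000 in
set_option maxHeartbeats 4000000 in
theorem lam1_eq {R : Type*} [CommRing R] {b C D : R} (h : ParamRel b C D) :
    lam1 (b ^ 2) (2 * b) C D = (b ^ 3 + 1 - D - b * C) ^ 10 * red1 b C D := by
  simp only [lam1, evalTerms, lam1Terms, List.map_cons, List.map_nil, List.sum_cons,
    List.sum_nil, red1]
  unfold ParamRel at h
  push_cast
  linear_combination
    (b ^ 28 * C - 2 * b ^ 27 - 9 * b ^ 26 * C ^ 2 - 8 * b ^ 25 * C * D + 26 * b ^ 25 * C + 35 *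
      b ^ 24 * C ^ 3 + 17 * b ^ 24 * D - 16 * b ^ 24 + 64 * b ^ 23 * C ^ 2 * D - 132 * b ^ 23 *
      C ^ 2 - 76 * b ^ 22 * C ^ 4 + 28 * b ^ 22 * C * D ^ 2 - 194 * b ^ 22 * C * D + 152 * b ^
      22 * C - 218 * b ^ 21 * C ^ 3 * D + 354 * b ^ 21 * C ^ 3 - 64 * b ^ 21 * D ^ 2 + 122 * b ^
      21 * D - 56 * b ^ 21 + 99 * b ^ 20 * C ^ 5 - 195 * b ^ 20 * C ^ 2 * D ^ 2 + 857 * b ^ 20 *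
      C ^ 2 * D - 587 * b ^ 20 * C ^ 2 + 406 * b ^ 19 * C ^ 4 * D - 552 * b ^ 19 * C ^ 4 - 56 *
      b ^ 19 * C * D ^ 3 + 628 * b ^ 19 * C * D ^ 2 - 1008 * b ^ 19 * C * D + 422 * b ^ 19 * C -
      77 * b ^ 18 * C ^ 6 + 566 * b ^ 18 * C ^ 3 * D ^ 2 - 1962 * b ^ 18 * C ^ 3 * D + 1194 * b
      ^ 18 * C ^ 3 + 140 * b ^ 18 * D ^ 3 - 405 * b ^ 18 * D ^ 2 + 376 * b ^ 18 * D - 112 * b ^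
      18 - 438 * b ^ 17 * C ^ 5 * D + 508 * b ^ 17 * C ^ 5 + 330 * b ^ 17 * C ^ 2 * D ^ 3 - 2352
      * b ^ 17 * C ^ 2 * D ^ 2 + 3318 * b ^ 17 * C ^ 2 * D - 1272 * b ^ 17 * C ^ 2 + 34 * b ^ 16
      * C ^ 7 - 871 * b ^ 16 * C ^ 4 * D ^ 2 + 2523 * b ^ 16 * C ^ 4 * D - 1371 * b ^ 16 * C ^ 4
      + 70 * b ^ 16 * C * D ^ 4 - 1150 * b ^ 16 * C * D ^ 3 + 2841 * b ^ 16 * C * D ^ 2 - 2414 *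
      b ^ 16 * C * D + 670 * b ^ 16 * C + 262 * b ^ 15 * C ^ 6 * D - 268 * b ^ 15 * C ^ 6 - 784
      * b ^ 15 * C ^ 3 * D ^ 3 + 4442 * b ^ 15 * C ^ 3 * D ^ 2 - 5556 * b ^ 15 * C ^ 3 * D +
      1950 * b ^ 15 * C ^ 3 - 196 * b ^ 15 * D ^ 4 + 764 * b ^ 15 * D ^ 3 - 1076 * b ^ 15 * D ^
      2 + 646 * b ^ 15 * D - 140 * b ^ 15 - 9 * b ^ 14 * C ^ 8 + 738 * b ^ 14 * C ^ 5 * D ^ 2 -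
      1784 * b ^ 14 * C ^ 5 * D + 886 * b ^ 14 * C ^ 5 - 335 * b ^ 14 * C ^ 2 * D ^ 4 + 3522 * b
      ^ 14 * C ^ 2 * D ^ 3 - 7719 * b ^ 14 * C ^ 2 * D ^ 2 + 5990 * b ^ 14 * C ^ 2 * D - 1543 *
      b ^ 14 * C ^ 2 - 72 * b ^ 13 * C ^ 7 * D + 82 * b ^ 13 * C ^ 7 + 938 * b ^ 13 * C ^ 4 * D
      ^ 3 - 4488 * b ^ 13 * C ^ 4 * D ^ 2 + 4916 * b ^ 13 * C ^ 4 * D - 1596 * b ^ 13 * C ^ 4 -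
      56 * b ^ 13 * C * D ^ 5 + 1300 * b ^ 13 * C * D ^ 4 - 4402 * b ^ 13 * C * D ^ 3 + 5706 * b
      ^ 13 * C * D ^ 2 - 3184 * b ^ 13 * C * D + 646 * b ^ 13 * C + 2 * b ^ 12 * C ^ 9 - 310 * b
      ^ 12 * C ^ 6 * D ^ 2 + 610 * b ^ 12 * C ^ 6 * D - 314 * b ^ 12 * C ^ 6 + 611 * b ^ 12 * C
      ^ 3 * D ^ 4 - 5208 * b ^ 12 * C ^ 3 * D ^ 3 + 10158 * b ^ 12 * C ^ 3 * D ^ 2 - 7112 * b ^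
      12 * C ^ 3 * D + 1699 * b ^ 12 * C ^ 3 + 182 * b ^ 12 * D ^ 5 - 895 * b ^ 12 * D ^ 4 +
      1699 * b ^ 12 * D ^ 3 - 1543 * b ^ 12 * D ^ 2 + 670 * b ^ 12 * D - 112 * b ^ 12 + 8 * b ^
      11 * C ^ 8 * D - 14 * b ^ 11 * C ^ 8 - 564 * b ^ 11 * C ^ 5 * D ^ 3 + 2238 * b ^ 11 * C ^
      5 * D ^ 2 - 2136 * b ^ 11 * C ^ 5 * D + 672 * b ^ 11 * C ^ 5 + 204 * b ^ 11 * C ^ 2 * D ^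
      5 - 3088 * b ^ 11 * C ^ 2 * D ^ 4 + 9412 * b ^ 11 * C ^ 2 * D ^ 3 - 11136 * b ^ 11 * C ^ 2
      * D ^ 2 + 5706 * b ^ 11 * C ^ 2 * D - 1076 * b ^ 11 * C ^ 2 + b ^ 10 * C ^ 10 + 34 * b ^
      10 * C ^ 7 * D ^ 2 - 100 * b ^ 10 * C ^ 7 * D + 46 * b ^ 10 * C ^ 7 - 507 * b ^ 10 * C ^ 4
      * D ^ 4 + 3806 * b ^ 10 * C ^ 4 * D ^ 3 - 6366 * b ^ 10 * C ^ 4 * D ^ 2 + 4018 * b ^ 10 *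
      C ^ 4 * D - 895 * b ^ 10 * C ^ 4 + 28 * b ^ 10 * C * D ^ 6 - 926 * b ^ 10 * C * D ^ 5 +
      4038 * b ^ 10 * C * D ^ 4 - 7112 * b ^ 10 * C * D ^ 3 + 5990 * b ^ 10 * C * D ^ 2 - 2414 *
      b ^ 10 * C * D + 376 * b ^ 10 * C - 6 * b ^ 9 * C ^ 9 * D - 8 * b ^ 9 * C ^ 9 + 136 * b ^
      9 * C ^ 6 * D ^ 3 - 348 * b ^ 9 * C ^ 6 * D ^ 2 + 442 * b ^ 9 * C ^ 6 * D - 104 * b ^ 9 *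
      C ^ 6 - 254 * b ^ 9 * C ^ 3 * D ^ 5 + 3278 * b ^ 9 * C ^ 3 * D ^ 4 - 9028 * b ^ 9 * C ^ 3
      * D ^ 3 + 9432 * b ^ 9 * C ^ 3 * D ^ 2 - 4402 * b ^ 9 * C ^ 3 * D + 764 * b ^ 9 * C ^ 3 -
      112 * b ^ 9 * D ^ 6 + 666 * b ^ 9 * D ^ 5 - 1596 * b ^ 9 * D ^ 4 + 1950 * b ^ 9 * D ^ 3 -
      1272 * b ^ 9 * D ^ 2 + 422 * b ^ 9 * D - 56 * b ^ 9 + 9 * b ^ 8 * C ^ 8 * D ^ 2 + 38 * b ^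
      8 * C ^ 8 * D + 21 * b ^ 8 * C ^ 8 + 166 * b ^ 8 * C ^ 5 * D ^ 4 - 1144 * b ^ 8 * C ^ 5 *
      D ^ 3 + 1404 * b ^ 8 * C ^ 5 * D ^ 2 - 992 * b ^ 8 * C ^ 5 * D + 174 * b ^ 8 * C ^ 5 - 69
      * b ^ 8 * C ^ 2 * D ^ 6 + 1569 * b ^ 8 * C ^ 2 * D ^ 5 - 6291 * b ^ 8 * C ^ 2 * D ^ 4 +
      10158 * b ^ 8 * C ^ 2 * D ^ 3 - 7719 * b ^ 8 * C ^ 2 * D ^ 2 + 2841 * b ^ 8 * C ^ 2 * D -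
      405 * b ^ 8 * C ^ 2 - 2 * b ^ 7 * C ^ 10 * D - 4 * b ^ 7 * C ^ 10 - 28 * b ^ 7 * C ^ 7 * D
      ^ 2 - 76 * b ^ 7 * C ^ 7 * D - 18 * b ^ 7 * C ^ 7 + 110 * b ^ 7 * C ^ 4 * D ^ 5 - 1460 * b
      ^ 7 * C ^ 4 * D ^ 4 + 3458 * b ^ 7 * C ^ 4 * D ^ 3 - 2948 * b ^ 7 * C ^ 4 * D ^ 2 + 1330 *
      b ^ 7 * C ^ 4 * D - 196 * b ^ 7 * C ^ 4 - 8 * b ^ 7 * C * D ^ 7 + 404 * b ^ 7 * C * D ^ 6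
      - 2184 * b ^ 7 * C * D ^ 5 + 4906 * b ^ 7 * C * D ^ 4 - 5556 * b ^ 7 * C * D ^ 3 + 3318 *
      b ^ 7 * C * D ^ 2 - 1008 * b ^ 7 * C * D + 122 * b ^ 7 * C - b ^ 6 * C ^ 12 + 6 * b ^ 6 *
      C ^ 9 * D ^ 2 + 32 * b ^ 6 * C ^ 9 * D + 26 * b ^ 6 * C ^ 9 - 5 * b ^ 6 * C ^ 6 * D ^ 4 +
      14 * b ^ 6 * C ^ 6 * D ^ 3 - 60 * b ^ 6 * C ^ 6 * D ^ 2 + 42 * b ^ 6 * C ^ 6 * D - 5 * b ^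
      6 * C ^ 6 + 44 * b ^ 6 * C ^ 3 * D ^ 6 - 1014 * b ^ 6 * C ^ 3 * D ^ 5 + 3806 * b ^ 6 * C ^
      3 * D ^ 4 - 5308 * b ^ 6 * C ^ 3 * D ^ 3 + 3482 * b ^ 6 * C ^ 3 * D ^ 2 - 1150 * b ^ 6 * C
      ^ 3 * D + 140 * b ^ 6 * C ^ 3 + 44 * b ^ 6 * D ^ 7 - 307 * b ^ 6 * D ^ 6 + 890 * b ^ 6 * D
      ^ 5 - 1371 * b ^ 6 * D ^ 4 + 1194 * b ^ 6 * D ^ 3 - 587 * b ^ 6 * D ^ 2 + 152 * b ^ 6 * D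
      - 16 * b ^ 6 + 4 * b ^ 5 * C ^ 11 * D + 6 * b ^ 5 * C ^ 11 - 6 * b ^ 5 * C ^ 8 * D ^ 3 -
      72 * b ^ 5 * C ^ 8 * D ^ 2 - 144 * b ^ 5 * C ^ 8 * D - 60 * b ^ 5 * C ^ 8 + 166 * b ^ 5 *
      C ^ 5 * D ^ 4 - 108 * b ^ 5 * C ^ 5 * D ^ 3 + 330 * b ^ 5 * C ^ 5 * D ^ 2 + 8 * b ^ 5 * C
      ^ 5 * D + 10 * b ^ 5 * C ^ 5 + 10 * b ^ 5 * C ^ 2 * D ^ 7 - 420 * b ^ 5 * C ^ 2 * D ^ 6 +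
      2154 * b ^ 5 * C ^ 2 * D ^ 5 - 4488 * b ^ 5 * C ^ 2 * D ^ 4 + 4462 * b ^ 5 * C ^ 2 * D ^ 3
      - 2352 * b ^ 5 * C ^ 2 * D ^ 2 + 628 * b ^ 5 * C ^ 2 * D - 64 * b ^ 5 * C ^ 2 - b ^ 4 * C
      ^ 13 - 8 * b ^ 4 * C ^ 10 * D ^ 2 - 20 * b ^ 4 * C ^ 10 * D - 4 * b ^ 4 * C ^ 10 + 5 * b ^
      4 * C ^ 7 * D ^ 4 + 68 * b ^ 4 * C ^ 7 * D ^ 3 + 264 * b ^ 4 * C ^ 7 * D ^ 2 + 260 * b ^ 4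
      * C ^ 7 * D + 53 * b ^ 4 * C ^ 7 + 166 * b ^ 4 * C ^ 4 * D ^ 5 - 632 * b ^ 4 * C ^ 4 * D ^
      4 + 376 * b ^ 4 * C ^ 4 * D ^ 3 - 500 * b ^ 4 * C ^ 4 * D ^ 2 + 30 * b ^ 4 * C ^ 4 * D + b
      ^ 4 * C * D ^ 8 - 98 * b ^ 4 * C * D ^ 7 + 641 * b ^ 4 * C * D ^ 6 - 1762 * b ^ 4 * C * D
      ^ 5 + 2523 * b ^ 4 * C * D ^ 4 - 1962 * b ^ 4 * C * D ^ 3 + 857 * b ^ 4 * C * D ^ 2 - 194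
      * b ^ 4 * C * D + 17 * b ^ 4 * C + 4 * b ^ 3 * C ^ 12 * D + 12 * b ^ 3 * C ^ 12 + 12 * b ^
      3 * C ^ 9 * D ^ 3 + 38 * b ^ 3 * C ^ 9 * D ^ 2 - 16 * b ^ 3 * C ^ 9 * D - 44 * b ^ 3 * C ^
      9 - 4 * b ^ 3 * C ^ 6 * D ^ 5 - 40 * b ^ 3 * C ^ 6 * D ^ 4 - 176 * b ^ 3 * C ^ 6 * D ^ 3 -
      312 * b ^ 3 * C ^ 6 * D ^ 2 - 70 * b ^ 3 * C ^ 6 * D - 68 * b ^ 3 * C ^ 6 + 110 * b ^ 3 *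
      C ^ 3 * D ^ 6 - 564 * b ^ 3 * C ^ 3 * D ^ 5 + 1058 * b ^ 3 * C ^ 3 * D ^ 4 - 624 * b ^ 3 *
      C ^ 3 * D ^ 3 + 390 * b ^ 3 * C ^ 3 * D ^ 2 - 56 * b ^ 3 * C ^ 3 * D - 10 * b ^ 3 * D ^ 8
      + 80 * b ^ 3 * D ^ 7 - 272 * b ^ 3 * D ^ 6 + 506 * b ^ 3 * D ^ 5 - 552 * b ^ 3 * D ^ 4 +
      354 * b ^ 3 * D ^ 3 - 132 * b ^ 3 * D ^ 2 + 26 * b ^ 3 * D - 2 * b ^ 3 - 6 * b ^ 2 * C ^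
      11 * D ^ 2 - 52 * b ^ 2 * C ^ 11 * D - 50 * b ^ 2 * C ^ 11 - 11 * b ^ 2 * C ^ 8 * D ^ 4 -
      62 * b ^ 2 * C ^ 8 * D ^ 3 + 90 * b ^ 2 * C ^ 8 * D ^ 2 + 134 * b ^ 2 * C ^ 8 * D - 55 * b
      ^ 2 * C ^ 8 + 18 * b ^ 2 * C ^ 5 * D ^ 5 + 90 * b ^ 2 * C ^ 5 * D ^ 4 + 120 * b ^ 2 * C ^
      5 * D ^ 3 - 54 * b ^ 2 * C ^ 5 * D ^ 2 + 162 * b ^ 2 * C ^ 5 * D - 12 * b ^ 2 * C ^ 5 + 44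
      * b ^ 2 * C ^ 2 * D ^ 7 - 287 * b ^ 2 * C ^ 2 * D ^ 6 + 738 * b ^ 2 * C ^ 2 * D ^ 5 - 926
      * b ^ 2 * C ^ 2 * D ^ 4 + 526 * b ^ 2 * C ^ 2 * D ^ 3 - 195 * b ^ 2 * C ^ 2 * D ^ 2 + 28 *
      b ^ 2 * C ^ 2 * D - 2 * b * C ^ 13 * D + 6 * b * C ^ 13 + 4 * b * C ^ 10 * D ^ 3 + 52 * b
      * C ^ 10 * D ^ 2 + 6 * b * C ^ 10 * D + 32 * b * C ^ 10 + 6 * b * C ^ 7 * D ^ 5 + 34 * b *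
      C ^ 7 * D ^ 4 - 72 * b * C ^ 7 * D ^ 3 - 48 * b * C ^ 7 * D ^ 2 - 22 * b * C ^ 7 * D + 24
      * b * C ^ 7 - 30 * b * C ^ 4 * D ^ 5 - 60 * b * C ^ 4 * D ^ 4 + 130 * b * C ^ 4 * D ^ 3 -
      120 * b * C ^ 4 * D ^ 2 + 10 * b * C ^ 4 * D + 10 * b * C * D ^ 8 - 78 * b * C * D ^ 7 +
      254 * b * C * D ^ 6 - 438 * b * C * D ^ 5 + 416 * b * C * D ^ 4 - 218 * b * C * D ^ 3 + 64
      * b * C * D ^ 2 - 8 * b * C * D + C ^ 15 + 3 * C ^ 12 * D ^ 2 - 9 * C ^ 12 * D + 3 * C ^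
      12 + 2 * C ^ 9 * D ^ 4 - 28 * C ^ 9 * D ^ 3 + 30 * C ^ 9 * D ^ 2 - 28 * C ^ 9 * D + 2 * C
      ^ 9 + C ^ 6 * D ^ 6 - 21 * C ^ 6 * D ^ 5 + 57 * C ^ 6 * D ^ 4 - 56 * C ^ 6 * D ^ 3 + 57 *
      C ^ 6 * D ^ 2 - 21 * C ^ 6 * D + C ^ 6 + 20 * C ^ 3 * D ^ 5 - 35 * C ^ 3 * D ^ 4 + 20 * C
      ^ 3 * D ^ 3 + D ^ 9 - 9 * D ^ 8 + 35 * D ^ 7 - 76 * D ^ 6 + 99 * D ^ 5 - 76 * D ^ 4 + 35 *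
      D ^ 3 - 9 * D ^ 2 + D) * h

set_option maxRecDepth 100000 in
set_option maxHeartbeats 4000000 in
theorem lam2_eq {R : Type*} [CommRing R] {b C D : R} (h : ParamRel b C D) :
    lam2 (b ^ 2) (2 * b) C D = (b ^ 3 + 1 - D - b * C) ^ 10 * red2 b C D := by
  simp only [lam2, evalTerms, lam2Terms, List.map_cons, List.map_nil, List.sum_cons,
    List.sum_nil, red2]
  unfold ParamRel at h
  push_cast
  linear_combination
    (b ^ 28 * D - 4 * b ^ 28 - 8 * b ^ 26 * C * D + 35 * b ^ 26 * C - 8 * b ^ 25 * D ^ 2 + 42 *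
      b ^ 25 * D - 30 * b ^ 25 + 26 * b ^ 24 * C ^ 2 * D - 132 * b ^ 24 * C ^ 2 + 56 * b ^ 23 *
      C * D ^ 2 - 320 * b ^ 23 * C * D + 222 * b ^ 23 * C - 41 * b ^ 22 * C ^ 3 * D + 278 * b ^
      22 * C ^ 3 + 28 * b ^ 22 * D ^ 3 - 185 * b ^ 22 * D ^ 2 + 256 * b ^ 22 * D - 96 * b ^ 22 -
      154 * b ^ 21 * C ^ 2 * D ^ 2 + 1026 * b ^ 21 * C ^ 2 * D - 684 * b ^ 21 * C ^ 2 + 23 * b ^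
      20 * C ^ 4 * D - 355 * b ^ 20 * C ^ 4 - 167 * b ^ 20 * C * D ^ 3 + 1209 * b ^ 20 * C * D ^
      2 - 1638 * b ^ 20 * C * D + 580 * b ^ 20 * C + 188 * b ^ 19 * C ^ 3 * D ^ 2 - 1774 * b ^
      19 * C ^ 3 * D + 1124 * b ^ 19 * C ^ 3 - 56 * b ^ 19 * D ^ 4 + 454 * b ^ 19 * D ^ 3 - 928
      * b ^ 19 * D ^ 2 + 694 * b ^ 19 * D - 168 * b ^ 19 + 22 * b ^ 18 * C ^ 5 * D + 285 * b ^
      18 * C ^ 5 + 371 * b ^ 18 * C ^ 2 * D ^ 3 - 3221 * b ^ 18 * C ^ 2 * D ^ 2 + 4238 * b ^ 18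
      * C ^ 2 * D - 1385 * b ^ 18 * C ^ 2 - 32 * b ^ 17 * C ^ 4 * D ^ 2 + 1762 * b ^ 17 * C ^ 4
      * D - 1066 * b ^ 17 * C ^ 4 + 274 * b ^ 17 * C * D ^ 4 - 2482 * b ^ 17 * C * D ^ 3 + 5010
      * b ^ 17 * C * D ^ 2 - 3536 * b ^ 17 * C * D + 778 * b ^ 17 * C - 43 * b ^ 16 * C ^ 6 * D
      - 158 * b ^ 16 * C ^ 6 - 305 * b ^ 16 * C ^ 3 * D ^ 3 + 4399 * b ^ 16 * C ^ 3 * D ^ 2 -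
      5577 * b ^ 16 * C ^ 3 * D + 1641 * b ^ 16 * C ^ 3 + 70 * b ^ 16 * D ^ 5 - 687 * b ^ 16 * D
      ^ 4 + 1867 * b ^ 16 * D ^ 3 - 2099 * b ^ 16 * D ^ 2 + 1014 * b ^ 16 * D - 168 * b ^ 16 -
      176 * b ^ 15 * C ^ 5 * D ^ 2 - 1016 * b ^ 15 * C ^ 5 * D + 646 * b ^ 15 * C ^ 5 - 454 * b
      ^ 15 * C ^ 2 * D ^ 4 + 5286 * b ^ 15 * C ^ 2 * D ^ 3 - 10502 * b ^ 15 * C ^ 2 * D ^ 2 +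
      6778 * b ^ 15 * C ^ 2 * D - 1280 * b ^ 15 * C ^ 2 + 25 * b ^ 14 * C ^ 7 * D + 79 * b ^ 14
      * C ^ 7 - 133 * b ^ 14 * C ^ 4 * D ^ 3 - 3158 * b ^ 14 * C ^ 4 * D ^ 2 + 3913 * b ^ 14 * C
      ^ 4 * D - 1059 * b ^ 14 * C ^ 4 - 265 * b ^ 14 * C * D ^ 5 + 3023 * b ^ 14 * C * D ^ 4 -
      8207 * b ^ 14 * C * D ^ 3 + 8706 * b ^ 14 * C * D ^ 2 - 3762 * b ^ 14 * C * D + 510 * b ^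
      14 * C + 190 * b ^ 13 * C ^ 6 * D ^ 2 + 396 * b ^ 13 * C ^ 6 * D - 342 * b ^ 13 * C ^ 6 +
      154 * b ^ 13 * C ^ 3 * D ^ 4 - 5320 * b ^ 13 * C ^ 3 * D ^ 3 + 10448 * b ^ 13 * C ^ 3 * D
      ^ 2 - 5876 * b ^ 13 * C ^ 3 * D + 846 * b ^ 13 * C ^ 3 - 56 * b ^ 13 * D ^ 6 + 664 * b ^
      13 * D ^ 5 - 2274 * b ^ 13 * D ^ 4 + 3432 * b ^ 13 * D ^ 3 - 2484 * b ^ 13 * D ^ 2 + 806 *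
      b ^ 13 * D - 84 * b ^ 13 - 7 * b ^ 12 * C ^ 8 * D - 33 * b ^ 12 * C ^ 8 + 428 * b ^ 12 * C
      ^ 5 * D ^ 3 + 1146 * b ^ 12 * C ^ 5 * D ^ 2 - 1669 * b ^ 12 * C ^ 5 * D + 521 * b ^ 12 * C
      ^ 5 + 276 * b ^ 12 * C ^ 2 * D ^ 5 - 4820 * b ^ 12 * C ^ 2 * D ^ 4 + 13176 * b ^ 12 * C ^
      2 * D ^ 3 - 12631 * b ^ 12 * C ^ 2 * D ^ 2 + 4423 * b ^ 12 * C ^ 2 * D - 331 * b ^ 12 * C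
      ^ 2 - 64 * b ^ 11 * C ^ 7 * D ^ 2 - 186 * b ^ 11 * C ^ 7 * D + 158 * b ^ 11 * C ^ 7 + 374
      * b ^ 11 * C ^ 4 * D ^ 4 + 2360 * b ^ 11 * C ^ 4 * D ^ 3 - 4910 * b ^ 11 * C ^ 4 * D ^ 2 +
      2480 * b ^ 11 * C ^ 4 * D - 228 * b ^ 11 * C ^ 4 + 148 * b ^ 11 * C * D ^ 6 - 2212 * b ^
      11 * C * D ^ 5 + 7706 * b ^ 11 * C * D ^ 4 - 10980 * b ^ 11 * C * D ^ 3 + 6938 * b ^ 11 *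
      C * D ^ 2 - 1696 * b ^ 11 * C * D + 50 * b ^ 11 * C + 3 * b ^ 10 * C ^ 9 * D + 3 * b ^ 10
      * C ^ 9 - 276 * b ^ 10 * C ^ 6 * D ^ 3 - 351 * b ^ 10 * C ^ 6 * D ^ 2 + 875 * b ^ 10 * C ^
      6 * D - 276 * b ^ 10 * C ^ 6 + 104 * b ^ 10 * C ^ 3 * D ^ 5 + 3107 * b ^ 10 * C ^ 3 * D ^
      4 - 8968 * b ^ 10 * C ^ 3 * D ^ 3 + 7054 * b ^ 10 * C ^ 3 * D ^ 2 - 1487 * b ^ 10 * C ^ 3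
      * D - 224 * b ^ 10 * C ^ 3 + 28 * b ^ 10 * D ^ 7 - 407 * b ^ 10 * D ^ 6 + 1706 * b ^ 10 *
      D ^ 5 - 3255 * b ^ 10 * D ^ 4 + 3138 * b ^ 10 * D ^ 3 - 1479 * b ^ 10 * D ^ 2 + 272 * b ^
      10 * D + 2 * b ^ 9 * C ^ 8 * D ^ 2 + 76 * b ^ 9 * C ^ 8 * D - 26 * b ^ 9 * C ^ 8 - 428 * b
      ^ 9 * C ^ 5 * D ^ 4 - 390 * b ^ 9 * C ^ 5 * D ^ 3 + 1450 * b ^ 9 * C ^ 5 * D ^ 2 - 1296 *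
      b ^ 9 * C ^ 5 * D + 160 * b ^ 9 * C ^ 5 - 50 * b ^ 9 * C ^ 2 * D ^ 6 + 2334 * b ^ 9 * C ^
      2 * D ^ 5 - 8600 * b ^ 9 * C ^ 2 * D ^ 4 + 10914 * b ^ 9 * C ^ 2 * D ^ 3 - 4918 * b ^ 9 *
      C ^ 2 * D ^ 2 + 128 * b ^ 9 * C ^ 2 * D + 324 * b ^ 9 * C ^ 2 + b ^ 8 * C ^ 10 * D - 3 * b
      ^ 8 * C ^ 10 + 43 * b ^ 8 * C ^ 7 * D ^ 3 + 205 * b ^ 8 * C ^ 7 * D ^ 2 - 422 * b ^ 8 * C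
      ^ 7 * D + 104 * b ^ 8 * C ^ 7 - 341 * b ^ 8 * C ^ 4 * D ^ 5 - 518 * b ^ 8 * C ^ 4 * D ^ 4
      + 2438 * b ^ 8 * C ^ 4 * D ^ 3 - 1609 * b ^ 8 * C ^ 4 * D ^ 2 + 300 * b ^ 8 * C ^ 4 * D +
      164 * b ^ 8 * C ^ 4 - 41 * b ^ 8 * C * D ^ 7 + 923 * b ^ 8 * C * D ^ 6 - 4065 * b ^ 8 * C
      * D ^ 5 + 7339 * b ^ 8 * C * D ^ 4 - 5937 * b ^ 8 * C * D ^ 3 + 1737 * b ^ 8 * C * D ^ 2 +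
      198 * b ^ 8 * C * D - 148 * b ^ 8 * C - 8 * b ^ 7 * C ^ 9 * D ^ 2 - 2 * b ^ 7 * C ^ 9 * D
      + 34 * b ^ 7 * C ^ 9 + 136 * b ^ 7 * C ^ 6 * D ^ 4 + 270 * b ^ 7 * C ^ 6 * D ^ 3 - 948 * b
      ^ 7 * C ^ 6 * D ^ 2 + 766 * b ^ 7 * C ^ 6 * D - 196 * b ^ 7 * C ^ 6 - 144 * b ^ 7 * C ^ 3
      * D ^ 6 - 642 * b ^ 7 * C ^ 3 * D ^ 5 + 3282 * b ^ 7 * C ^ 3 * D ^ 4 - 3066 * b ^ 7 * C ^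
      3 * D ^ 3 + 30 * b ^ 7 * C ^ 3 * D ^ 2 + 1018 * b ^ 7 * C ^ 3 * D - 366 * b ^ 7 * C ^ 3 -
      8 * b ^ 7 * D ^ 8 + 150 * b ^ 7 * D ^ 7 - 760 * b ^ 7 * D ^ 6 + 1768 * b ^ 7 * D ^ 5 -
      2124 * b ^ 7 * D ^ 4 + 1264 * b ^ 7 * D ^ 3 - 264 * b ^ 7 * D ^ 2 - 54 * b ^ 7 * D + 24 *
      b ^ 7 - b ^ 6 * C ^ 11 * D + 3 * b ^ 6 * C ^ 11 + 15 * b ^ 6 * C ^ 8 * D ^ 3 - 28 * b ^ 6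
      * C ^ 8 * D ^ 2 - 54 * b ^ 6 * C ^ 8 * D - 119 * b ^ 6 * C ^ 8 + 161 * b ^ 6 * C ^ 5 * D ^
      5 + 51 * b ^ 6 * C ^ 5 * D ^ 4 - 907 * b ^ 6 * C ^ 5 * D ^ 3 + 1669 * b ^ 6 * C ^ 5 * D ^
      2 - 541 * b ^ 6 * C ^ 5 * D + 141 * b ^ 6 * C ^ 5 - 25 * b ^ 6 * C ^ 2 * D ^ 7 - 480 * b ^
      6 * C ^ 2 * D ^ 6 + 2585 * b ^ 6 * C ^ 2 * D ^ 5 - 4089 * b ^ 6 * C ^ 2 * D ^ 4 + 1571 * b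
      ^ 6 * C ^ 2 * D ^ 3 + 1099 * b ^ 6 * C ^ 2 * D ^ 2 - 1108 * b ^ 6 * C ^ 2 * D + 265 * b ^
      6 * C ^ 2 + 2 * b ^ 5 * C ^ 10 * D ^ 2 - 8 * b ^ 5 * C ^ 10 * D - 6 * b ^ 5 * C ^ 10 - 6 *
      b ^ 5 * C ^ 7 * D ^ 4 - 166 * b ^ 5 * C ^ 7 * D ^ 3 + 406 * b ^ 5 * C ^ 7 * D ^ 2 + 168 *
      b ^ 5 * C ^ 7 * D + 166 * b ^ 5 * C ^ 7 + 110 * b ^ 5 * C ^ 4 * D ^ 6 - 68 * b ^ 5 * C ^ 4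
      * D ^ 5 - 596 * b ^ 5 * C ^ 4 * D ^ 4 + 640 * b ^ 5 * C ^ 4 * D ^ 3 - 1008 * b ^ 5 * C ^ 4
      * D ^ 2 - 24 * b ^ 5 * C ^ 4 * D + 22 * b ^ 5 * C ^ 4 + 2 * b ^ 5 * C * D ^ 8 - 186 * b ^
      5 * C * D ^ 7 + 1064 * b ^ 5 * C * D ^ 6 - 2354 * b ^ 5 * C * D ^ 5 + 2190 * b ^ 5 * C * D
      ^ 4 - 338 * b ^ 5 * C * D ^ 3 - 704 * b ^ 5 * C * D ^ 2 + 464 * b ^ 5 * C * D - 90 * b ^ 5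
      * C - 2 * b ^ 4 * C ^ 12 * D + 5 * b ^ 4 * C ^ 12 - 2 * b ^ 4 * C ^ 9 * D ^ 3 + 28 * b ^ 4
      * C ^ 9 * D ^ 2 + 7 * b ^ 4 * C ^ 9 * D - 51 * b ^ 4 * C ^ 9 - 154 * b ^ 4 * C ^ 6 * D ^ 4
      + 533 * b ^ 4 * C ^ 6 * D ^ 3 - 944 * b ^ 4 * C ^ 6 * D ^ 2 + 194 * b ^ 4 * C ^ 6 * D -
      149 * b ^ 4 * C ^ 6 + 44 * b ^ 4 * C ^ 3 * D ^ 7 - 42 * b ^ 4 * C ^ 3 * D ^ 6 - 363 * b ^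
      4 * C ^ 3 * D ^ 5 + 447 * b ^ 4 * C ^ 3 * D ^ 4 + 537 * b ^ 4 * C ^ 3 * D ^ 3 - 435 * b ^
      4 * C ^ 3 * D ^ 2 + 385 * b ^ 4 * C ^ 3 * D - 83 * b ^ 4 * C ^ 3 + b ^ 4 * D ^ 9 - 29 * b
      ^ 4 * D ^ 8 + 179 * b ^ 4 * D ^ 7 - 496 * b ^ 4 * D ^ 6 + 707 * b ^ 4 * D ^ 5 - 472 * b ^
      4 * D ^ 4 + 35 * b ^ 4 * D ^ 3 + 131 * b ^ 4 * D ^ 2 - 71 * b ^ 4 * D + 12 * b ^ 4 + 8 * b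
      ^ 3 * C ^ 11 * D ^ 2 - 6 * b ^ 3 * C ^ 11 * D - 42 * b ^ 3 * C ^ 11 + 6 * b ^ 3 * C ^ 8 *
      D ^ 4 - 60 * b ^ 3 * C ^ 8 * D ^ 3 - 14 * b ^ 3 * C ^ 8 * D ^ 2 + 244 * b ^ 3 * C ^ 8 * D
      - 20 * b ^ 3 * C ^ 8 - 4 * b ^ 3 * C ^ 5 * D ^ 6 - 114 * b ^ 3 * C ^ 5 * D ^ 5 + 610 * b ^
      3 * C ^ 5 * D ^ 4 - 930 * b ^ 3 * C ^ 5 * D ^ 3 + 666 * b ^ 3 * C ^ 5 * D ^ 2 - 170 * b ^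
      3 * C ^ 5 * D + 54 * b ^ 3 * C ^ 5 + 10 * b ^ 3 * C ^ 2 * D ^ 8 + 8 * b ^ 3 * C ^ 2 * D ^
      7 - 216 * b ^ 3 * C ^ 2 * D ^ 6 + 432 * b ^ 3 * C ^ 2 * D ^ 5 + 144 * b ^ 3 * C ^ 2 * D ^
      4 - 980 * b ^ 3 * C ^ 2 * D ^ 3 + 822 * b ^ 3 * C ^ 2 * D ^ 2 - 344 * b ^ 3 * C ^ 2 * D +
      56 * b ^ 3 * C ^ 2 - b ^ 2 * C ^ 13 * D + 2 * b ^ 2 * C ^ 13 - 14 * b ^ 2 * C ^ 10 * D ^ 3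
      - 37 * b ^ 2 * C ^ 10 * D ^ 2 - 13 * b ^ 2 * C ^ 10 * D - 6 * b ^ 2 * C ^ 10 - 6 * b ^ 2 *
      C ^ 7 * D ^ 5 - 13 * b ^ 2 * C ^ 7 * D ^ 4 + 128 * b ^ 2 * C ^ 7 * D ^ 3 - 144 * b ^ 2 * C
      ^ 7 * D ^ 2 - 65 * b ^ 2 * C ^ 7 * D - 20 * b ^ 2 * C ^ 7 - 29 * b ^ 2 * C ^ 4 * D ^ 6 +
      287 * b ^ 2 * C ^ 4 * D ^ 5 - 843 * b ^ 2 * C ^ 4 * D ^ 4 + 1101 * b ^ 2 * C ^ 4 * D ^ 3 -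
      601 * b ^ 2 * C ^ 4 * D ^ 2 + 175 * b ^ 2 * C ^ 4 * D - 28 * b ^ 2 * C ^ 4 + b ^ 2 * C * D
      ^ 9 + 10 * b ^ 2 * C * D ^ 8 - 92 * b ^ 2 * C * D ^ 7 + 241 * b ^ 2 * C * D ^ 6 - 198 * b
      ^ 2 * C * D ^ 5 - 219 * b ^ 2 * C * D ^ 4 + 487 * b ^ 2 * C * D ^ 3 - 352 * b ^ 2 * C * D
      ^ 2 + 122 * b ^ 2 * C * D - 17 * b ^ 2 * C + 2 * b * C ^ 12 * D ^ 2 + 6 * b * C ^ 12 * D -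
      16 * b * C ^ 12 + 16 * b * C ^ 9 * D ^ 4 + 30 * b * C ^ 9 * D ^ 3 - 18 * b * C ^ 9 * D ^ 2
      + 104 * b * C ^ 9 * D - 28 * b * C ^ 9 + 10 * b * C ^ 6 * D ^ 6 - 6 * b * C ^ 6 * D ^ 5 -
      40 * b * C ^ 6 * D ^ 4 + 46 * b * C ^ 6 * D ^ 3 - 94 * b * C ^ 6 * D ^ 2 + 108 * b * C ^ 6
      * D - 12 * b * C ^ 6 - 10 * b * C ^ 3 * D ^ 7 + 58 * b * C ^ 3 * D ^ 6 - 234 * b * C ^ 3 *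
      D ^ 5 + 458 * b * C ^ 3 * D ^ 4 - 486 * b * C ^ 3 * D ^ 3 + 238 * b * C ^ 3 * D ^ 2 - 64 *
      b * C ^ 3 * D + 8 * b * C ^ 3 + 2 * b * D ^ 9 - 16 * b * D ^ 8 + 52 * b * D ^ 7 - 82 * b *
      D ^ 6 + 46 * b * D ^ 5 + 46 * b * D ^ 4 - 82 * b * D ^ 3 + 52 * b * D ^ 2 - 16 * b * D + 2
      * b + C ^ 14 * D + C ^ 14 + C ^ 11 * D ^ 3 - 5 * C ^ 11 * D ^ 2 + 6 * C ^ 11 - C ^ 8 * D ^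
      5 - 22 * C ^ 8 * D ^ 4 + 30 * C ^ 8 * D ^ 3 - 35 * C ^ 8 * D ^ 2 - 8 * C ^ 8 * D + 6 * C ^
      8 + C ^ 5 * D ^ 7 - 23 * C ^ 5 * D ^ 6 + 81 * C ^ 5 * D ^ 5 - 127 * C ^ 5 * D ^ 4 + 131 *
      C ^ 5 * D ^ 3 - 63 * C ^ 5 * D ^ 2 + 6 * C ^ 5 * D - C ^ 2 * D ^ 8 + 9 * C ^ 2 * D ^ 7 -
      25 * C ^ 2 * D ^ 6 + 56 * C ^ 2 * D ^ 5 - 84 * C ^ 2 * D ^ 4 + 76 * C ^ 2 * D ^ 3 - 35 * C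
      ^ 2 * D ^ 2 + 9 * C ^ 2 * D - C ^ 2) * h

set_option maxRecDepth 100000 in
set_option maxHeartbeats 4000000 in
theorem lam3_eq {R : Type*} [CommRing R] {b C D : R} (h : ParamRel b C D) :
    lam3 (b ^ 2) (2 * b) C D = (b ^ 3 + 1 - D - b * C) ^ 10 * red3 b C D := by
  simp only [lam3, evalTerms, lam3Terms, List.map_cons, List.map_nil, List.sum_cons,
    List.sum_nil, red3]
  unfold ParamRel at h
  push_cast
  linear_combination
    (-2 * b ^ 29 + 16 * b ^ 27 * C + b ^ 26 * D ^ 2 + 17 * b ^ 26 * D - 12 * b ^ 26 - 52 * b ^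
      25 * C ^ 2 - 9 * b ^ 24 * C * D ^ 2 - 122 * b ^ 24 * C * D + 71 * b ^ 24 * C + 82 * b ^ 23
      * C ^ 3 - 8 * b ^ 23 * D ^ 3 - 56 * b ^ 23 * D ^ 2 + 90 * b ^ 23 * D - 24 * b ^ 23 + 35 *
      b ^ 22 * C ^ 2 * D ^ 2 + 352 * b ^ 22 * C ^ 2 * D - 131 * b ^ 22 * C ^ 2 - 46 * b ^ 21 * C
      ^ 4 + 64 * b ^ 21 * C * D ^ 3 + 344 * b ^ 21 * C * D ^ 2 - 464 * b ^ 21 * C * D + 54 * b ^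
      21 * C - 76 * b ^ 20 * C ^ 3 * D ^ 2 - 487 * b ^ 20 * C ^ 3 * D - 35 * b ^ 20 * C ^ 3 + 28
      * b ^ 20 * D ^ 4 + 83 * b ^ 20 * D ^ 3 - 265 * b ^ 20 * D ^ 2 + 148 * b ^ 20 * D - 44 * b
      ^ 19 * C ^ 5 - 218 * b ^ 19 * C ^ 2 * D ^ 3 - 822 * b ^ 19 * C ^ 2 * D ^ 2 + 704 * b ^ 19
      * C ^ 2 * D + 264 * b ^ 19 * C ^ 2 + 99 * b ^ 18 * C ^ 4 * D ^ 2 + 239 * b ^ 18 * C ^ 4 *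
      D + 472 * b ^ 18 * C ^ 4 - 195 * b ^ 18 * C * D ^ 4 - 385 * b ^ 18 * C * D ^ 3 + 1108 * b
      ^ 18 * C * D ^ 2 - 198 * b ^ 18 * C * D - 272 * b ^ 18 * C + 86 * b ^ 17 * C ^ 6 + 406 * b
      ^ 17 * C ^ 3 * D ^ 3 + 880 * b ^ 17 * C ^ 3 * D ^ 2 + 338 * b ^ 17 * C ^ 3 * D - 1264 * b
      ^ 17 * C ^ 3 - 56 * b ^ 17 * D ^ 5 - 22 * b ^ 17 * D ^ 4 + 366 * b ^ 17 * D ^ 3 - 324 * b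
      ^ 17 * D ^ 2 - 50 * b ^ 17 * D + 84 * b ^ 17 - 77 * b ^ 16 * C ^ 5 * D ^ 2 + 176 * b ^ 16
      * C ^ 5 * D - 715 * b ^ 16 * C ^ 5 + 566 * b ^ 16 * C ^ 2 * D ^ 4 + 595 * b ^ 16 * C ^ 2 *
      D ^ 3 - 1099 * b ^ 16 * C ^ 2 * D ^ 2 - 1737 * b ^ 16 * C ^ 2 * D + 1479 * b ^ 16 * C ^ 2
      - 50 * b ^ 15 * C ^ 7 - 438 * b ^ 15 * C ^ 4 * D ^ 3 - 224 * b ^ 15 * C ^ 4 * D ^ 2 - 2180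
      * b ^ 15 * C ^ 4 * D + 2124 * b ^ 15 * C ^ 4 + 330 * b ^ 15 * C * D ^ 5 - 86 * b ^ 15 * C
      * D ^ 4 - 1018 * b ^ 15 * C * D ^ 3 - 128 * b ^ 15 * C * D ^ 2 + 1696 * b ^ 15 * C * D -
      806 * b ^ 15 * C + 34 * b ^ 14 * C ^ 6 * D ^ 2 - 269 * b ^ 14 * C ^ 6 * D + 485 * b ^ 14 *
      C ^ 6 - 871 * b ^ 14 * C ^ 3 * D ^ 4 - 197 * b ^ 14 * C ^ 3 * D ^ 3 - 1531 * b ^ 14 * C ^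
      3 * D ^ 2 + 5937 * b ^ 14 * C ^ 3 * D - 3138 * b ^ 14 * C ^ 3 + 70 * b ^ 14 * D ^ 6 - 113
      * b ^ 14 * D ^ 5 - 164 * b ^ 14 * D ^ 4 + 224 * b ^ 14 * D ^ 3 + 331 * b ^ 14 * D ^ 2 -
      510 * b ^ 14 * D + 168 * b ^ 14 + 14 * b ^ 13 * C ^ 8 + 262 * b ^ 13 * C ^ 5 * D ^ 3 - 356
      * b ^ 13 * C ^ 5 * D ^ 2 + 2434 * b ^ 13 * C ^ 5 * D - 1754 * b ^ 13 * C ^ 5 - 784 * b ^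
      13 * C ^ 2 * D ^ 5 + 628 * b ^ 13 * C ^ 2 * D ^ 4 - 130 * b ^ 13 * C ^ 2 * D ^ 3 + 4918 *
      b ^ 13 * C ^ 2 * D ^ 2 - 6938 * b ^ 13 * C ^ 2 * D + 2484 * b ^ 13 * C ^ 2 - 9 * b ^ 12 *
      C ^ 7 * D ^ 2 + 85 * b ^ 12 * C ^ 7 * D - 178 * b ^ 12 * C ^ 7 + 738 * b ^ 12 * C ^ 4 * D
      ^ 4 - 322 * b ^ 12 * C ^ 4 * D ^ 3 + 4014 * b ^ 12 * C ^ 4 * D ^ 2 - 7379 * b ^ 12 * C ^ 4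
      * D + 3255 * b ^ 12 * C ^ 4 - 335 * b ^ 12 * C * D ^ 6 + 687 * b ^ 12 * C * D ^ 5 - 220 *
      b ^ 12 * C * D ^ 4 + 1487 * b ^ 12 * C * D ^ 3 - 4423 * b ^ 12 * C * D ^ 2 + 3762 * b ^ 12
      * C * D - 1014 * b ^ 12 * C - 6 * b ^ 11 * C ^ 9 - 72 * b ^ 11 * C ^ 6 * D ^ 3 + 282 * b ^
      11 * C ^ 6 * D ^ 2 - 1000 * b ^ 11 * C ^ 6 * D + 776 * b ^ 11 * C ^ 6 + 938 * b ^ 11 * C ^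
      3 * D ^ 5 - 1060 * b ^ 11 * C ^ 3 * D ^ 4 + 2906 * b ^ 11 * C ^ 3 * D ^ 3 - 10894 * b ^ 11
      * C ^ 3 * D ^ 2 + 10980 * b ^ 11 * C ^ 3 * D - 3432 * b ^ 11 * C ^ 3 - 56 * b ^ 11 * D ^ 7
      + 188 * b ^ 11 * D ^ 6 - 182 * b ^ 11 * D ^ 5 + 228 * b ^ 11 * D ^ 4 - 846 * b ^ 11 * D ^
      3 + 1280 * b ^ 11 * D ^ 2 - 778 * b ^ 11 * D + 168 * b ^ 11 + 2 * b ^ 10 * C ^ 8 * D ^ 2 +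
      7 * b ^ 10 * C ^ 8 * D + 49 * b ^ 10 * C ^ 8 - 310 * b ^ 10 * C ^ 5 * D ^ 4 + 240 * b ^ 10
      * C ^ 5 * D ^ 3 - 2845 * b ^ 10 * C ^ 5 * D ^ 2 + 3927 * b ^ 10 * C ^ 5 * D - 1726 * b ^
      10 * C ^ 5 + 611 * b ^ 10 * C ^ 2 * D ^ 6 - 1415 * b ^ 10 * C ^ 2 * D ^ 5 + 1904 * b ^ 10
      * C ^ 2 * D ^ 4 - 7014 * b ^ 10 * C ^ 2 * D ^ 3 + 12631 * b ^ 10 * C ^ 2 * D ^ 2 - 8706 *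
      b ^ 10 * C ^ 2 * D + 2099 * b ^ 10 * C ^ 2 - 2 * b ^ 9 * C ^ 10 + 8 * b ^ 9 * C ^ 7 * D ^
      3 - 16 * b ^ 9 * C ^ 7 * D ^ 2 + 132 * b ^ 9 * C ^ 7 * D - 174 * b ^ 9 * C ^ 7 - 564 * b ^
      9 * C ^ 4 * D ^ 5 + 536 * b ^ 9 * C ^ 4 * D ^ 4 - 3092 * b ^ 9 * C ^ 4 * D ^ 3 + 8860 * b
      ^ 9 * C ^ 4 * D ^ 2 - 7636 * b ^ 9 * C ^ 4 * D + 2274 * b ^ 9 * C ^ 4 + 204 * b ^ 9 * C *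
      D ^ 7 - 740 * b ^ 9 * C * D ^ 6 + 1152 * b ^ 9 * C * D ^ 5 - 2530 * b ^ 9 * C * D ^ 4 +
      5876 * b ^ 9 * C * D ^ 3 - 6778 * b ^ 9 * C * D ^ 2 + 3536 * b ^ 9 * C * D - 694 * b ^ 9 *
      C + b ^ 8 * C ^ 9 * D ^ 2 + 15 * b ^ 8 * C ^ 9 * D + 22 * b ^ 8 * C ^ 9 + 34 * b ^ 8 * C ^
      6 * D ^ 4 - 3 * b ^ 8 * C ^ 6 * D ^ 3 + 417 * b ^ 8 * C ^ 6 * D ^ 2 - 940 * b ^ 8 * C ^ 6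
      * D + 394 * b ^ 8 * C ^ 6 - 507 * b ^ 8 * C ^ 3 * D ^ 6 + 1110 * b ^ 8 * C ^ 3 * D ^ 5 -
      2233 * b ^ 8 * C ^ 3 * D ^ 4 + 8868 * b ^ 8 * C ^ 3 * D ^ 3 - 13256 * b ^ 8 * C ^ 3 * D ^
      2 + 8207 * b ^ 8 * C ^ 3 * D - 1867 * b ^ 8 * C ^ 3 + 28 * b ^ 8 * D ^ 8 - 139 * b ^ 8 * D
      ^ 7 + 291 * b ^ 8 * D ^ 6 - 505 * b ^ 8 * D ^ 5 + 1059 * b ^ 8 * D ^ 4 - 1641 * b ^ 8 * D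
      ^ 3 + 1385 * b ^ 8 * D ^ 2 - 580 * b ^ 8 * D + 96 * b ^ 8 + 2 * b ^ 7 * C ^ 11 - 6 * b ^ 7
      * C ^ 8 * D ^ 3 - 50 * b ^ 7 * C ^ 8 * D ^ 2 - 130 * b ^ 7 * C ^ 8 * D - 68 * b ^ 7 * C ^
      8 + 136 * b ^ 7 * C ^ 5 * D ^ 5 + 170 * b ^ 7 * C ^ 5 * D ^ 4 + 936 * b ^ 7 * C ^ 5 * D ^
      3 - 2010 * b ^ 7 * C ^ 5 * D ^ 2 + 2372 * b ^ 7 * C ^ 5 * D - 638 * b ^ 7 * C ^ 5 - 254 *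
      b ^ 7 * C ^ 2 * D ^ 7 + 918 * b ^ 7 * C ^ 2 * D ^ 6 - 1712 * b ^ 7 * C ^ 2 * D ^ 5 + 4790
      * b ^ 7 * C ^ 2 * D ^ 4 - 10428 * b ^ 7 * C ^ 2 * D ^ 3 + 10502 * b ^ 7 * C ^ 2 * D ^ 2 -
      5010 * b ^ 7 * C ^ 2 * D + 928 * b ^ 7 * C ^ 2 - 5 * b ^ 6 * C ^ 10 * D - b ^ 6 * C ^ 10 +
      9 * b ^ 6 * C ^ 7 * D ^ 4 + 11 * b ^ 6 * C ^ 7 * D ^ 3 + 254 * b ^ 6 * C ^ 7 * D ^ 2 + 358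
      * b ^ 6 * C ^ 7 * D + 58 * b ^ 6 * C ^ 7 + 166 * b ^ 6 * C ^ 4 * D ^ 6 - 109 * b ^ 6 * C ^
      4 * D ^ 5 + 313 * b ^ 6 * C ^ 4 * D ^ 4 - 3587 * b ^ 6 * C ^ 4 * D ^ 3 + 4435 * b ^ 6 * C
      ^ 4 * D ^ 2 - 3123 * b ^ 6 * C ^ 4 * D + 687 * b ^ 6 * C ^ 4 - 69 * b ^ 6 * C * D ^ 8 +
      349 * b ^ 6 * C * D ^ 7 - 817 * b ^ 6 * C * D ^ 6 + 1763 * b ^ 6 * C * D ^ 5 - 3893 * b ^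
      6 * C * D ^ 4 + 5577 * b ^ 6 * C * D ^ 3 - 4238 * b ^ 6 * C * D ^ 2 + 1638 * b ^ 6 * C * D
      - 256 * b ^ 6 * C + 4 * b ^ 5 * C ^ 12 - 2 * b ^ 5 * C ^ 9 * D ^ 3 + 4 * b ^ 5 * C ^ 9 * D
      ^ 2 - 30 * b ^ 5 * C ^ 9 * D - 54 * b ^ 5 * C ^ 9 - 154 * b ^ 5 * C ^ 6 * D ^ 4 - 18 * b ^
      5 * C ^ 6 * D ^ 3 - 332 * b ^ 5 * C ^ 6 * D ^ 2 - 374 * b ^ 5 * C ^ 6 * D + 52 * b ^ 5 * C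
      ^ 6 + 110 * b ^ 5 * C ^ 3 * D ^ 7 - 288 * b ^ 5 * C ^ 3 * D ^ 6 + 356 * b ^ 5 * C ^ 3 * D
      ^ 5 - 2210 * b ^ 5 * C ^ 3 * D ^ 4 + 5640 * b ^ 5 * C ^ 3 * D ^ 3 - 5146 * b ^ 5 * C ^ 3 *
      D ^ 2 + 2482 * b ^ 5 * C ^ 3 * D - 454 * b ^ 5 * C ^ 3 - 8 * b ^ 5 * D ^ 9 + 52 * b ^ 5 *
      D ^ 8 - 154 * b ^ 5 * D ^ 7 + 330 * b ^ 5 * D ^ 6 - 656 * b ^ 5 * D ^ 5 + 1066 * b ^ 5 * D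
      ^ 4 - 1124 * b ^ 5 * D ^ 3 + 684 * b ^ 5 * D ^ 2 - 222 * b ^ 5 * D + 30 * b ^ 5 - b ^ 4 *
      C ^ 11 * D ^ 2 - 17 * b ^ 4 * C ^ 11 * D - 32 * b ^ 4 * C ^ 11 + 6 * b ^ 4 * C ^ 8 * D ^ 4
      + 12 * b ^ 4 * C ^ 8 * D ^ 3 + 96 * b ^ 4 * C ^ 8 * D ^ 2 + 333 * b ^ 4 * C ^ 8 * D + 183
      * b ^ 4 * C ^ 8 - 5 * b ^ 4 * C ^ 5 * D ^ 6 - 183 * b ^ 4 * C ^ 5 * D ^ 5 + 419 * b ^ 4 *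
      C ^ 5 * D ^ 4 + 21 * b ^ 4 * C ^ 5 * D ^ 3 - 183 * b ^ 4 * C ^ 5 * D ^ 2 + 219 * b ^ 4 * C
      ^ 5 * D + 26 * b ^ 4 * C ^ 5 + 44 * b ^ 4 * C ^ 2 * D ^ 8 - 194 * b ^ 4 * C ^ 2 * D ^ 7 +
      402 * b ^ 4 * C ^ 2 * D ^ 6 - 1071 * b ^ 4 * C ^ 2 * D ^ 5 + 3103 * b ^ 4 * C ^ 2 * D ^ 4
      - 4479 * b ^ 4 * C ^ 2 * D ^ 3 + 3221 * b ^ 4 * C ^ 2 * D ^ 2 - 1209 * b ^ 4 * C ^ 2 * D +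
      185 * b ^ 4 * C ^ 2 + 2 * b ^ 3 * C ^ 13 + 4 * b ^ 3 * C ^ 10 * D ^ 3 + 38 * b ^ 3 * C ^
      10 * D ^ 2 + 136 * b ^ 3 * C ^ 10 * D + 72 * b ^ 3 * C ^ 10 - 6 * b ^ 3 * C ^ 7 * D ^ 5 -
      48 * b ^ 3 * C ^ 7 * D ^ 4 - 86 * b ^ 3 * C ^ 7 * D ^ 3 - 518 * b ^ 3 * C ^ 7 * D ^ 2 -
      308 * b ^ 3 * C ^ 7 * D - 12 * b ^ 3 * C ^ 7 - 90 * b ^ 3 * C ^ 4 * D ^ 6 + 504 * b ^ 3 *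
      C ^ 4 * D ^ 5 - 414 * b ^ 3 * C ^ 4 * D ^ 4 - 24 * b ^ 3 * C ^ 4 * D ^ 3 + 654 * b ^ 3 * C
      ^ 4 * D ^ 2 - 464 * b ^ 3 * C ^ 4 * D + 56 * b ^ 3 * C ^ 4 + 10 * b ^ 3 * C * D ^ 9 - 62 *
      b ^ 3 * C * D ^ 8 + 180 * b ^ 3 * C * D ^ 7 - 426 * b ^ 3 * C * D ^ 6 + 984 * b ^ 3 * C *
      D ^ 5 - 1752 * b ^ 3 * C * D ^ 4 + 1774 * b ^ 3 * C * D ^ 3 - 1026 * b ^ 3 * C * D ^ 2 +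
      320 * b ^ 3 * C * D - 42 * b ^ 3 * C - b ^ 2 * C ^ 12 * D ^ 2 - 4 * b ^ 2 * C ^ 12 * D -
      35 * b ^ 2 * C ^ 12 - 8 * b ^ 2 * C ^ 9 * D ^ 4 - 58 * b ^ 2 * C ^ 9 * D ^ 3 - 161 * b ^ 2
      * C ^ 9 * D ^ 2 + 39 * b ^ 2 * C ^ 9 * D - 130 * b ^ 2 * C ^ 9 + 5 * b ^ 2 * C ^ 6 * D ^ 6
      + 5 * b ^ 2 * C ^ 6 * D ^ 5 + 104 * b ^ 2 * C ^ 6 * D ^ 4 + 384 * b ^ 2 * C ^ 6 * D ^ 3 +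
      25 * b ^ 2 * C ^ 6 * D ^ 2 + 214 * b ^ 2 * C ^ 6 * D - 71 * b ^ 2 * C ^ 6 - 44 * b ^ 2 * C
      ^ 3 * D ^ 7 + 213 * b ^ 2 * C ^ 3 * D ^ 6 - 501 * b ^ 2 * C ^ 3 * D ^ 5 + 93 * b ^ 2 * C ^
      3 * D ^ 4 + 85 * b ^ 2 * C ^ 3 * D ^ 3 - 251 * b ^ 2 * C ^ 3 * D ^ 2 + 167 * b ^ 2 * C ^ 3
      * D - 28 * b ^ 2 * C ^ 3 + b ^ 2 * D ^ 10 - 8 * b ^ 2 * D ^ 9 + 30 * b ^ 2 * D ^ 8 - 77 *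
      b ^ 2 * D ^ 7 + 163 * b ^ 2 * D ^ 6 - 281 * b ^ 2 * D ^ 5 + 355 * b ^ 2 * D ^ 4 - 278 * b
      ^ 2 * D ^ 3 + 132 * b ^ 2 * D ^ 2 - 35 * b ^ 2 * D + 4 * b ^ 2 - 2 * b * C ^ 14 + 4 * b *
      C ^ 11 * D ^ 3 + 8 * b * C ^ 11 * D ^ 2 + 24 * b * C ^ 11 * D - 6 * b * C ^ 11 + 12 * b *
      C ^ 8 * D ^ 5 + 20 * b * C ^ 8 * D ^ 4 + 56 * b * C ^ 8 * D ^ 3 - 32 * b * C ^ 8 * D ^ 2 +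
      104 * b * C ^ 8 * D + 2 * b * C ^ 8 + 4 * b * C ^ 5 * D ^ 7 - 20 * b * C ^ 5 * D ^ 6 + 4 *
      b * C ^ 5 * D ^ 5 - 182 * b * C ^ 5 * D ^ 4 + 96 * b * C ^ 5 * D ^ 3 - 194 * b * C ^ 5 * D
      ^ 2 + 72 * b * C ^ 5 * D - 2 * b * C ^ 5 - 10 * b * C ^ 2 * D ^ 8 + 68 * b * C ^ 2 * D ^ 7
      - 156 * b * C ^ 2 * D ^ 6 + 204 * b * C ^ 2 * D ^ 5 + 92 * b * C ^ 2 * D ^ 4 - 208 * b * C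
      ^ 2 * D ^ 3 + 154 * b * C ^ 2 * D ^ 2 - 56 * b * C ^ 2 * D + 8 * b * C ^ 2 + C ^ 13 * D +
      C ^ 13 - 2 * C ^ 10 * D ^ 4 - C ^ 10 * D ^ 3 - 5 * C ^ 10 * D ^ 2 - 2 * C ^ 10 * D + 4 * C
      ^ 10 - 3 * C ^ 7 * D ^ 6 - 4 * C ^ 7 * D ^ 5 - C ^ 7 * D ^ 4 - 14 * C ^ 7 * D ^ 2 - 11 * C
      ^ 7 * D + 3 * C ^ 7 - 5 * C ^ 4 * D ^ 7 + 25 * C ^ 4 * D ^ 6 - 15 * C ^ 4 * D ^ 5 + 5 * C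
      ^ 4 * D ^ 4 + 35 * C ^ 4 * D ^ 3 - 15 * C ^ 4 * D ^ 2 - C * D ^ 9 + 8 * C * D ^ 8 - 26 * C
      * D ^ 7 + 36 * C * D ^ 6 - 28 * C * D ^ 5 - 23 * C * D ^ 4 + 41 * C * D ^ 3 - 26 * C * D ^
      2 + 8 * C * D - C) * h

/-! ### The conic, its cyclic shifts and their common zeros -/

/-- The quadratic form whose value at `(x⁻¹, x⁻¹ ^ q, x⁻¹ ^ q ^ 2)` is the value of the pentanomial
at `x` divided by the norm of `x`. -/
def quad {R : Type*} [CommRing R] (b C D X Y Z : R) : R :=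
  (X + b * Y) ^ 2 + Z * (C * X + D * Y)

/-- The common zeros of the three cyclic shifts of `quad`. -/
def IsBasePoint {R : Type*} [CommRing R] (b C D X Y Z : R) : Prop :=
  quad b C D X Y Z = 0 ∧ quad b C D Y Z X = 0 ∧ quad b C D Z X Y = 0

/-- The binary form of the reduced cubic. -/
def redForm {R : Type*} [CommRing R] (b C D X Y : R) : R :=
  red1 b C D * X ^ 3 + red2 b C D * X ^ 2 * Y + red3 b C D * X * Y ^ 2 - red1 b C D * Y ^ 3

/-- The circulant determinant. -/
def circDet {R : Type*} [CommRing R] (X Y Z : R) : R :=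
  X ^ 3 + Y ^ 3 + Z ^ 3 - 3 * X * Y * Z

/-- The second shift minus `b ^ 2` times the third has no `Z ^ 2` term, so it is linear in `Z`, as
is the first equation. The reduced cubic is the resultant of these two linear equations. -/
theorem IsBasePoint.redForm_eq_zero {R : Type*} [CommRing R] {b C D X Y Z : R}
    (h : IsBasePoint b C D X Y Z) : redForm b C D X Y = 0 := by
  obtain ⟨h1, h2, h3⟩ := h
  unfold quad at h1 h2 h3
  unfold redForm red1 red2 red3
  linear_combination (C * X + D * Y) * (h2 - b ^ 2 * h3)
    - ((D - 2 * b ^ 3) * X + (2 * b - b ^ 2 * C) * Y) * h1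

section Field

variable {F : Type*} [Field F] {b C D : F}

/-- The third coordinate over a root `t` is found by dividing by `C * t + D`. If that vanished, the
cubic would split as a linear factor times `(t + b) ^ 2`. The square is excluded by `D ≠ b * C`, and
the linear factor leads successively to `b ^ 6 = -1`, `t = -b ^ 4` and a zero leading coefficient.
-/
theorem linear_coeff_ne_zero (h : ParamRel b C D) (hD : D ≠ b * C)
    (h0 : red1 b C D ≠ 0) {t : F} (ht : redForm b C D t 1 = 0) : C * t + D ≠ 0 := by
  intro hA
  obtain rfl : D = -(C * t) := by linear_combination hA
  have hprod : ((-(C * t) - 2 * b ^ 3) * t + (2 * b - b ^ 2 * C)) * (t + b) ^ 2 = 0 := by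
    unfold redForm red1 red2 red3 at ht
    linear_combination -ht
  have htb : t + b ≠ 0 := fun h' => hD (by linear_combination -C * h')
  have hA2 := (mul_eq_zero.1 hprod).resolve_right (pow_ne_zero 2 htb)
  have h6 : b ^ 6 + 1 = 0 := by
    refine (mul_eq_zero.1 (?_ : (b ^ 6 + 1) * (t + b) ^ 2 = 0)).resolve_right (pow_ne_zero 2 htb)
    unfold ParamRel at h
    linear_combination (t ^ 2 + b ^ 2) * h + (C * (t ^ 2 + b ^ 2) + 2 * b * (1 - b ^ 2 * t)
      - (b ^ 4 + 2 * b - 2 * b ^ 3 * t - t)) * hA2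
  have ht4 : t + b ^ 4 = 0 := by
    refine (mul_eq_zero.1 (?_ : (t + b ^ 4) * red1 b C (-(C * t)) = 0)).resolve_right h0
    unfold red1
    linear_combination -hA2 + (2 * b - C * b ^ 2) * h6
  obtain rfl : t = -b ^ 4 := by linear_combination ht4
  apply h0
  unfold ParamRel at h
  unfold red1
  linear_combination h - (b ^ 2 * C ^ 2 + 1 - 2 * b * C) * h6

/-- Converse of the elimination: the parameter relation is exactly what is used to make a root of
the reduced cubic satisfy all three equations. -/
theorem exists_isBasePoint_of_root (h : ParamRel b C D) (hD : D ≠ b * C)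
    (h0 : red1 b C D ≠ 0) {t : F} (ht : redForm b C D t 1 = 0) :
    ∃ z, IsBasePoint b C D t 1 z := by
  have hA := linear_coeff_ne_zero h hD h0 ht
  set A := C * t + D with hAdef
  -- The first equation is linear in the last coordinate, so it determines this value.
  refine ⟨-(t + b) ^ 2 / A, ?_⟩
  set z := -(t + b) ^ 2 / A with hz
  have hzA : z * A = -(t + b) ^ 2 := div_mul_cancel₀ _ hA
  rw [hAdef] at hzA
  have e1 : quad b C D t 1 z = 0 := by
    unfold quad
    linear_combination hzA
  have e3 : quad b C D z t 1 = 0 := by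
    -- Clearing denominators turns the third equation into a quartic in `t`. Its product with the
    -- leading coefficient is a multiple of the cubic plus a multiple of the parameter relation.
    have hg : red1 b C D * ((-(t + b) ^ 2 + b * t * A) ^ 2
        + (-C * (t + b) ^ 2 + D * t * A) * A) = 0 := by
      rw [hAdef]
      unfold redForm red1 red2 red3 at ht
      unfold red1
      unfold ParamRel at h
      linear_combination ((1 - b * C) ^ 2 * t - (b ^ 4 - b ^ 2 * C * D)) * ht
        + (2*b^3*t - b^2*C*t^3 - b^2*D*t^2 + 4*b^2*t^2 + 2*b*t^3 - C^2*t^3 - 2*C*D*t^2 - C*t^2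
          - D^2*t - D*t) * h
    have hg' := (mul_eq_zero.1 hg).resolve_left h0
    refine (mul_eq_zero.1 (?_ : A ^ 2 * quad b C D z t 1 = 0)).resolve_left (pow_ne_zero 2 hA)
    unfold quad
    rw [← hAdef] at hzA
    linear_combination hg' + (z * A - (t + b) ^ 2 + 2 * b * t * A + C * A) * hzA
  refine ⟨e1, ?_, e3⟩
  -- The elimination identity read backwards: the cubic and two of the equations yield the remaining
  -- one.
  refine (mul_eq_zero.1 (?_ : A * quad b C D 1 z t = 0)).resolve_left hA
  rw [hAdef]
  unfold redForm red1 red2 red3 at ht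
  unfold quad at e1 e3 ⊢
  linear_combination ht + (C * t + D) * b ^ 2 * e3
    + ((D - 2 * b ^ 3) * t + (2 * b - b ^ 2 * C)) * e1

/-- With zero leading coefficient, the parameter relation factors as `(1 - b * C) ^ 2 * (b ^ 6 + 1)
= 0`. The first factor gives an explicit common zero; the second makes the whole reduced cubic
vanish. -/
theorem isBasePoint_or_red_eq_zero (h : ParamRel b C D) (h0 : red1 b C D = 0) :
    IsBasePoint b C D 0 (-b) 1 ∧ b ≠ 0 ∨ red2 b C D = 0 ∧ red3 b C D = 0 := by
  unfold red1 at h0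
  obtain rfl : D = 2 * b ^ 3 - b ^ 4 * C := by linear_combination -h0
  unfold ParamRel at h
  have hv : (1 - b * C) ^ 2 * (b ^ 6 + 1) = 0 := by linear_combination h
  rcases mul_eq_zero.1 hv with hv | h6
  · left
    have hv := pow_eq_zero_iff (two_ne_zero) |>.1 hv
    refine ⟨⟨?_, ?_, ?_⟩, ?_⟩
    · unfold quad
      linear_combination -b ^ 4 * hv
    · unfold quad
      ring
    · unfold quad
      linear_combination hv
    · rintro rfl
      simp at hv
  · right
    unfold red2 red3
    constructor
    · linear_combination (C ^ 2 + b ^ 2 * C - 2 * b) * h6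
    · linear_combination (C + 4 * b ^ 3 * C - b ^ 4 * C ^ 2 - 4 * b ^ 2) * h6

/-- A zero determinant would put the point and its cyclic shifts on one line `X + η Y + η² Z = 0`
with `η ^ 3 = 1`. The conic would meet this line in three distinct points, hence contain it, and
comparing coefficients would give `b = η` and `D = b * C`. -/
theorem IsBasePoint.circDet_ne_zero (hD : D ≠ b * C) {X Y Z : F}
    (h : IsBasePoint b C D X Y Z) (hXY : X ^ 3 ≠ Y ^ 3) : circDet X Y Z ≠ 0 := by
  intro hN
  unfold circDet at hN
  -- The cofactors of the circulant matrix, up to sign. When its determinant is zero they are in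
  -- geometric progression, with ratio a cube root of unity `η`.
  set k0 := X ^ 2 - Y * Z with hk0
  set k1 := Y ^ 2 - Z * X with hk1
  set k2 := Z ^ 2 - X * Y with hk2
  have r0 : k0 ^ 2 = k1 * k2 := by linear_combination X * hN
  have r1 : k1 ^ 2 = k2 * k0 := by linear_combination Y * hN
  have hk : k0 ≠ 0 := by
    intro hk
    have hk1' : k1 = 0 := pow_eq_zero_iff two_ne_zero |>.1 (by rw [r1, hk, mul_zero])
    exact hXY (by linear_combination X * hk - Y * hk1')
  set η := k1 / k0 with hη
  have hk1η : k1 = η * k0 := (div_mul_cancel₀ _ hk).symm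
  have hk2η : k2 = η ^ 2 * k0 := by
    refine mul_right_cancel₀ hk ?_
    rw [← r1, hk1η]
    ring
  have hη3 : η ^ 3 = 1 := by
    refine mul_right_cancel₀ (pow_ne_zero 2 hk) ?_
    linear_combination -r0 - k2 * hk1η - η * k0 * hk2η
  have hplane : X + η * Y + η ^ 2 * Z = 0 := by
    refine (mul_eq_zero.1 (?_ : k0 * _ = 0)).resolve_left hk
    linear_combination hN - Y * hk1η - Z * hk2η
  have hη0 : η ≠ 0 := by
    intro h0
    simp [h0] at hη3
  have hk1' : k1 ≠ 0 := hk1η ▸ mul_ne_zero hη0 hk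
  have hk2' : k2 ≠ 0 := hk2η ▸ mul_ne_zero (pow_ne_zero 2 hη0) hk
  -- On the line, the conic becomes a binary quadratic form in the last two coordinates. Cyclic
  -- shifts preserve the line, so all three equations concern the same binary form.
  have restrict : ∀ x y z : F, x + η * y + η ^ 2 * z = 0 → quad b C D x y z = 0 →
      (b - η) ^ 2 * y ^ 2 + (-2 * η ^ 2 * (b - η) + D - C * η) * (y * z)
        + (η - C * η ^ 2) * z ^ 2 = 0 := by
    intro x y z hx hq
    obtain rfl : x = -(η * y + η ^ 2 * z) := by linear_combination hx
    unfold quad at hq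
    linear_combination hq - η * z ^ 2 * hη3
  obtain ⟨h1, h2, h3⟩ := h
  have e1 := restrict X Y Z hplane h1
  have e2 := restrict Y Z X (by linear_combination η ^ 2 * hplane - (Y + η * Z) * hη3) h2
  have e3 := restrict Z X Y (by linear_combination η * hplane - Z * hη3) h3
  -- Up to sign, this is the determinant of the linear system for the three coefficients of the
  -- binary form, a homogeneous Vandermonde determinant in the points `(Y, Z)`, `(Z, X)`, `(X, Y)`.
  have hdet : k0 * k1 * k2 ≠ 0 := mul_ne_zero (mul_ne_zero hk hk1') hk2'
  have hα : (b - η) ^ 2 = 0 := by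
    refine (mul_eq_zero.1 (?_ : _ * (k0 * k1 * k2) = 0)).resolve_right hdet
    linear_combination (Z * X * Y ^ 2 - X ^ 3 * Y) * e1 - (Y ^ 3 * Z - Z ^ 2 * X * Y) * e2
      + (Y * Z * X ^ 2 - Z ^ 3 * X) * e3
  have hγ : η - C * η ^ 2 = 0 := by
    refine (mul_eq_zero.1 (?_ : _ * (k0 * k1 * k2) = 0)).resolve_right hdet
    linear_combination (Z ^ 2 * X * Y - Z * X ^ 3) * e1 - (Y ^ 3 * X - Y * Z * X ^ 2) * e2
      + (Y ^ 2 * Z * X - Y * Z ^ 3) * e3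
  have hβ : -2 * η ^ 2 * (b - η) + D - C * η = 0 := by
    refine (mul_eq_zero.1 (?_ : _ * (k0 * k1 * k2) = 0)).resolve_right hdet
    linear_combination -(Z ^ 2 * Y ^ 2 - X ^ 4) * e1 + (Y ^ 4 - Z ^ 2 * X ^ 2) * e2
      - (Y ^ 2 * X ^ 2 - Z ^ 4) * e3
  have hb : b - η = 0 := pow_eq_zero_iff two_ne_zero |>.1 hα
  exact hD (by linear_combination hβ + (2 * η ^ 2 - C) * hb)

end Field

/-! ### A rational root of the reduced cubic -/

/-- A cubic over `F` whose extreme coefficients are opposite, without roots of norm one in the cubic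
extension, has a root in `F`. -/
theorem exists_root_of_forall_mu_ne_zero {F K : Type*} [Field F] [Fintype F] [Field K] [Algebra F K]
    (hFK : Module.finrank F K = 3) {a b c : F} (ha : a ≠ 0)
    (h : ∀ t ∈ mu K (Fintype.card F ^ 2 + Fintype.card F + 1),
      algebraMap F K a * t ^ 3 + algebraMap F K b * t ^ 2 + algebraMap F K c * t
        - algebraMap F K a ≠ 0) :
    ∃ t : F, a * t ^ 3 + b * t ^ 2 + c * t - a = 0 := by
  by_contra! hroot
  set p : Polynomial F := Polynomial.C a * Polynomial.X ^ 3 + Polynomial.C b * Polynomial.X ^ 2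
    + Polynomial.C c * Polynomial.X + Polynomial.C (-a) with hp
  have hdeg : p.natDegree = 3 := Polynomial.natDegree_cubic ha
  have hlead : p.leadingCoeff = a := Polynomial.leadingCoeff_cubic ha
  have hcoeff : p.coeff 0 = -a := by simp [hp]
  -- A cubic without roots in the field is irreducible.
  have hirr : Irreducible p := by
    refine Polynomial.irreducible_of_degree_le_three_of_not_isRoot (by simp [hdeg]) fun x hx => ?_
    refine hroot x ?_
    simpa [hp, Polynomial.IsRoot, ← sub_eq_add_neg] using hx
  have : Fact (Irreducible p) := ⟨hirr⟩
  have hfin : Module.finrank F (AdjoinRoot p) = 3 := by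
    rw [(AdjoinRoot.powerBasis hirr.ne_zero).finrank, AdjoinRoot.powerBasis_dim, hdeg]
  have : Module.Finite F (AdjoinRoot p) := Module.finite_of_finrank_pos (by omega)
  have : Finite (AdjoinRoot p) := Module.finite_of_finite F
  have : Module.Finite F K := Module.finite_of_finrank_pos (by omega)
  have : Finite K := Module.finite_of_finite F
  -- The norm of a root is `(-1) ^ 3` times the constant coefficient over the leading one, here
  -- `(-1) ^ 3 * (-1)`. Over a finite field, the norm is also the power with exponent `1 + q + q ^
  -- 2`.
  have hnorm : Algebra.norm F (AdjoinRoot.root p) = 1 := by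
    have := Algebra.PowerBasis.norm_gen_eq_coeff_zero_minpoly
      (AdjoinRoot.powerBasis hirr.ne_zero)
    rw [AdjoinRoot.minpoly_powerBasis_gen, AdjoinRoot.powerBasis_gen, AdjoinRoot.powerBasis_dim,
      hdeg, Polynomial.coeff_mul_C, hcoeff, hlead] at this
    rw [this, neg_mul, mul_inv_cancel₀ ha]
    norm_num
  have hpow := FiniteField.algebraMap_norm_eq_pow_sum F (AdjoinRoot p) (AdjoinRoot.root p)
  rw [hnorm, map_one, hfin, Nat.card_eq_fintype_card] at hpow
  -- Both extensions have degree 3, so the root embeds into `K`, where it violates the hypothesis.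
  obtain ⟨g⟩ := FiniteField.nonempty_algHom_of_finrank_dvd (F := F) (K := AdjoinRoot p) (L := K)
    (by rw [hfin, hFK])
  refine h (g (AdjoinRoot.root p)) ?_ ?_
  · rw [mu, Set.mem_ofPred_eq, ← map_pow, ← map_one g, hpow]
    congr 2
    simp [Finset.sum_range_succ]
    ring
  · have h0 : Polynomial.aeval (g (AdjoinRoot.root p)) p = 0 := by
      rw [Polynomial.aeval_algHom_apply, AdjoinRoot.aeval_eq, AdjoinRoot.mk_self, map_zero]
    simpa [hp, ← sub_eq_add_neg] using h0

/-! ### Linearization of the quadratic form by a base point -/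

section Twist

variable {K : Type*} [Field K] [Finite K] {σ : K →+* K}

/-- A base point allows the substitution `X = ψ Y` that removes the squares from the form, leaving
an injective additive function of `Y * σ Y`. Proportional values then give `Y * σ Y = c * (Y' * σ
Y')`. The ratio of `Y` to a nonzero `Y'` is therefore either zero or fixed by `σ²`; as `σ³ = 1`, it
is fixed by `σ`. -/
theorem IsBasePoint.exists_fixed_smul_eq (h3 : ∀ x, σ (σ (σ x)) = x) {b C D x y z : K}
    (hx : σ x = x) (hy : σ y = y) (hz : σ z = z)
    (hbase : IsBasePoint b C D x y z) (hdet : circDet x y z ≠ 0)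
    (hne : ∀ X : K, X ≠ 0 → quad b C D X (σ X) (σ (σ X)) ≠ 0)
    {X X' c : K} (hX' : X' ≠ 0) (hc : σ c = c)
    (h : quad b C D X (σ X) (σ (σ X)) = c * quad b C D X' (σ X') (σ (σ X'))) :
    ∃ d, σ d = d ∧ X = d * X' := by
  -- Chosen so that `(ψ Y, σ (ψ Y), σ² (ψ Y))` equals `Y (x, y, z) + σ Y (z, x, y) + σ² Y (y, z,
  -- x)`. Its matrix is circulant, and the form vanishes at each of the three vectors.
  let ψ : K →+ K :=
    { toFun := fun Y => x * Y + z * σ Y + y * σ (σ Y)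
      map_zero' := by simp
      map_add' := fun Y Y' => by simp only [map_add]; ring }
  have hψ : ∀ Y, ψ Y = x * Y + z * σ Y + y * σ (σ Y) := fun _ => rfl
  have hψ1 : ∀ Y, σ (ψ Y) = x * σ Y + z * σ (σ Y) + y * Y := fun Y => by
    simp only [hψ, map_add, map_mul, hx, hy, hz, h3]
  have hψ2 : ∀ Y, σ (σ (ψ Y)) = x * σ (σ Y) + z * Y + y * σ Y := fun Y => by
    simp only [hψ1, map_add, map_mul, hx, hy, hz, h3]
  have hinj : Function.Injective ψ := by
    refine (injective_iff_map_eq_zero ψ).2 fun Y hY => ?_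
    have h1 := hψ1 Y
    have h2 := hψ2 Y
    rw [hY, map_zero] at h1
    rw [hY, map_zero, map_zero] at h2
    rw [hψ] at hY
    refine (mul_eq_zero.1 (?_ : circDet x y z * Y = 0)).resolve_left hdet
    unfold circDet
    linear_combination (x ^ 2 - y * z) * hY - (y ^ 2 - x * z) * h1 - (z ^ 2 - x * y) * h2
  have hsurj : Function.Surjective ψ := Finite.surjective_of_injective hinj
  -- The polar form of two zeros of a quadratic form is the value at their sum, so these are the
  -- coefficients of the mixed terms.
  set a0 := quad b C D (x + z) (y + x) (z + y) with ha0
  set a1 := quad b C D (z + y) (x + z) (y + x) with ha1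
  set a2 := quad b C D (y + x) (z + y) (x + z) with ha2
  have hquad : ∀ Y, quad b C D (ψ Y) (σ (ψ Y)) (σ (σ (ψ Y)))
      = a0 * (Y * σ Y) + a1 * (σ Y * σ (σ Y)) + a2 * (σ (σ Y) * Y) := by
    intro Y
    obtain ⟨e1, e2, e3⟩ := hbase
    rw [hψ2, hψ1, hψ, ha0, ha1, ha2]
    unfold quad at e1 e2 e3 ⊢
    generalize σ (σ Y) = Y2
    generalize σ Y = Y1
    linear_combination (Y ^ 2 - Y * Y1 - Y2 * Y) * e1 + (Y1 ^ 2 - Y * Y1 - Y1 * Y2) * e3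
      + (Y2 ^ 2 - Y1 * Y2 - Y2 * Y) * e2
  -- For `Y = (σ w)⁻¹`, the product `Y * σ Y` is `w` divided by its norm. A nonzero kernel element
  -- would therefore give a nonzero zero of the quadratic form.
  have hM : ∀ w, a0 * w + a1 * σ w + a2 * σ (σ w) = 0 → w = 0 := by
    intro w hw
    by_contra hw0
    have hw1 : σ w ≠ 0 := (map_ne_zero σ).2 hw0
    have hw2 : σ (σ w) ≠ 0 := (map_ne_zero σ).2 hw1
    have hY : (σ w)⁻¹ ≠ 0 := inv_ne_zero hw1
    refine hne (ψ (σ w)⁻¹) (fun h0 => hY (hinj (h0.trans (map_zero ψ).symm))) ?_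
    rw [hquad]
    simp only [map_inv₀, h3]
    field_simp
    linear_combination hw
  obtain ⟨Y, rfl⟩ := hsurj X
  obtain ⟨Y', rfl⟩ := hsurj X'
  have hY' : Y' ≠ 0 := by
    rintro rfl
    exact hX' (map_zero ψ)
  have hY1 : σ Y' ≠ 0 := (map_ne_zero σ).2 hY'
  have hY2 : σ (σ Y') ≠ 0 := (map_ne_zero σ).2 hY1
  have key : Y * σ Y - c * (Y' * σ Y') = 0 := by
    refine hM _ ?_
    rw [hquad, hquad] at h
    simp only [map_sub, map_mul, hc, h3]
    linear_combination h
  have key1 : σ Y * σ (σ Y) = c * (σ Y' * σ (σ Y')) := by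
    have := congrArg σ key
    simp only [map_sub, map_mul, hc, map_zero] at this
    linear_combination this
  by_cases hY : Y = 0
  · exact ⟨0, map_zero σ, by rw [hY, map_zero, zero_mul]⟩
  have hσY : σ Y ≠ 0 := (map_ne_zero σ).2 hY
  -- Dividing `Y * σ Y = c * (Y' * σ Y')` by its image under `σ` cancels both `c` and the middle
  -- factors.
  have hratio : Y * σ (σ Y') = σ (σ Y) * Y' := by
    refine mul_right_cancel₀ (mul_ne_zero hσY hY1) ?_
    linear_combination σ Y' * σ (σ Y') * key - Y' * σ Y' * key1
  have hd2 : σ (σ (Y / Y')) = Y / Y' := by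
    rw [map_div₀, map_div₀, div_eq_div_iff hY2 hY', hratio]
  have hd : σ (Y / Y') = Y / Y' := by
    conv_lhs => rw [← hd2]
    exact h3 _
  refine ⟨Y / Y', hd, ?_⟩
  have hYd : Y = Y / Y' * Y' := (div_mul_cancel₀ _ hY').symm
  set d := Y / Y'
  rw [hYd, hψ, hψ, map_mul, map_mul, hd, hd]
  ring

end Twist

/-! ### Transfer to the cubic extension and the permutation property -/

section Map

variable {R S : Type*} [CommRing R] [CommRing S] (f : R →+* S) (b C D X Y Z : R)

theorem map_quad : f (quad b C D X Y Z) = quad (f b) (f C) (f D) (f X) (f Y) (f Z) := by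
  simp [quad]

theorem map_redForm : f (redForm b C D X Y) = redForm (f b) (f C) (f D) (f X) (f Y) := by
  simp [redForm, red1, red2, red3, map_ofNat]

theorem map_circDet : f (circDet X Y Z) = circDet (f X) (f Y) (f Z) := by
  simp [circDet, map_ofNat]

end Map

variable {F K : Type*} [Field F] [Field K] [Algebra F K] {b C D : F}

theorem aeval_mCubic (h : ParamRel b C D) (t : K) :
    Polynomial.aeval t (mCubic (b ^ 2) (2 * b) C D)
      = algebraMap F K (b ^ 3 + 1 - D - b * C) ^ 10
        * redForm (algebraMap F K b) (algebraMap F K C) (algebraMap F K D) t 1 := by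
  have e1 : red1 (algebraMap F K b) (algebraMap F K C) (algebraMap F K D)
      = algebraMap F K (red1 b C D) := by simp [red1, map_ofNat]
  have e2 : red2 (algebraMap F K b) (algebraMap F K C) (algebraMap F K D)
      = algebraMap F K (red2 b C D) := by simp [red2, map_ofNat]
  have e3 : red3 (algebraMap F K b) (algebraMap F K C) (algebraMap F K D)
      = algebraMap F K (red3 b C D) := by simp [red3, map_ofNat]
  rw [mCubic, lam4, lam1_eq h, lam2_eq h, lam3_eq h, redForm, e1, e2, e3]
  simp only [map_add, map_mul, map_pow, map_neg, Polynomial.aeval_C, Polynomial.aeval_X]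
  ring

/-- The reduced cubic has a rational root, or is degenerate of a kind already treated. The condition
`X ^ 3 ≠ Y ^ 3`, needed for the determinant, holds because a rational `t` with `t ^ 3 = 1` belongs
to the set where the cubic has no zeros. -/
theorem exists_isBasePoint [Fintype F] (hFK : Module.finrank F K = 3) (h : ParamRel b C D) (hD : D ≠ b * C)
    (hred : ∀ t ∈ mu K (Fintype.card F ^ 2 + Fintype.card F + 1),
      redForm (algebraMap F K b) (algebraMap F K C) (algebraMap F K D) t 1 ≠ 0) :
    ∃ X Y Z, IsBasePoint b C D X Y Z ∧ X ^ 3 ≠ Y ^ 3 := by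
  have hredF : ∀ t : F, t ^ 3 = 1 → redForm b C D t 1 ≠ 0 := by
    intro t ht h0
    refine hred (algebraMap F K t) ?_ ?_
    -- On the base field Frobenius is trivial, so `t ^ (q ^ 2 + q + 1) = t ^ 3`.
    · rw [mu, Set.mem_ofPred_eq, ← map_pow, pow_add, pow_add, pow_one, sq (Fintype.card F), pow_mul,
        FiniteField.pow_card, FiniteField.pow_card, ← sq, ← pow_succ, ht, map_one]
    · rw [← map_one (algebraMap F K), ← map_redForm, h0, map_zero]
  by_cases h0 : red1 b C D = 0
  · rcases isBasePoint_or_red_eq_zero h h0 with ⟨hbase, hb⟩ | ⟨h2, h3⟩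
    · exact ⟨0, -b, 1, hbase, by
        rw [zero_pow three_ne_zero]
        exact (pow_ne_zero 3 (neg_ne_zero.2 hb)).symm⟩
    -- Here the reduced cubic is identically zero, so it vanishes at `1`, an element of norm one.
    · exact absurd (by simp [redForm, h0, h2, h3]) (hredF 1 (one_pow 3))
  · obtain ⟨t, ht⟩ := exists_root_of_forall_mu_ne_zero (K := K) hFK (b := red2 b C D)
      (c := red3 b C D) h0 fun t ht h1 => hred t ht (by
        rw [← h1]
        simp only [redForm, red1, red2, red3, map_add, map_sub, map_mul, map_pow, map_ofNat]
        ring)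
    have ht' : redForm b C D t 1 = 0 := by
      rw [← ht, redForm]
      ring
    obtain ⟨z, hz⟩ := exists_isBasePoint_of_root h hD h0 ht'
    exact ⟨t, 1, z, hz, fun h3 => hredF t (by rw [h3, one_pow]) ht'⟩

theorem aeval_pentanomial (q : ℕ) (hq : 0 < q) {x : K} (hx : x ≠ 0) :
    Polynomial.aeval x (pentanomial q (b ^ 2) (2 * b) C D)
      = x * x ^ q * (x ^ q) ^ q * quad (algebraMap F K b) (algebraMap F K C) (algebraMap F K D)
        x⁻¹ (x ^ q)⁻¹ ((x ^ q) ^ q)⁻¹ := by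
  -- Keeps the truncated subtractions in the exponents `q ^ 2 + q - 1` and `q ^ 2 - q + 1` honest.
  have hq2 : q ≤ q ^ 2 := Nat.le_self_pow two_ne_zero q
  have h1 : x ^ (q ^ 2 + q - 1) = (x ^ q) ^ q * x ^ q / x := by
    rw [eq_div_iff hx, ← pow_succ, ← pow_mul, ← sq, ← pow_add]
    congr 1
    omega
  have h2 : x ^ (q ^ 2 - q + 1) = (x ^ q) ^ q * x / x ^ q := by
    rw [eq_div_iff (pow_ne_zero q hx), ← pow_add, ← pow_mul, ← sq, ← pow_succ]
    congr 1
    omega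
  have h3 : x ^ q ^ 2 = (x ^ q) ^ q := by rw [← pow_mul, sq]
  have hy : x ^ q ≠ 0 := pow_ne_zero q hx
  have hz : (x ^ q) ^ q ≠ 0 := pow_ne_zero q hy
  simp only [pentanomial, map_add, map_mul, map_pow, map_ofNat, Polynomial.aeval_C,
    Polynomial.aeval_X, h1, h2, h3, quad]
  generalize (x ^ q) ^ q = z at *
  generalize x ^ q = y at *
  field_simp
  ring

/-- On the finite field `K` injectivity suffices. Equal values of `f` at nonzero points give values
of the quadratic form that are proportional over `F`, so the points are proportional, and
homogeneity under scalars of `F` makes the factor `1`. -/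
theorem isPermutationPolynomial_pentanomial [Fintype F] (hFK : Module.finrank F K = 3) (h : ParamRel b C D)
    (hD : D ≠ b * C)
    (hred : ∀ t ∈ mu K (Fintype.card F ^ 2 + Fintype.card F + 1),
      redForm (algebraMap F K b) (algebraMap F K C) (algebraMap F K D) t 1 ≠ 0) :
    IsPermutationPolynomial K (pentanomial (Fintype.card F) (b ^ 2) (2 * b) C D) := by
  have : Module.Finite F K := Module.finite_of_finrank_pos (by omega)
  have : Finite K := Module.finite_of_finite F
  have : Fintype K := Fintype.ofFinite K
  set q := Fintype.card F with hq
  have hq0 : 0 < q := Fintype.card_pos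
  let σ : K →ₐ[F] K := FiniteField.frobeniusAlgHom F K
  have hσ : ∀ x, σ x = x ^ q := fun _ => rfl
  have h3 : ∀ x, σ (σ (σ x)) = x := fun x => by
    rw [hσ, hσ, hσ, ← pow_mul, ← pow_mul, ← pow_three, ← hFK, hq,
      ← Module.card_eq_pow_finrank (K := F) (V := K), FiniteField.pow_card]
  have hF : ∀ a : F, (σ : K →+* K) (algebraMap F K a) = algebraMap F K a := σ.commutes
  set b' := algebraMap F K b
  set C' := algebraMap F K C
  set D' := algebraMap F K D
  have hne : ∀ X : K, X ≠ 0 → quad b' C' D' X (σ X) (σ (σ X)) ≠ 0 := by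
    intro X hX h0
    have hX1 : σ X ≠ 0 := (map_ne_zero σ).2 hX
    have hX2 : σ (σ X) ≠ 0 := (map_ne_zero σ).2 hX1
    have h1 := congrArg (σ : K →+* K) h0
    rw [map_quad, hF, hF, hF, map_zero] at h1
    have h2 := congrArg (σ : K →+* K) h1
    rw [map_quad, hF, hF, hF, map_zero] at h2
    simp only [RingHom.coe_coe, h3] at h1 h2
    have hform := IsBasePoint.redForm_eq_zero ⟨h0, h1, h2⟩
    -- The easy direction of Hilbert 90: `X / σ X` has norm one. It is the dehomogenized zero of the
    -- reduced cubic.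
    refine hred (X / σ X) ?_ ?_
    · have hpow : (X / σ X) ^ (q ^ 2 + q + 1)
          = σ (σ (X / σ X)) * σ (X / σ X) * (X / σ X) := by
        rw [hσ (σ (X / σ X)), hσ (X / σ X)]
        ring
      rw [mu, Set.mem_ofPred_eq, hpow]
      simp only [map_div₀, h3]
      field_simp
    · refine (mul_eq_zero.1 (?_ : σ X ^ 3 * _ = 0)).resolve_left (pow_ne_zero 3 hX1)
      rw [← hform]
      unfold redForm
      field_simp
  obtain ⟨x, y, z, hbase, hxy⟩ := exists_isBasePoint hFK h hD hred
  have hbase' : IsBasePoint b' C' D' (algebraMap F K x) (algebraMap F K y) (algebraMap F K z) := by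
    obtain ⟨e1, e2, e3⟩ := hbase
    refine ⟨?_, ?_, ?_⟩ <;> rw [← map_quad]
    · rw [e1, map_zero]
    · rw [e2, map_zero]
    · rw [e3, map_zero]
  have hdet : circDet (algebraMap F K x) (algebraMap F K y) (algebraMap F K z) ≠ 0 := by
    rw [← map_circDet]
    exact (map_ne_zero _).2 (hbase.circDet_ne_zero hD hxy)
  set f : K → K := fun c => Polynomial.aeval c (pentanomial q (b ^ 2) (2 * b) C D) with hf
  have hval : ∀ X : K, X ≠ 0 →
      f X = X * σ X * σ (σ X) * quad b' C' D' X⁻¹ (σ X⁻¹) (σ (σ X⁻¹)) := by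
    intro X hX
    simp only [hf, map_inv₀]
    exact aeval_pentanomial q hq0 hX
  have hval0 : f 0 = 0 := by
    have hq2 : q ≤ q ^ 2 := Nat.le_self_pow two_ne_zero q
    have hq1 : q ^ 2 + q - 1 ≠ 0 := by omega
    simp [hf, pentanomial, hq1, hq0.ne']
  have hfne : ∀ X : K, X ≠ 0 → f X ≠ 0 := by
    intro X hX
    rw [hval X hX]
    have hX1 : σ X ≠ 0 := (map_ne_zero σ).2 hX
    exact mul_ne_zero (mul_ne_zero (mul_ne_zero hX hX1) ((map_ne_zero σ).2 hX1))
      (hne _ (inv_ne_zero hX))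
  refine Finite.injective_iff_bijective.1 ?_
  intro X X' hXX'
  change f X = f X' at hXX'
  by_cases hX : X = 0
  · by_contra hX'
    exact hfne X' (fun h' => hX' (hX.trans h'.symm)) (by rw [← hXX', hX, hval0])
  by_cases hX' : X' = 0
  · exact absurd (by rw [hXX', hX', hval0]) (hfne X hX)
  have hX1 : σ X ≠ 0 := (map_ne_zero σ).2 hX
  have hX2 : σ (σ X) ≠ 0 := (map_ne_zero σ).2 hX1
  have hX1' : σ X' ≠ 0 := (map_ne_zero σ).2 hX'
  have hX2' : σ (σ X') ≠ 0 := (map_ne_zero σ).2 hX1'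
  have hN := hXX'
  rw [hval X hX, hval X' hX'] at hN
  -- The scalar `c` is the quotient of the norms of `X'` and `X`, hence fixed by `σ`.
  obtain ⟨d, hd, hdX⟩ := hbase'.exists_fixed_smul_eq (σ := (σ : K →+* K)) h3 (hF x) (hF y) (hF z)
    hdet hne (X := X⁻¹) (X' := X'⁻¹)
    (c := (X' * σ X' * σ (σ X')) / (X * σ X * σ (σ X))) (inv_ne_zero hX')
    (by
      simp only [RingHom.coe_coe, map_div₀, map_mul, h3]
      congr 1 <;> ring)
    (by
      rw [div_mul_eq_mul_div, eq_div_iff (mul_ne_zero (mul_ne_zero hX hX1) hX2)]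
      simp only [RingHom.coe_coe]
      rw [← hN]
      ring)
  replace hd : σ d = d := hd
  have hX'd : X' = d * X := by
    linear_combination X * X' * hdX - X' * mul_inv_cancel₀ hX + d * X * mul_inv_cancel₀ hX'
  have hd0 : d ≠ 0 := by
    rintro rfl
    exact hX' (by rw [hX'd, zero_mul])
  -- For `d` fixed by `σ`, the norm factor scales by `d ^ 3` and the quadratic form in the inverses
  -- by `d⁻¹ ^ 2`.
  have hhom : f X' = d * f X := by
    rw [hval X hX, hval X' hX', hX'd]
    simp only [map_inv₀, map_mul, hd, quad]
    field_simp
  have hd1 : d = 1 := by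
    refine mul_right_cancel₀ (hfne X hX) ?_
    rw [← hhom, ← hXX', one_mul]
  rw [hX'd, hd1, one_mul]

end PermPentanomial

theorem theorem3p10 {F K : Type*} [Field F] [Fintype F] [Field K] [Algebra F K]
    (hFK : Module.finrank F K = 3) (q : ℕ) (hq : Fintype.card F = q)
    (A B C D : F) (hC : C ≠ 0) (hBA : B ^ 2 - 4 * A = 0)
    (hrel : A ^ 3 - A ^ 2 * C - A * B * D + A * B + A * C ^ 2 - B * C + D ^ 2 - D + 1 = 0)
    (h1 : A * C ^ 2 - B * C * D + D ^ 2 ≠ 0)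
    (h2 : A ^ 3 - 2 * A ^ 2 * C + A * B + A * C ^ 2 - B * C + 1 ≠ 0)
    (h3 : A ^ 3 - A * B ^ 2 * C + A * B + B ^ 2 * C ^ 2 - 2 * B * C + 1 ≠ 0)
    (h4 : B ^ 3 + 8 ≠ 0)
    (h5 : A * B - 3 * B * C + 2 * C ^ 3 + 2 ≠ 0)
    (hm : ∀ t ∈ PermPentanomial.mu K (q ^ 2 + q + 1),
      Polynomial.aeval t (PermPentanomial.mCubic A B C D) ≠ 0) :
    PermPentanomial.IsPermutationPolynomial K (PermPentanomial.pentanomial q A B C D) := by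
  subst hq
  -- In characteristic 2, `B ^ 2 = 4 * A` would force `B = 0`, and then `B ^ 3 + 8 = 0`.
  have hchar : (2 : F) ≠ 0 := by
    intro hchar
    have hB : B = 0 := pow_eq_zero_iff two_ne_zero |>.1 (by linear_combination hBA + 2 * A * hchar)
    exact h4 (by rw [hB]; linear_combination 4 * hchar)
  obtain ⟨b, rfl⟩ : ∃ b, B = 2 * b := ⟨B / 2, by field_simp⟩
  obtain rfl : A = b ^ 2 := by
    refine mul_left_cancel₀ (pow_ne_zero 2 hchar) ?_
    linear_combination -hBA
  have hparam : PermPentanomial.ParamRel b C D := by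
    unfold PermPentanomial.ParamRel
    linear_combination hrel
  refine PermPentanomial.isPermutationPolynomial_pentanomial hFK hparam ?_ fun t ht h0 => ?_
  -- With `A = b ^ 2` and `B = 2 * b`, the expression `A * C ^ 2 - B * C * D + D ^ 2` is the square
  -- of `D - b * C`.
  · rintro rfl
    exact h1 (by ring)
  · exact hm t ht (by rw [PermPentanomial.aeval_mCubic hparam, h0, mul_zero])
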